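/- **Setting.** Let $X$ be a (Hausdorff) complex manifold of dimension $3$ with a nowhere vanishing holomorphic $(3,0)$-form $\Omega$, let $\alpha'\in\mathbb R$ and $T>0$, and for each $t\in[0,T)$ let $\Phi(t)$ be a smooth closed $(2,2)$-form on $X$. Let $\omega(t)=i\,g_{\bar kj}(t)\,dz^j\wedge d\bar z^k$, $t\in[0,T)$, be a family of Hermitian metrics on $X$, smooth on $[0,T)\times X$. The norm $\|\Omega\|_\omega$ is defined by $\|\Omega\|_\omega^2\,\omega^3=i\,\Omega\wedge\bar\Omega$. Let $g^{p\bar\ell}$ be the inverse matrix, $g^{p\bar\ell}g_{\bar\ell q}=\delta^p_q$, and let $$R_{\bar kj}{}^p{}_q=-\partial_{\bar k}\big(g^{p\bar m}\partial_jg_{\bar mq}\big),\qquad Rm=R_{\bar kj}{}^p{}_q\,dz^j\wedge d\bar z^k,\qquad R_{\bar kj\bar\ell m}=g_{\bar\ell p}R_{\bar kj}{}^p{}_m,\qquad \tilde R_{\bar kj}=g^{p\bar q}R_{\bar qp\bar kj},$$ $$T_{\bar kjm}=\partial_jg_{\bar km}-\partial_mg_{\bar kj},\qquad \bar T_{k\bar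 j\bar m}=\partial_{\bar j}g_{\bar mk}-\partial_{\bar m}g_{\bar jk}$$ be the curvature of the Chern connection of $\omega$ on $T^{1,0}(X)$, its second Chern–Ricci curvature $\tilde R$, and the coefficients of the torsion $T=i\partial\omega$ and of its conjugate. Write $\Phi=\frac14\sum\Phi_{\bar ps\bar rq}\,dz^q\wedge d\bar z^r\wedge dz^s\wedge d\bar z^p$ with $\Phi_{\bar ps\bar rq}$ antisymmetric in $\bar p,\bar r$ and in $s,q$, and $$R_{[\bar ps}{}^\alpha{}_\beta R_{\bar rq]}{}^\beta{}_\alpha=R_{\bar ps}{}^\alpha{}_\beta R_{\bar rq}{}^\beta{}_\alpha-R_{\bar rs}{}^\alpha{}_\beta R_{\bar pq}{}^\beta{}_\alpha-R_{\bar pq}{}^\alpha{}_\beta R_{\bar rs}{}^\beta{}_\alpha+R_{\bar rq}{}^\alpha{}_\beta R_{\bar ps}{}^\beta{}_\alpha .$$ A Hermitian metric $\omega$ is called conformally balanced if $d(\|\Omega\|_\omega\,\omega^2)=0$. Consider, for $t\in[0,T)$, the Anomaly flow $$\partial_t\big(\|\Omega\|_\omega\,\omega^2\big)=i\partial\bar\partial\omega-\alpha'\big(\mathrm{Tr}\,Rm\wedge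 Rm-\Phi(t)\big)\qquad(1)$$ and the flow of the metric coefficients $$\partial_tg_{\bar pq}=\frac1{2\|\Omega\|_\omega}\Big[-\tilde R_{\bar pq}+g^{\alpha\bar\beta}g^{s\bar r}T_{\bar\beta sq}\bar T_{\alpha\bar r\bar p}-\alpha' g^{s\bar r}\big(R_{[\bar ps}{}^\alpha{}_\beta R_{\bar rq]}{}^\beta{}_\alpha-\Phi_{\bar ps\bar rq}\big)\Big].\qquad(2)$$ **Theorem 1.** Suppose that the initial metric $\omega(0)$ is conformally balanced. Then $\omega(t)$ solves (1) if and only if $\omega(t)$ is conformally balanced for every $t\in[0,T)$ and $g(t)$ solves (2). If moreover $X$ is compact, then $\omega(t)$ solves (1) if and only if $g(t)$ solves (2). -/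

import Mathlib

open Set
open scoped Manifold ContDiff ComplexConjugate Nat

noncomputable section

namespace AnomalyFlow

/-! ### Differential forms with complex coefficients on an open subset of `ℂ³` -/

/-- The model space `ℂ³` with coordinates `z⁰, z¹, z²`. -/
abbrev C3 : Type := Fin 3 → ℂ

/-- Labels of the complexified coordinate frame: `Sum.inl j` stands for `∂/∂zʲ` (dually `dzʲ`),
`Sum.inr k` stands for `∂/∂z̄ᵏ` (dually `dz̄ᵏ`). -/
abbrev Idx : Type := Fin 3 ⊕ Fin 3

/-- The values of a complex `n`-form at one point on all `n`-tuples of frame vectors.  An alternating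
array `α` represents the form `(1/n!) ∑ₐ α(a) θ^{a₀} ∧ ⋯ ∧ θ^{aₙ₋₁}`, where `θ` is the coframe
`dzʲ, dz̄ᵏ`. -/
abbrev Form (n : ℕ) : Type := (Fin n → Idx) → ℂ

/-- The exterior product, normalised so that `(dzʲ ∧ dz̄ᵏ)(∂/∂zʲ, ∂/∂z̄ᵏ) = 1`. -/
def wedge {k l : ℕ} (α : Form k) (β : Form l) : Form (k + l) := fun a =>
  ((k ! * l ! : ℕ) : ℂ)⁻¹ * ∑ σ : Equiv.Perm (Fin (k + l)), ((Equiv.Perm.sign σ : ℤ) : ℂ) *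
    (α (fun i => a (σ (Fin.castAdd l i))) * β (fun i => a (σ (Fin.natAdd k i))))

/-- The Wirtinger derivative `∂f/∂zʲ = (∂f/∂xʲ - i ∂f/∂yʲ) / 2`. -/
def dHol (j : Fin 3) (f : C3 → ℂ) (z : C3) : ℂ :=
  (fderiv ℝ f z (Pi.single j 1) - Complex.I * fderiv ℝ f z (Pi.single j Complex.I)) / 2

/-- The Wirtinger derivative `∂f/∂z̄ᵏ = (∂f/∂xᵏ + i ∂f/∂yᵏ) / 2`. -/
def dAnti (k : Fin 3) (f : C3 → ℂ) (z : C3) : ℂ :=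
  (fderiv ℝ f z (Pi.single k 1) + Complex.I * fderiv ℝ f z (Pi.single k Complex.I)) / 2

/-- The operator `∂` on forms, `∂α = ∑ⱼ dzʲ ∧ ∂α/∂zʲ`. -/
def delForm {n : ℕ} (α : C3 → Form n) (z : C3) : Form (n + 1) := fun a =>
  ∑ i : Fin (n + 1), (-1 : ℂ) ^ (i : ℕ) *
    Sum.elim (fun j => dHol j (fun w => α w (fun r => a (i.succAbove r))) z) (fun _ => 0) (a i)

/-- The operator `∂̄` on forms, `∂̄α = ∑ₖ dz̄ᵏ ∧ ∂α/∂z̄ᵏ`. -/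
def delbarForm {n : ℕ} (α : C3 → Form n) (z : C3) : Form (n + 1) := fun a =>
  ∑ i : Fin (n + 1), (-1 : ℂ) ^ (i : ℕ) *
    Sum.elim (fun _ => 0) (fun k => dAnti k (fun w => α w (fun r => a (i.succAbove r))) z) (a i)

/-- The exterior derivative `d = ∂ + ∂̄`. -/
def dForm {n : ℕ} (α : C3 → Form n) (z : C3) : Form (n + 1) :=
  delForm α z + delbarForm α z

/-- The `(1,1)`-form `∑ h k j dzʲ ∧ dz̄ᵏ`. -/
def oneOneForm (h : Matrix (Fin 3) (Fin 3) ℂ) : Form 2 := fun a =>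
  match a 0, a 1 with
  | Sum.inl j, Sum.inr k => h k j
  | Sum.inr k, Sum.inl j => -h k j
  | _, _ => 0

/-! ### Local Hermitian geometry

A Hermitian metric is given by the matrix function `G z k j = g_{k̄j}(z)`.  Its inverse matrix
`(G z)⁻¹ p l` is `g^{p l̄}`, that is `∑ₗ g^{p l̄} g_{l̄ q} = δᵖ_q`. -/

/-- The Hermitian form `ω = i g_{k̄j} dzʲ ∧ dz̄ᵏ`. -/
def omegaForm (G : Matrix (Fin 3) (Fin 3) ℂ) : Form 2 := oneOneForm (Complex.I • G)

/-- The `(3,0)`-form `f dz⁰ ∧ dz¹ ∧ dz²`. -/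
def volForm (f : ℂ) : Form 3 := fun a =>
  f * Matrix.det (Matrix.of fun i j : Fin 3 => if a i = Sum.inl j then (1 : ℂ) else 0)

/-- The conjugate `(0,3)`-form `f̄ dz̄⁰ ∧ dz̄¹ ∧ dz̄²`. -/
def volFormConj (f : ℂ) : Form 3 := fun a =>
  conj f * Matrix.det (Matrix.of fun i j : Fin 3 => if a i = Sum.inr j then (1 : ℂ) else 0)

/-- The coordinate frame `∂/∂z⁰, ∂/∂z¹, ∂/∂z², ∂/∂z̄⁰, ∂/∂z̄¹, ∂/∂z̄²`. -/
def topIdx : Fin 6 → Idx :=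
  ![Sum.inl 0, Sum.inl 1, Sum.inl 2, Sum.inr 0, Sum.inr 1, Sum.inr 2]

/-- The norm `‖Ω‖_ω` of `Ω = f dz⁰ ∧ dz¹ ∧ dz²`, where `‖Ω‖_ω² = i Ω ∧ Ω̄ / ω³` is the quotient of
two forms of top degree. -/
def volNorm (f : ℂ) (G : Matrix (Fin 3) (Fin 3) ℂ) : ℝ :=
  Real.sqrt ((Complex.I * wedge (volForm f) (volFormConj f) topIdx) /
    wedge (wedge (omegaForm G) (omegaForm G)) (omegaForm G) topIdx).re

/-- The `(2,2)`-form `‖Ω‖_ω ω²`. -/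
def balancedForm (f : ℂ) (G : Matrix (Fin 3) (Fin 3) ℂ) : Form 4 :=
  (volNorm f G : ℂ) • wedge (omegaForm G) (omegaForm G)

section Tensors

variable (G : C3 → Matrix (Fin 3) (Fin 3) ℂ)

/-- The torsion coefficients `T_{k̄jm} = ∂ⱼ g_{k̄m} - ∂ₘ g_{k̄j}`, that is, those of
`T = i∂ω = (1/2) T_{k̄jm} dzᵐ ∧ dzʲ ∧ dz̄ᵏ`. -/
def torsion (k j m : Fin 3) (z : C3) : ℂ :=
  dHol j (fun w => G w k m) z - dHol m (fun w => G w k j) z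

/-- The conjugate torsion coefficients `T̄_{k j̄ m̄} = ∂_{j̄} g_{m̄k} - ∂_{m̄} g_{j̄k}`. -/
def torsionConj (k j m : Fin 3) (z : C3) : ℂ :=
  dAnti j (fun w => G w m k) z - dAnti m (fun w => G w j k) z

/-- The coefficients `A_j{}^p{}_q = g^{p m̄} ∂ⱼ g_{m̄q}` of the Chern connection. -/
def chernConn (j p q : Fin 3) (z : C3) : ℂ :=
  ∑ m, (G z)⁻¹ p m * dHol j (fun w => G w m q) z

/-- The curvature `R_{k̄j}{}^p{}_q = -∂_{k̄} A_j{}^p{}_q` of the Chern connection. -/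
def curv (k j p q : Fin 3) (z : C3) : ℂ := -dAnti k (chernConn G j p q) z

/-- The curvature with lowered index, `R_{k̄j l̄m} = g_{l̄p} R_{k̄j}{}^p{}_m`. -/
def curvLow (k j l m : Fin 3) (z : C3) : ℂ := ∑ p, G z l p * curv G k j p m z

/-- The second Chern-Ricci curvature `R̃_{k̄j} = R^p{}_{p k̄j} = g^{p q̄} R_{q̄p k̄j}`. -/
def ricciTilde (k j : Fin 3) (z : C3) : ℂ := ∑ p, ∑ q, (G z)⁻¹ p q * curvLow G q p k j z

/-- The entry `(p,q)` of the curvature form `Rm = R_{k̄j}{}^p{}_q dzʲ ∧ dz̄ᵏ`, an endomorphism-valued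
`(1,1)`-form. -/
def curvForm (p q : Fin 3) (z : C3) : Form 2 :=
  oneOneForm (Matrix.of fun k j => curv G k j p q z)

/-- The `(2,2)`-form `Tr (Rm ∧ Rm)`. -/
def traceRmRm (z : C3) : Form 4 :=
  ∑ p, ∑ q, wedge (curvForm G p q z) (curvForm G q p z)

/-- The `(2,2)`-form `i∂∂̄ω`. -/
def iddbarOmega (z : C3) : Form 4 :=
  Complex.I • delForm (delbarForm (fun w => omegaForm (G w))) z

/-- `R_{p̄s}{}^α{}_β R_{r̄q}{}^β{}_α`. -/
def curvSq (p s r q : Fin 3) (z : C3) : ℂ := ∑ α, ∑ β, curv G p s α β z * curv G r q β α z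

/-- `R_{[p̄s}{}^α{}_β R_{r̄q]}{}^β{}_α`: the signed sum over the permutations of the barred indices
`p, r` and, separately, over those of the unbarred indices `s, q`. -/
def curvSqAlt (p s r q : Fin 3) (z : C3) : ℂ :=
  curvSq G p s r q z - curvSq G r s p q z - curvSq G p q r s z + curvSq G r q p s z

/-- The right-hand side
`(2‖Ω‖)⁻¹ [-R̃_{p̄q} + g^{αβ̄} g^{sr̄} T_{β̄sq} T̄_{αr̄p̄} - α' g^{sr̄} (R_{[p̄s} R_{r̄q]} - Φ_{p̄sr̄q})]`
of the flow of the metric, where `Φ_{p̄sr̄q} = Φ(∂_q, ∂_{r̄}, ∂_s, ∂_{p̄})`, that is,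
`Φ = (1/4) ∑ Φ_{p̄sr̄q} dz^q ∧ dz̄^r ∧ dz^s ∧ dz̄^p`. -/
def metricSpeed (f : C3 → ℂ) (slope : ℝ) (Φ : C3 → Form 4) (p q : Fin 3) (z : C3) : ℂ :=
  (1 / (2 * (volNorm (f z) (G z) : ℂ))) *
    (-ricciTilde G p q z
      + ∑ α, ∑ β, ∑ s, ∑ r, (G z)⁻¹ α β * (G z)⁻¹ s r *
          torsion G β s q z * torsionConj G α r p z
      - (slope : ℂ) * ∑ s, ∑ r, (G z)⁻¹ s r *
          (curvSqAlt G p s r q z - Φ z ![Sum.inl q, Sum.inr r, Sum.inl s, Sum.inr p]))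

end Tensors

/-! ### Tensor fields on a complex threefold and their components in charts -/

section Manifold

variable (X : Type*) [TopologicalSpace X] [ChartedSpace C3 X]

variable {X} in
/-- The vector tangent to `X` at the point with coordinate `z` in the chart `e` that corresponds to
`v ∈ ℂ³`. -/
def coordVec (e : OpenPartialHomeomorph X C3) (z : C3) (v : C3) :
    TangentSpace 𝓘(ℂ, C3) (e.symm z) :=
  mfderiv 𝓘(ℂ, C3) 𝓘(ℂ, C3) e.symm z v

/-- A Hermitian inner product on every holomorphic tangent space, conjugate-linear in the first
argument. -/
structure HermitianMetric where
  /-- The inner product at a point. -/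
  inner : ∀ x : X, TangentSpace 𝓘(ℂ, C3) x →ₗ⋆[ℂ] TangentSpace 𝓘(ℂ, C3) x →ₗ[ℂ] ℂ
  conj_symm : ∀ x u v, conj (inner x u v) = inner x v u
  pos : ∀ x v, v ≠ 0 → 0 < (inner x v v).re

variable {X} in
/-- The components `g_{k̄j}` of a Hermitian metric in a chart. -/
def HermitianMetric.coeff (g : HermitianMetric X) (e : OpenPartialHomeomorph X C3) (z : C3) :
    Matrix (Fin 3) (Fin 3) ℂ :=
  Matrix.of fun k j =>
    g.inner (e.symm z) (coordVec e z (Pi.single k 1)) (coordVec e z (Pi.single j 1))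

/-- A nowhere vanishing holomorphic `(3,0)`-form. -/
structure HolVolumeForm where
  /-- The form at a point. -/
  form : ∀ x : X, TangentSpace 𝓘(ℂ, C3) x [⋀^Fin 3]→ₗ[ℂ] ℂ
  holomorphic : ∀ e ∈ atlas C3 X, DifferentiableOn ℂ
    (fun z => form (e.symm z) (fun i => coordVec e z (Pi.single i 1))) e.target
  ne_zero : ∀ x, form x ≠ 0

variable {X} in
/-- The function `f` with `Ω = f dz⁰ ∧ dz¹ ∧ dz²` in a chart. -/
def HolVolumeForm.coeff (Ω : HolVolumeForm X) (e : OpenPartialHomeomorph X C3) (z : C3) : ℂ :=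
  Ω.form (e.symm z) (fun i => coordVec e z (Pi.single i 1))

/-- A complex-valued differential form of degree `n` on the underlying real manifold (without
regularity). -/
abbrev RealForm (n : ℕ) : Type _ := ∀ x : X, TangentSpace 𝓘(ℂ, C3) x [⋀^Fin n]→ₗ[ℝ] ℂ

/-- The coefficients of `∂/∂zʲ = (1/2) ∂/∂xʲ - (i/2) ∂/∂yʲ` and `∂/∂z̄ᵏ = (1/2) ∂/∂xᵏ + (i/2) ∂/∂yᵏ`;
`false` stands for `∂/∂x` and `true` for `∂/∂y`. -/
def frameCoeff : Idx → Bool → ℂ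
  | _, false => 1 / 2
  | Sum.inl _, true => -Complex.I / 2
  | Sum.inr _, true => Complex.I / 2

/-- The real coordinate vectors `∂/∂xʲ` (`false`) and `∂/∂yʲ` (`true`) in `ℂ³` that enter into the
frame vector with the given label. -/
def frameVec (a : Idx) (s : Bool) : C3 :=
  Pi.single (Sum.elim id id a) (if s then Complex.I else 1)

variable {X} in
/-- The components of a form in a chart: its complex-multilinear extension evaluated on the frame
vectors `∂/∂zʲ`, `∂/∂z̄ᵏ`. -/
def RealForm.coeff {n : ℕ} (Φ : RealForm X n) (e : OpenPartialHomeomorph X C3) (z : C3) : Form n :=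
  fun a => ∑ s : Fin n → Bool, (∏ i, frameCoeff (a i) (s i)) *
    Φ (e.symm z) (fun i => coordVec e z (frameVec (a i) (s i)))

variable {X}

/-- `Φ` is a smooth closed `(2,2)`-form. -/
structure IsClosedTwoTwoForm (Φ : RealForm X 4) : Prop where
  smooth : ∀ e ∈ atlas C3 X, ∀ a, ContDiffOn ℝ ∞ (fun z => Φ.coeff e z a) e.target
  type : ∀ e ∈ atlas C3 X, ∀ z ∈ e.target, ∀ a : Fin 4 → Idx, Φ.coeff e z a ≠ 0 →
    (Finset.univ.filter fun i => (a i).isLeft = true).card = 2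
  closed : ∀ e ∈ atlas C3 X, ∀ z ∈ e.target, dForm (Φ.coeff e) z = 0

/-- `g(t)`, `0 ≤ t < T`, is a smooth family of Hermitian metrics. -/
def IsSmoothFamily (T : ℝ) (g : ℝ → HermitianMetric X) : Prop :=
  ∀ e ∈ atlas C3 X, ∀ k j, ContDiffOn ℝ ∞
    (fun p : ℝ × C3 => (g p.1).coeff e p.2 k j) (Ico 0 T ×ˢ e.target)

/-- The conformally balanced condition `d(‖Ω‖_ω ω²) = 0`. -/
def IsConformallyBalanced (Ω : HolVolumeForm X) (g : HermitianMetric X) : Prop :=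
  ∀ e ∈ atlas C3 X, ∀ z ∈ e.target,
    dForm (fun w => balancedForm (Ω.coeff e w) (g.coeff e w)) z = 0

/-- The Anomaly flow `∂ₜ(‖Ω‖_ω ω²) = i∂∂̄ω - α'(Tr (Rm ∧ Rm) - Φ(t))` for `0 ≤ t < T`. -/
def IsAnomalyFlow (Ω : HolVolumeForm X) (slope T : ℝ) (Φ : ℝ → RealForm X 4)
    (g : ℝ → HermitianMetric X) : Prop :=
  ∀ t ∈ Ico 0 T, ∀ e ∈ atlas C3 X, ∀ z ∈ e.target, ∀ a : Fin 4 → Idx,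
    HasDerivWithinAt (fun s => balancedForm (Ω.coeff e z) ((g s).coeff e z) a)
      (iddbarOmega ((g t).coeff e) z a
        - (slope : ℂ) * (traceRmRm ((g t).coeff e) z a - (Φ t).coeff e z a))
      (Ico 0 T) t

/-- The flow of the metric coefficients
`∂ₜ g_{p̄q} = (2‖Ω‖)⁻¹ [-R̃_{p̄q} + g^{αβ̄} g^{sr̄} T_{β̄sq} T̄_{αr̄p̄} - α' g^{sr̄} (R_{[p̄s} R_{r̄q]} - Φ_{p̄sr̄q})]`
for `0 ≤ t < T`. -/
def IsMetricFlow (Ω : HolVolumeForm X) (slope T : ℝ) (Φ : ℝ → RealForm X 4)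
    (g : ℝ → HermitianMetric X) : Prop :=
  ∀ t ∈ Ico 0 T, ∀ e ∈ atlas C3 X, ∀ z ∈ e.target, ∀ p q : Fin 3,
    HasDerivWithinAt (fun s => (g s).coeff e z p q)
      (metricSpeed ((g t).coeff e) (Ω.coeff e) slope ((Φ t).coeff e) p q z)
      (Ico 0 T) t

end Manifold

end AnomalyFlow

end

/-! Write θ for the (1,0)-form `lee`, twice the difference of the torsion trace and ∂ log ‖Ω‖, and H
for the inverse metric. In dimension three an alternating (2,2)-array Ψ amounts to a 3×3 matrix, its
components at (j+1, k+1, j+2, k+2) with indices mod 3, and Ψ is closed exactly when both divergences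
of this matrix vanish (`dForm_eq_zero_iff`). For ‖Ω‖ω² the matrix is -2V with V = ‖Ω‖ det(g) H
(`dual_balanced`), and 2∂_k̄ V^{jk} = -V^{jk} θ̄_k (`two_mul_div_cofactor`). So a metric is
conformally balanced if and only if θ = 0 (`isConformallyBalanced_iff`).

The two flows are related by contraction with H. For every Hermitian metric, the contraction of
∂ₜ(‖Ω‖ω²) is 2‖Ω‖∂ₜg (`contract_dt_balanced`), and that of i∂∂̄ω is -R̃ + T·T̄ - L/2 with L = ∂̄θ +
∂θ̄ (`contract_ddbar`). Thus the metric flow says that the residual of the Anomaly flow contracts to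
L/2 (`isMetricFlow_iff`). In dimension three a (2,2)-array can be recovered from its contraction
(`two_mul_dual_eq`), so both flows agree when θ vanishes throughout
(`isAnomalyFlow_iff_isMetricFlow`). Under the Anomaly flow it does: the right-hand side is closed,
hence div V is constant in time (`isConformallyBalanced_of_isAnomalyFlow`). This gives the first
equivalence.

On a compact manifold it remains to derive θ = 0 from the metric flow alone. Recovering the residual
from L/2 and taking its divergence gives an evolution equation for Vθ̄
(`divergenceEquation_of_isMetricFlow`). Its right-hand side contains terms of the form ∂̄∂̄θ besides
the Laplacian; they cancel because ∂_j∂_k̄ V^{jk} is real (`div_lee_sub_mem`). What is left is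
2‖Ω‖∂ₜθ̄ = Δθ̄ plus terms linear in θ, θ̄ and their first derivatives (`parabolic_leeConj`). Hence
(2‖Ω‖∂ₜ - Δ)|θ|² ≤ C|θ|², once the gradient term has absorbed the mixed error
(`exists_parabolic_bound`). As |θ|² is independent of the chart (`eval_leeNormSq_transition`) and
vanishes at t = 0, the maximum principle `IsGlobal.density_nonpos` makes it vanish for all times.

All tensor identities are proved in a commutative ring with commuting derivations and a conjugation,
realised by the smooth functions on [0,T) times a chart domain. Lower-order terms are membership in
ideals of this ring, which turns into pointwise bounds with continuous coefficients only at the end.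
-/

noncomputable section

namespace AnomalyFlow

/-! ### The algebra of smooth functions on a set with unique derivatives -/

section SmoothAlgebra

open Classical in
/-- Extension by zero of a function on a set. -/
def extendZero {E : Type*} {S : Set E} (f : S → ℂ) (p : E) : ℂ := if h : p ∈ S then f ⟨p, h⟩ else 0

theorem extendZero_of_mem {E : Type*} {S : Set E} (f : S → ℂ) {p : E} (h : p ∈ S) :
    extendZero f p = f ⟨p, h⟩ := dif_pos h

variable {E : Type*} [NormedAddCommGroup E] [NormedSpace ℝ E]

/-- The algebra of complex functions that are smooth on a set. -/
def SmoothAlg (S : Set E) : Subalgebra ℂ (S → ℂ) where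
  carrier := {f | ContDiffOn ℝ ∞ (extendZero f) S}
  mul_mem' {a b} ha hb := by
    refine (ContDiffOn.mul ha hb).congr fun p hp => ?_
    simp [extendZero_of_mem _ hp]
  add_mem' {a b} ha hb := by
    refine (ContDiffOn.add ha hb).congr fun p hp => ?_
    simp [extendZero_of_mem _ hp]
  algebraMap_mem' c := by
    refine (contDiffOn_const (c := c)).congr fun p hp => ?_
    simp [extendZero_of_mem _ hp]

namespace SmoothAlg

variable {S : Set E}

/-- Restriction of a function that is smooth on `S`. -/
def of (F : E → ℂ) (hF : ContDiffOn ℝ ∞ F S) : SmoothAlg S :=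
  ⟨fun p => F p, hF.congr fun p hp => by simp [extendZero_of_mem _ hp]⟩

/-- Evaluation at a point. -/
def eval (p : S) : SmoothAlg S →ₐ[ℂ] ℂ := (Pi.evalAlgHom ℂ (fun _ : S => ℂ) p).comp (SmoothAlg S).val

theorem eval_apply (p : S) (f : SmoothAlg S) : eval p f = f.1 p := rfl

@[simp] theorem eval_of (p : S) (F : E → ℂ) (hF : ContDiffOn ℝ ∞ F S) :
    eval p (of F hF) = F p := rfl

theorem ext_eval {f g : SmoothAlg S} (h : ∀ p, eval p f = eval p g) : f = g :=
  Subtype.ext (funext h)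

/-- The function on the whole space underlying an element of the algebra. -/
def fn (f : SmoothAlg S) : E → ℂ := extendZero f.1

theorem fn_of_mem (f : SmoothAlg S) {p : E} (hp : p ∈ S) : fn f p = eval ⟨p, hp⟩ f :=
  extendZero_of_mem _ hp

theorem contDiffOn_fn (f : SmoothAlg S) : ContDiffOn ℝ ∞ (fn f) S := f.2

theorem continuous_eval (f : SmoothAlg S) : Continuous fun p : S => eval p f := by
  have := (contDiffOn_fn f).continuousOn
  rw [continuousOn_iff_continuous_domRestrict] at this
  refine this.congr fun p => ?_
  simp [fn_of_mem f p.2]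

theorem isUnit_of_eval_ne_zero {f : SmoothAlg S} (h : ∀ p, eval p f ≠ 0) : IsUnit f := by
  have hs : ContDiffOn ℝ ∞ (fun p => (fn f p)⁻¹) S :=
    (contDiffOn_fn f).inv fun p hp => by rw [fn_of_mem f hp]; exact h _
  refine IsUnit.of_mul_eq_one (of _ hs) (ext_eval fun p => ?_)
  rw [map_mul, eval_of, fn_of_mem f p.2, map_one]
  exact mul_inv_cancel₀ (h p)

/-- Complex conjugation of smooth functions. -/
def conjHom : SmoothAlg S →+* SmoothAlg S where
  toFun f := ⟨fun p => conj (eval p f), (Complex.conjCLE.contDiff.comp_contDiffOn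
    (contDiffOn_fn f)).congr fun p hp => by simp [extendZero_of_mem _ hp, fn_of_mem f hp]⟩
  map_one' := ext_eval fun p => by simp [eval_apply]
  map_mul' a b := ext_eval fun p => by simp [eval_apply]
  map_zero' := ext_eval fun p => by simp [eval_apply]
  map_add' a b := ext_eval fun p => by simp [eval_apply]

@[simp] theorem eval_conjHom (p : S) (f : SmoothAlg S) : eval p (conjHom f) = conj (eval p f) := rfl

theorem differentiableOn_fn (f : SmoothAlg S) : DifferentiableOn ℝ (fn f) S :=
  (contDiffOn_fn f).differentiableOn (by simp)

theorem fderivWithin_fn_eq {F G : E → ℂ} (h : ∀ p ∈ S, F p = G p)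
    {p : E} (hp : p ∈ S) : fderivWithin ℝ F S p = fderivWithin ℝ G S p :=
  fderivWithin_congr h (h p hp)

/-- The directional derivative as a derivation of the algebra of smooth functions. -/
def dirDeriv (hS : UniqueDiffOn ℝ S) (v : E) : Derivation ℂ (SmoothAlg S) (SmoothAlg S) :=
  Derivation.mk'
    { toFun := fun f => of (fun p => fderivWithin ℝ (fn f) S p v)
        (((contDiffOn_fn f).fderivWithin hS (by simp)).clm_apply contDiffOn_const)
      map_add' := fun f g => ext_eval fun p => by
        simp only [eval_of, map_add]
        rw [fderivWithin_fn_eq (G := fn f + fn g) (fun q hq => by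
            simp [fn_of_mem _ hq]) p.2,
          fderivWithin_add (hS p p.2) ((differentiableOn_fn f) p p.2) ((differentiableOn_fn g) p p.2)]
        rfl
      map_smul' := fun c f => ext_eval fun p => by
        simp only [eval_of, map_smul, RingHom.id_apply]
        rw [fderivWithin_fn_eq (G := c • fn f) (fun q hq => by
            simp [fn_of_mem _ hq]) p.2,
          fderivWithin_const_smul (hS p p.2) ((differentiableOn_fn f) p p.2)]
        rfl }
    (fun f g => ext_eval fun p => by
      simp only [LinearMap.coe_mk, AddHom.coe_mk, eval_of, map_add, smul_eq_mul, map_mul]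
      rw [fderivWithin_fn_eq (G := fun q => fn f q * fn g q) (fun q hq => by
            simp [fn_of_mem _ hq]) p.2,
        fderivWithin_fun_mul (hS p p.2) ((differentiableOn_fn f) p p.2) ((differentiableOn_fn g) p p.2)]
      simp [fn_of_mem _ p.2])

theorem eval_dirDeriv (hS : UniqueDiffOn ℝ S) (v : E) (f : SmoothAlg S) (p : S) :
    eval p (dirDeriv hS v f) = fderivWithin ℝ (fn f) S p v := rfl

theorem conjHom_dirDeriv (hS : UniqueDiffOn ℝ S) (v : E) (f : SmoothAlg S) :
    conjHom (dirDeriv hS v f) = dirDeriv hS v (conjHom f) := ext_eval fun p => by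
  rw [eval_conjHom, eval_dirDeriv, eval_dirDeriv,
    fderivWithin_fn_eq (F := fn (conjHom f)) (G := fun q => Complex.conjCLE (fn f q))
      (fun q hq => by simp [fn_of_mem _ hq]) p.2]
  have h := (((Complex.conjCLE : ℂ ≃L[ℝ] ℂ).toContinuousLinearMap.hasFDerivAt.comp_hasFDerivWithinAt
    (p : E) ((differentiableOn_fn f) p p.2).hasFDerivWithinAt).fderivWithin (hS p p.2))
  exact (congrArg (fun L => L v) h).symm

/-- The space-time domain contains its boundary t = 0. Second derivatives are symmetric there too,
as limits from the interior; this is the role of the closure hypothesis. -/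
theorem dirDeriv_comm (hS : UniqueDiffOn ℝ S) (hcl : S ⊆ closure (interior S)) (v w : E)
    (f : SmoothAlg S) : dirDeriv hS v (dirDeriv hS w f) = dirDeriv hS w (dirDeriv hS v f) :=
  ext_eval fun p => by
    have hsym : IsSymmSndFDerivWithinAt ℝ (fn f) S p :=
      ((contDiffOn_fn f) p p.2).isSymmSndFDerivWithinAt
        (by simpa using WithTop.coe_le_coe.2 (le_top : (2 : ℕ∞) ≤ ⊤)) hS (hcl p.2) p.2
    have key : ∀ v w : E, eval p (dirDeriv hS v (dirDeriv hS w f)) =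
        fderivWithin ℝ (fderivWithin ℝ (fn f) S) S p v w := by
      intro v w
      have hd : DifferentiableWithinAt ℝ (fderivWithin ℝ (fn f) S) S p :=
        ((contDiffOn_fn f).fderivWithin (m := ∞) hS (by simp)).differentiableOn (by simp) p p.2
      rw [eval_dirDeriv, fderivWithin_fn_eq (G := fun q => fderivWithin ℝ (fn f) S q w)
        (fun q hq => by rw [fn_of_mem _ hq, eval_dirDeriv]) p.2]
      rw [(hd.hasFDerivWithinAt.clm_apply (hasFDerivWithinAt_const w (p : E) S)).fderivWithin
        (hS p p.2)]
      simp
    rw [key, key]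
    exact hsym v w

end SmoothAlg

end SmoothAlgebra

/-! ### Linear algebra of `(2,2)`-arrays -/

/-- An array antisymmetric in its two unbarred (first and third) and in its two barred (second and
fourth) indices is determined by its contraction with a nonsingular matrix. -/
theorem two_mul_dual_eq {K : Type*} [CommRing K] {G H : Matrix (Fin 3) (Fin 3) K} (hGH : G * H = 1)
    (X : Fin 3 → Fin 3 → Fin 3 → Fin 3 → K) (Y : Matrix (Fin 3) (Fin 3) K)
    (hdiag : ∀ q r p, X q r q p = 0) (hdiag' : ∀ q r s, X q r s r = 0)
    (hswap : ∀ q r s p, X s r q p = -X q r s p) (hswap' : ∀ q r s p, X q p s r = -X q r s p)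
    (hY : ∀ p q, ∑ s, ∑ r, H s r * X q r s p = Y p q) (j k : Fin 3) :
    2 * X (j + 1) (k + 1) (j + 2) (k + 2) =
      G.det * (2 * (H * Y * H) j k - (H * Y).trace * H j k) := by
  have hHG : H * G = 1 := mul_eq_one_comm.1 hGH
  have hdet : G.det * H.det = 1 := by rw [← Matrix.det_mul, hGH, Matrix.det_one]
  have hadj : H.adjugate = H.det • G := by
    have := congrArg (· * G) (Matrix.adjugate_mul H)
    simpa [Matrix.mul_assoc, hHG] using this
  set x : Matrix (Fin 3) (Fin 3) K := Matrix.of fun j k => X (j + 1) (k + 1) (j + 2) (k + 2) with hx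
  -- The contraction is linear in the dual matrix `x`; the minors of H in it form the adjugate. Once
  -- adj H = det(H) G is inserted, the trace can be solved for.
  have hYH : Y * H = H.adjugate * x - (H.adjugate * x).trace • (1 : Matrix (Fin 3) (Fin 3) K) := by
    ext p b
    simp only [Matrix.sub_apply, Matrix.smul_apply, Matrix.mul_apply, Matrix.trace, Matrix.diag_apply,
      Fin.sum_univ_three, ← hY, Matrix.adjugate_fin_three, hx, Matrix.of_apply]
    fin_cases p <;> fin_cases b <;>
      simp [hdiag, hdiag', hswap 0 _ 1, hswap 0 _ 2, hswap 1 _ 2, hswap' _ 0 _ 1, hswap' _ 0 _ 2,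
        hswap' _ 1 _ 2] <;> ring
  rw [hadj, smul_mul_assoc] at hYH
  have h1 : H * Y * H = H.det • x - (H.det * (G * x).trace) • H := by
    rw [Matrix.mul_assoc, hYH]
    simp [mul_sub, ← Matrix.mul_assoc, hHG]
  have h2 : (H * Y).trace = -2 * (H.det * (G * x).trace) := by
    rw [Matrix.trace_mul_comm, hYH]
    simp
    ring
  rw [h1, h2]
  change 2 * x j k = _
  simp only [Matrix.sub_apply, Matrix.smul_apply, smul_eq_mul]
  linear_combination (-2 * x j k) * hdet

/-! ### Hermitian geometry in differential algebra -/

/-- Commuting derivations `∂/∂zʲ`, `∂/∂z̄ᵏ`, `∂/∂t` and a conjugation on a `ℂ`-algebra. -/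
structure Wirtinger (A : Type*) [CommRing A] [Algebra ℂ A] where
  /-- The derivation `∂/∂zʲ`. -/
  D : Fin 3 → Derivation ℂ A A
  /-- The derivation `∂/∂z̄ᵏ`. -/
  B : Fin 3 → Derivation ℂ A A
  /-- The derivation `∂/∂t`. -/
  dt : Derivation ℂ A A
  /-- The conjugation. -/
  c : A →+* A
  c_c : ∀ x, c (c x) = x
  c_D : ∀ j x, c (D j x) = B j (c x)
  c_dt : ∀ x, c (dt x) = dt (c x)
  D_D : ∀ i j x, D i (D j x) = D j (D i x)
  D_B : ∀ i j x, D i (B j x) = B j (D i x)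
  dt_D : ∀ j x, dt (D j x) = D j (dt x)

namespace Wirtinger

variable {A : Type*} [CommRing A] [Algebra ℂ A] (W : Wirtinger A)

theorem c_B (j : Fin 3) (x : A) : W.c (W.B j x) = W.D j (W.c x) := by
  rw [← W.c_c (W.D j (W.c x)), W.c_D, W.c_c]

theorem B_B (i j : Fin 3) (x : A) : W.B i (W.B j x) = W.B j (W.B i x) := by
  rw [← W.c_c x, ← W.c_D, ← W.c_D, ← W.c_D, ← W.c_D, W.D_D]

theorem dt_B (j : Fin 3) (x : A) : W.dt (W.B j x) = W.B j (W.dt x) := by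
  rw [← W.c_c x, ← W.c_D, ← W.c_dt, ← W.c_dt, ← W.c_D, W.dt_D]

end Wirtinger

/-- The components of a time-dependent Hermitian metric with inverse, of a holomorphic volume form `f`
and of its norm `n`. -/
structure HermitianData {A : Type*} [CommRing A] [Algebra ℂ A] (W : Wirtinger A) where
  /-- The components `g_{k̄j}`. -/
  G : Matrix (Fin 3) (Fin 3) A
  /-- The components `g^{p l̄}`. -/
  H : Matrix (Fin 3) (Fin 3) A
  GH : G * H = 1
  c_G : ∀ k j, W.c (G k j) = G j k
  /-- The coefficient of the volume form. -/
  f : A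
  /-- The inverse of the coefficient of the volume form. -/
  fi : A
  f_fi : f * fi = 1
  B_f : ∀ k, W.B k f = 0
  dt_f : W.dt f = 0
  /-- The norm of the volume form. -/
  n : A
  /-- The inverse of the norm of the volume form. -/
  ni : A
  n_ni : n * ni = 1
  c_n : W.c n = n
  /-- The normalising constant of the norm. -/
  κ : ℂ
  n_sq : n * n * G.det = algebraMap ℂ A κ * (f * W.c f)

theorem map_mul_derivation {A : Type*} [CommRing A] [Algebra ℂ A] (δ : Derivation ℂ A A)
    (M N : Matrix (Fin 3) (Fin 3) A) : (M * N).map δ = M.map δ * N + M * N.map δ := by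
  ext i j
  simp [Matrix.mul_apply, Finset.sum_add_distrib, mul_comm, add_comm]

namespace HermitianData

variable {A : Type*} [CommRing A] [Algebra ℂ A] {W : Wirtinger A} (X : HermitianData W)

theorem HG : X.H * X.G = 1 := mul_eq_one_comm.1 X.GH

theorem det_mul_det : X.G.det * X.H.det = 1 := by rw [← Matrix.det_mul, X.GH, Matrix.det_one]

theorem c_H (i j : Fin 3) : W.c (X.H i j) = X.H j i := by
  have h1 : (X.H.map W.c).transpose * X.G = 1 := by
    have hG : X.G = (X.G.map W.c).transpose := by ext a b; simp [X.c_G]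
    rw [hG, ← Matrix.transpose_mul, ← Matrix.map_mul, X.GH]
    simp
  have h2 : (X.H.map W.c).transpose = X.H := by
    calc (X.H.map W.c).transpose = (X.H.map W.c).transpose * (X.G * X.H) := by rw [X.GH, mul_one]
      _ = X.H := by rw [← mul_assoc, h1, one_mul]
  exact congrFun (congrFun h2 j) i

theorem c_det : W.c X.G.det = X.G.det := by
  simp only [Matrix.det_fin_three, map_sub, map_add, map_mul, X.c_G]
  ring

theorem derivation_H (δ : Derivation ℂ A A) (i j : Fin 3) :
    δ (X.H i j) = -∑ a, ∑ b, X.H i a * δ (X.G a b) * X.H b j := by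
  have h := congrArg (· * X.H) (map_mul_derivation δ X.H X.G)
  have h0 : (X.H * X.G).map δ = 0 := by
    rw [X.HG]; ext a b; by_cases hab : a = b <;> simp [hab]
  simp only [h0, zero_mul, add_mul, mul_assoc, X.GH, mul_one] at h
  have h' := congrFun (congrFun h i) j
  simp only [Matrix.zero_apply, Matrix.add_apply, Matrix.map_apply, Matrix.mul_apply] at h'
  simp only [Finset.mul_sum] at h'
  rw [eq_neg_iff_add_eq_zero, h']
  simp only [mul_assoc]

/-- The contraction `g^{ab̄} δ g_{b̄a}`. -/
def logTrace (δ : Derivation ℂ A A) : A := ∑ a, ∑ b, X.H a b * δ (X.G b a)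

theorem det_mul_H (i j : Fin 3) : X.G.det * X.H i j = X.G.adjugate i j := by
  have h := congrArg (· * X.H) (Matrix.adjugate_mul X.G)
  simp only [mul_assoc, X.GH, mul_one, smul_mul_assoc, one_mul] at h
  exact (congrFun (congrFun h i) j).symm

/-- Jacobi's formula, valid for any derivation. -/
theorem derivation_det (δ : Derivation ℂ A A) : δ X.G.det = X.G.det * X.logTrace δ := by
  simp only [logTrace, Finset.mul_sum, ← mul_assoc, X.det_mul_H]
  simp only [Matrix.adjugate_fin_three, Matrix.det_fin_three, Fin.sum_univ_three, map_sub, map_add,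
    Derivation.leibniz, smul_eq_mul]
  simp
  ring

/-- Logarithmic differentiation of n² det g = κ f f̄. The factor 2 comes from n² and avoids a square
root. -/
theorem two_mul_derivation_n (δ : Derivation ℂ A A) :
    2 * δ X.n = X.n * (δ X.f * X.fi + δ (W.c X.f) * W.c X.fi - X.logTrace δ) := by
  have h := congrArg δ X.n_sq
  simp only [Derivation.leibniz, smul_eq_mul, X.derivation_det, Derivation.map_algebraMap,
    mul_zero, add_zero] at h
  have hc : W.c X.f * W.c X.fi = 1 := by rw [← map_mul, X.f_fi, map_one]
  have hn := X.n_sq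
  have e1 : algebraMap ℂ A X.κ * W.c X.f * X.ni * X.H.det = X.n * X.fi := by
    linear_combination (-(X.ni * X.H.det * X.fi)) * hn
      - (algebraMap ℂ A X.κ * W.c X.f * X.ni * X.H.det) * X.f_fi
      + (X.n * X.fi * X.n * X.ni) * X.det_mul_det + (X.n * X.fi) * X.n_ni
  have e2 : algebraMap ℂ A X.κ * X.f * X.ni * X.H.det = X.n * W.c X.fi := by
    linear_combination (-(X.ni * X.H.det * W.c X.fi)) * hn
      - (algebraMap ℂ A X.κ * X.f * X.ni * X.H.det) * hc
      + (X.n * W.c X.fi * X.n * X.ni) * X.det_mul_det + (X.n * W.c X.fi) * X.n_ni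
  linear_combination (X.ni * X.H.det) * h + δ X.f * e1 + δ (W.c X.f) * e2
    - (2 * δ X.n * X.n * X.ni + X.n * X.ni * X.n * X.logTrace δ) * X.det_mul_det
    - (2 * δ X.n + X.n * X.logTrace δ) * X.n_ni

end HermitianData

/-! ### Torsion, curvature and the contraction of i∂∂̄ω -/

namespace HermitianData

variable {A : Type*} [CommRing A] [Algebra ℂ A] {W : Wirtinger A} (X : HermitianData W)

/-- The logarithmic derivative of the coefficient of the volume form. -/
def ell (q : Fin 3) : A := W.D q X.f * X.fi

/-- The `(1,0)`-form `2(τ - ∂ log ‖Ω‖)`, where `τ` is the trace of the torsion; it vanishes if and only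
if the metric is conformally balanced. -/
def lee (q : Fin 3) : A :=
  2 * ∑ s, ∑ r, X.H s r * W.D s (X.G r q) - ∑ s, ∑ r, X.H s r * W.D q (X.G r s) - X.ell q

/-- The conjugate of `lee`. -/
def leeConj (p : Fin 3) : A := W.c (X.lee p)

theorem c_leeConj (p : Fin 3) : W.c (X.leeConj p) = X.lee p := W.c_c _

theorem leeConj_eq (p : Fin 3) : X.leeConj p =
    2 * ∑ s, ∑ r, X.H r s * W.B s (X.G p r) - ∑ s, ∑ r, X.H r s * W.B p (X.G s r) - W.c (X.ell p) := by
  simp only [leeConj, lee, map_sub, map_mul, map_sum, X.c_H, W.c_D, X.c_G, map_ofNat]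

/-- The symmetrised derivative `∂̄_p θ_q + ∂_q θ̄_p` of the form `lee`. -/
def leeHess (p q : Fin 3) : A := W.B p (X.lee q) + W.D q (X.leeConj p)

/-- The Chern connection. -/
def conn (j p q : Fin 3) : A := ∑ m, X.H p m * W.D j (X.G m q)

/-- The curvature of the Chern connection. -/
def curvature (k j p q : Fin 3) : A := -W.B k (X.conn j p q)

/-- The curvature with lowered index. -/
def curvatureLow (k j l m : Fin 3) : A := ∑ p, X.G l p * X.curvature k j p m

/-- The second Chern-Ricci curvature. -/
def ricci (k j : Fin 3) : A := ∑ p, ∑ q, X.H p q * X.curvatureLow q p k j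

/-- The torsion. -/
def tors (k j m : Fin 3) : A := W.D j (X.G k m) - W.D m (X.G k j)

/-- The conjugate torsion. -/
def torsConj (k j m : Fin 3) : A := W.B j (X.G m k) - W.B m (X.G j k)

/-- The components of `i∂∂̄ω`. -/
def ddbar (q r s p : Fin 3) : A :=
  W.D s (W.B r (X.G p q)) + W.D q (W.B p (X.G r s)) - W.D q (W.B r (X.G p s))
    - W.D s (W.B p (X.G r q))

/-- The products `Tr (R_{p̄s} R_{r̄q})`. -/
def curvatureSq (p s r q : Fin 3) : A := ∑ α, ∑ β, X.curvature p s α β * X.curvature r q β α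

/-- The components of `Tr (Rm ∧ Rm)`. -/
def curvatureSqAlt (p s r q : Fin 3) : A :=
  X.curvatureSq p s r q - X.curvatureSq r s p q - X.curvatureSq p q r s + X.curvatureSq r q p s

/-- Differentiating g⁻¹∂g and using ∂̄(g g⁻¹) = 0 removes every derivative of the inverse, so that
only derivatives of g remain to be compared. -/
theorem curvatureLow_eq (k j l m : Fin 3) : X.curvatureLow k j l m =
    -W.B k (W.D j (X.G l m)) + ∑ a, ∑ b, W.B k (X.G l a) * X.H a b * W.D j (X.G b m) := by
  have h0 : X.G.map (W.B k) * X.H + X.G * X.H.map (W.B k) = 0 := by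
    rw [← map_mul_derivation, X.GH]; ext a b; by_cases hab : a = b <;> simp [hab]
  have h1 : X.G * (-(X.H * X.G.map (W.D j)).map (W.B k)) =
      -((X.G.map (W.D j)).map (W.B k)) + X.G.map (W.B k) * X.H * X.G.map (W.D j) := by
    rw [map_mul_derivation, eq_neg_of_add_eq_zero_left h0]
    rw [neg_mul, mul_assoc, ← mul_assoc X.G (X.H.map _), mul_neg, mul_add, ← mul_assoc, ← mul_assoc X.G X.H,
      X.GH, one_mul]
    abel
  have h2 := congrFun (congrFun h1 l) m
  simp only [Matrix.add_apply, Matrix.neg_apply, Matrix.map_apply, Matrix.mul_apply,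
    Finset.sum_mul] at h2
  rw [Finset.sum_comm] at h2
  simpa [curvatureLow, curvature, conn] using h2

/-- The volume form is holomorphic, so ∂ log f has no ∂̄-derivative. For this reason the volume form
drops out of `leeHess`. -/
theorem B_ell (k q : Fin 3) : W.B k (X.ell q) = 0 := by
  have h : W.B k (X.f * X.fi) = 0 := by rw [X.f_fi]; simp
  have h2 : W.B k X.fi = 0 := by
    rw [Derivation.leibniz, X.B_f, smul_zero, add_zero, smul_eq_mul] at h
    linear_combination X.fi * h - W.B k X.fi * X.f_fi
  rw [ell, Derivation.leibniz, h2, ← W.D_B, X.B_f]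
  simp

theorem D_c_ell (k q : Fin 3) : W.D k (W.c (X.ell q)) = 0 := by
  rw [← W.c_B, X.B_ell, map_zero]

/-- Of the four second derivatives in i∂∂̄ω, one contracts to the leading part of R̃ and the other
three to the second-order part of `leeHess`. The quadratic first-order terms then assemble into the
torsion square. No balanced hypothesis enters: the failure of that condition is recorded exactly by
`leeHess`. -/
theorem contract_ddbar (p q : Fin 3) : 2 * ∑ s, ∑ r, X.H s r * X.ddbar q r s p =
    -2 * X.ricci p q + 2 * ∑ α, ∑ β, ∑ s, ∑ r, X.H α β * X.H s r * X.tors β s q * X.torsConj α r p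
      - X.leeHess p q := by
  simp only [leeHess, lee, leeConj_eq, map_sub, X.B_ell, X.D_c_ell, ricci, curvatureLow_eq, ddbar]
  simp only [Derivation.leibniz, map_sum, X.derivation_H, smul_eq_mul, W.D_B]
  have h2 : ∀ δ : Derivation ℂ A A, δ 2 = 0 := fun δ => δ.map_natCast 2
  simp only [h2, tors, torsConj, Fin.sum_univ_three]
  generalize hd : (fun i j a b => W.B i (W.D j (X.G a b))) = d2
  simp only [fun i j a b => congrFun (congrFun (congrFun (congrFun hd i) j) a) b]
  ring

end HermitianData

/-! ### The divergence of ‖Ω‖ω² and the terms of the Anomaly flow -/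

namespace HermitianData

variable {A : Type*} [CommRing A] [Algebra ℂ A] {W : Wirtinger A} (X : HermitianData W)

/-- The bivector density dual to `‖Ω‖ω²`. -/
def cofactor (j k : Fin 3) : A := X.n * X.G.det * X.H j k

/-- The components of `‖Ω‖ω²`. -/
def balanced (q r s p : Fin 3) : A := -2 * X.n * (X.G r q * X.G p s - X.G p q * X.G r s)

/-- The logarithmic derivatives of n, det g and g⁻¹ add up to -θ̄/2. Since V is nonsingular, its
divergence vanishes exactly when θ does. -/
theorem two_mul_div_cofactor (j : Fin 3) :
    2 * ∑ k, W.B k (X.cofactor j k) = -∑ k, X.cofactor j k * X.leeConj k := by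
  have h : ∀ k, 2 * W.B k X.n = X.n * (W.c (X.ell k) - X.logTrace (W.B k)) := fun k => by
    rw [X.two_mul_derivation_n, X.B_f, ell, map_mul, W.c_D]
    ring
  simp only [cofactor, Derivation.leibniz, smul_eq_mul, X.derivation_det, X.derivation_H,
    X.leeConj_eq, Fin.sum_univ_three]
  have h0 := h 0
  have h1 := h 1
  have h2 := h 2
  simp only [logTrace, Fin.sum_univ_three] at h0 h1 h2 ⊢
  linear_combination X.G.det * X.H j 0 * h0 + X.G.det * X.H j 1 * h1 + X.G.det * X.H j 2 * h2

/-- The components of ω² are 2×2 minors of g, that is, entries of its adjugate det(g) g⁻¹. -/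
theorem dual_balanced (j k : Fin 3) :
    X.balanced (j + 1) (k + 1) (j + 2) (k + 2) = -2 * X.cofactor j k := by
  rw [cofactor, mul_assoc X.n, X.det_mul_H, Matrix.adjugate_fin_three, balanced]
  fin_cases j <;> fin_cases k <;> simp <;> ring

/-- This is ∂̄∂∂̄ω = 0 in divergence form. -/
theorem div_ddbar (j : Fin 3) :
    ∑ k, W.B k (X.ddbar (j + 1) (k + 1) (j + 2) (k + 2)) = 0 := by
  have e : (1 : Fin 3) + 1 = 2 ∧ (1 : Fin 3) + 2 = 0 ∧ (2 : Fin 3) + 1 = 0 ∧ (2 : Fin 3) + 2 = 1 := by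
    decide
  simp only [ddbar, Fin.sum_univ_three, map_sub, map_add, ← W.D_B, W.B_B 1 0, W.B_B 2 0, W.B_B 2 1,
    zero_add, e]
  ring

/-- The curvature is Rm = -∂̄A in a frame, up to the ordering of the wedge factors, so ∂̄ Tr(Rm ∧
Rm) = 0 needs only that the derivations ∂̄ commute. -/
theorem div_curvatureSqAlt (j : Fin 3) :
    ∑ k, W.B k (X.curvatureSqAlt (k + 2) (j + 2) (k + 1) (j + 1)) = 0 := by
  have e : (1 : Fin 3) + 1 = 2 ∧ (1 : Fin 3) + 2 = 0 ∧ (2 : Fin 3) + 1 = 0 ∧ (2 : Fin 3) + 2 = 1 := by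
    decide
  simp only [curvatureSqAlt, curvatureSq, curvature, Fin.sum_univ_three, map_sub, map_add, map_neg,
    Derivation.leibniz, smul_eq_mul, W.B_B 1 0, W.B_B 2 0, W.B_B 2 1, zero_add, e]
  ring

theorem sum_G_H_left (M : Matrix (Fin 3) (Fin 3) A) (p q : Fin 3) :
    ∑ s, ∑ r, X.H s r * (M r q * X.G p s) = M p q := by
  have h : X.G * X.H * M = M := by rw [X.GH, one_mul]
  have h' := congrFun (congrFun h p) q
  simp only [Matrix.mul_apply, Finset.sum_mul] at h'
  rw [Finset.sum_comm, ← h']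
  exact Finset.sum_congr rfl fun _ _ => Finset.sum_congr rfl fun _ _ => by ring

theorem sum_G_H_right (M : Matrix (Fin 3) (Fin 3) A) (p q : Fin 3) :
    ∑ s, ∑ r, X.H s r * (X.G r q * M p s) = M p q := by
  have h : M * X.H * X.G = M := by rw [mul_assoc, X.HG, mul_one]
  have h' := congrFun (congrFun h p) q
  simp only [Matrix.mul_apply, Finset.sum_mul] at h'
  rw [Finset.sum_comm, ← h']
  exact Finset.sum_congr rfl fun _ _ => Finset.sum_congr rfl fun _ _ => by ring

theorem sum_G_H_trace : ∑ s, ∑ r, X.H s r * X.G r s = 3 := by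
  have h := congrArg Matrix.trace X.HG
  simpa [Matrix.trace, Matrix.mul_apply] using h

/-- The derivative of n is -n tr(g⁻¹∂ₜg)/2, which cancels the trace part of the derivative of ω².
The full trace of the identity, 3, fixes the remaining coefficient. -/
theorem contract_dt_balanced (p q : Fin 3) :
    ∑ s, ∑ r, X.H s r * W.dt (X.balanced q r s p) = 2 * X.n * W.dt (X.G p q) := by
  have hn : 2 * W.dt X.n = -(X.n * X.logTrace W.dt) := by
    rw [X.two_mul_derivation_n, ← W.c_dt, X.dt_f]
    simp
  have h2 : W.dt 2 = 0 := W.dt.map_natCast 2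
  have e1 := X.sum_G_H_left X.G p q
  have e2 := X.sum_G_H_left (X.G.map W.dt) p q
  have e3 := X.sum_G_H_right (X.G.map W.dt) p q
  have e4 := X.sum_G_H_trace
  simp only [balanced, Derivation.leibniz, smul_eq_mul, map_sub, map_neg, h2, Matrix.map_apply] at *
  simp only [logTrace, Fin.sum_univ_three] at *
  linear_combination (-2 * W.dt X.n) * e1 - 2 * X.n * e2 - 2 * X.n * e3
    + 2 * (X.n * W.dt (X.G p q) + W.dt X.n * X.G p q) * e4 + 2 * X.G p q * hn

end HermitianData

theorem mem_of_two_mul_mem {A : Type*} [CommRing A] [Algebra ℂ A] {I : Ideal A} {x : A}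
    (h : 2 * x ∈ I) : x ∈ I := by
  have h2 := I.mul_mem_left (algebraMap ℂ A (1 / 2)) h
  rwa [← mul_assoc, show (2 : A) = algebraMap ℂ A 2 from (map_ofNat _ 2).symm, ← map_mul,
    show (1 / 2 * 2 : ℂ) = 1 by norm_num, map_one, one_mul] at h2

/-! ### Lower-order terms as ideals and the parabolic system for `lee` -/

namespace HermitianData

variable {A : Type*} [CommRing A] [Algebra ℂ A] {W : Wirtinger A} (X : HermitianData W)

/-- The components of the form `lee` and of its conjugate. -/
def leeGen (a : Idx) : A := Sum.elim X.lee X.leeConj a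

/-- The components of `lee`, its conjugate, and their first space derivatives. -/
def leeJet : Idx ⊕ (Idx × Idx) → A :=
  Sum.elim X.leeGen fun a => Sum.elim (fun k => W.D k (X.leeGen a.2)) (fun k => W.B k (X.leeGen a.2)) a.1

/-- The ideal generated by `lee` and its conjugate. -/
def leeIdeal : Ideal A := Ideal.span (Set.range X.leeGen)

/-- The ideal generated by `lee`, its conjugate and their first space derivatives. -/
def leeJetIdeal : Ideal A := Ideal.span (Set.range X.leeJet)

theorem lee_mem (q : Fin 3) : X.lee q ∈ X.leeIdeal := Ideal.subset_span ⟨Sum.inl q, rfl⟩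

theorem leeConj_mem (q : Fin 3) : X.leeConj q ∈ X.leeIdeal := Ideal.subset_span ⟨Sum.inr q, rfl⟩

theorem leeGen_mem_jet (a : Idx) : X.leeGen a ∈ X.leeJetIdeal := Ideal.subset_span ⟨Sum.inl a, rfl⟩

theorem leeIdeal_le : X.leeIdeal ≤ X.leeJetIdeal :=
  Ideal.span_le.2 (Set.range_subset_iff.2 X.leeGen_mem_jet)

theorem D_leeGen_mem (k : Fin 3) (a : Idx) : W.D k (X.leeGen a) ∈ X.leeJetIdeal :=
  Ideal.subset_span ⟨Sum.inr (Sum.inl k, a), rfl⟩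

theorem B_leeGen_mem (k : Fin 3) (a : Idx) : W.B k (X.leeGen a) ∈ X.leeJetIdeal :=
  Ideal.subset_span ⟨Sum.inr (Sum.inr k, a), rfl⟩

/-- By the Leibniz rule it suffices to look at the generators. In this way a relation modulo θ may
be differentiated to a relation modulo θ and its first derivatives. -/
theorem derivation_mem_of_mem_leeIdeal (δ : Derivation ℂ A A)
    (h : ∀ a, δ (X.leeGen a) ∈ X.leeJetIdeal) {x : A} (hx : x ∈ X.leeIdeal) :
    δ x ∈ X.leeJetIdeal := by
  induction hx using Submodule.span_induction with
  | mem x hx => obtain ⟨a, rfl⟩ := hx; exact h a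
  | zero => simp
  | add x y _ _ hx hy => rw [map_add]; exact add_mem hx hy
  | smul a x hx' hx =>
    rw [smul_eq_mul, Derivation.leibniz, smul_eq_mul, smul_eq_mul]
    exact add_mem (Ideal.mul_mem_left _ _ hx) (Ideal.mul_mem_right _ _ (X.leeIdeal_le hx'))

theorem c_leeGen (a : Idx) : W.c (X.leeGen a) = X.leeGen a.swap := by
  cases a with
  | inl q => rfl
  | inr q => exact X.c_leeConj q

theorem c_mem_leeJetIdeal {x : A} (hx : x ∈ X.leeJetIdeal) : W.c x ∈ X.leeJetIdeal := by
  induction hx using Submodule.span_induction with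
  | mem x hx =>
    obtain ⟨a, rfl⟩ := hx
    rcases a with a | ⟨k | k, a⟩
    · simpa only [leeJet, Sum.elim_inl, c_leeGen] using X.leeGen_mem_jet _
    · simpa only [leeJet, Sum.elim_inl, Sum.elim_inr, c_leeGen, W.c_D] using X.B_leeGen_mem _ _
    · simpa only [leeJet, Sum.elim_inl, Sum.elim_inr, c_leeGen, W.c_B] using X.D_leeGen_mem _ _
  | zero => simp
  | add x y _ _ hx hy => rw [map_add]; exact add_mem hx hy
  | smul a x _ hx => rw [smul_eq_mul, map_mul]; exact Ideal.mul_mem_left _ _ hx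

/-- The divergence of `lee` is real up to terms of order zero. -/
theorem div_lee_sub_mem :
    ∑ q, ∑ k, X.H q k * (W.B k (X.lee q) - W.D q (X.leeConj k)) ∈ X.leeIdeal := by
  -- The matrix V is Hermitian and ∂ commutes with ∂̄, so the double divergence ∂_j∂_k̄ V^{jk} is
  -- real.
  have h1 : W.c (∑ j, W.D j (∑ k, W.B k (X.cofactor j k))) =
      ∑ j, W.D j (∑ k, W.B k (X.cofactor j k)) := by
    simp only [map_sum, W.c_D, W.c_B, cofactor, map_mul, X.c_n, X.c_det, X.c_H]
    rw [Finset.sum_comm]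
    simp only [W.D_B]
  have h2 : 2 * ∑ j, W.D j (∑ k, W.B k (X.cofactor j k)) =
      -∑ j, ∑ k, (X.n * X.G.det * X.H j k * W.D j (X.leeConj k)
        + W.D j (X.cofactor j k) * X.leeConj k) := by
    have h2' : ∀ j, W.D j 2 = 0 := fun j => (W.D j).map_natCast 2
    have : ∀ j, W.D j (2 * ∑ k, W.B k (X.cofactor j k)) =
        2 * W.D j (∑ k, W.B k (X.cofactor j k)) := fun j => by
      rw [Derivation.leibniz, h2']; simp
    simp only [Finset.mul_sum, ← this]
    rw [← Finset.sum_neg_distrib]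
    refine Finset.sum_congr rfl fun j _ => ?_
    have := congrArg (W.D j) (X.two_mul_div_cofactor j)
    rw [Finset.mul_sum] at this
    rw [this, map_neg, map_sum]
    simp only [Derivation.leibniz, smul_eq_mul, cofactor]
    congr 1
    exact Finset.sum_congr rfl fun k _ => by ring
  have h3 := congrArg W.c h2
  rw [map_mul, h1, map_ofNat, h2] at h3
  -- Writing the real double divergence through θ̄, and through θ by conjugation, isolates the
  -- difference of the two divergences; the rest carries an undifferentiated θ or θ̄.
  have hk : X.n * X.G.det * ∑ q, ∑ k, X.H q k * (W.B k (X.lee q) - W.D q (X.leeConj k)) =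
      ∑ q, ∑ k, (W.D q (X.cofactor q k) * X.leeConj k - W.c (W.D q (X.cofactor q k)) * X.lee k) := by
    simp only [map_neg, map_add, map_mul, X.c_n, X.c_det, X.c_H, W.c_D, X.c_leeConj,
      Fin.sum_univ_three] at h3 ⊢
    linear_combination h3
  have hmem : X.n * X.G.det * ∑ q, ∑ k, X.H q k * (W.B k (X.lee q) - W.D q (X.leeConj k))
      ∈ X.leeIdeal := by
    rw [hk]
    exact sum_mem fun q _ => sum_mem fun k _ => sub_mem (Ideal.mul_mem_left _ _ (X.leeConj_mem k))
      (Ideal.mul_mem_left _ _ (X.lee_mem k))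
  have := Ideal.mul_mem_left _ (X.ni * X.H.det) hmem
  convert this using 1
  linear_combination (-(X.n * X.ni * ∑ q, ∑ k, X.H q k * (W.B k (X.lee q) - W.D q (X.leeConj k))))
    * X.det_mul_det - (∑ q, ∑ k, X.H q k * (W.B k (X.lee q) - W.D q (X.leeConj k))) * X.n_ni

/-- The Laplacian `g^{ab̄} ∂_a ∂_{b̄}`. -/
def laplacian (x : A) : A := ∑ a, ∑ b, X.H a b * W.D a (W.B b x)

/-- The divergence equation satisfied by a solution of the flow of the metric. -/
def DivergenceEquation : Prop := ∀ j,
  4 * ∑ k, W.dt (X.cofactor j k * X.leeConj k) =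
    ∑ k, W.B k (X.G.det * (2 * (X.H * Matrix.of X.leeHess * X.H) j k -
      (X.H * Matrix.of X.leeHess).trace * X.H j k))

/-- Modulo the jet ideal only ∂ₜθ̄ and second space derivatives survive. The right-hand side of the
divergence equation then consists of g^{jp̄}Δθ̄_p, of g^{jp̄}g^{qk̄}∂_p̄∂_k̄θ_q, and of the
∂̄-derivative of tr(HL). Up to lower-order terms the two halves of this trace coincide, by
`div_lee_sub_mem`, and together they cancel the ∂̄∂̄θ term. -/
theorem parabolic_leeConj (h : X.DivergenceEquation) (p : Fin 3) :
    2 * X.n * W.dt (X.leeConj p) - X.laplacian (X.leeConj p) ∈ X.leeJetIdeal := by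
  set π := Ideal.Quotient.mk X.leeJetIdeal with hπ
  have z0 : ∀ q, π (X.lee q) = 0 := fun q =>
    Ideal.Quotient.eq_zero_iff_mem.2 (X.leeGen_mem_jet (Sum.inl q))
  have z1 : ∀ q, π (X.leeConj q) = 0 := fun q =>
    Ideal.Quotient.eq_zero_iff_mem.2 (X.leeGen_mem_jet (Sum.inr q))
  have z2 : ∀ k q, π (W.D k (X.lee q)) = 0 := fun k q =>
    Ideal.Quotient.eq_zero_iff_mem.2 (X.D_leeGen_mem k (Sum.inl q))
  have z3 : ∀ k q, π (W.B k (X.lee q)) = 0 := fun k q =>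
    Ideal.Quotient.eq_zero_iff_mem.2 (X.B_leeGen_mem k (Sum.inl q))
  have z4 : ∀ k q, π (W.D k (X.leeConj q)) = 0 := fun k q =>
    Ideal.Quotient.eq_zero_iff_mem.2 (X.D_leeGen_mem k (Sum.inr q))
  have z5 : ∀ k q, π (W.B k (X.leeConj q)) = 0 := fun k q =>
    Ideal.Quotient.eq_zero_iff_mem.2 (X.B_leeGen_mem k (Sum.inr q))
  -- A ∂̄-derivative of the reality relation exchanges g^{ql̄}∂_k̄∂_l̄θ_q with g^{ql̄}∂_k̄∂_qθ̄_l
  -- modulo jets.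
  have hc : ∀ k, π (W.B k (∑ q, ∑ l, X.H q l * (W.B l (X.lee q) - W.D q (X.leeConj l)))) = 0 :=
    fun k => Ideal.Quotient.eq_zero_iff_mem.2
      (X.derivation_mem_of_mem_leeIdeal _ (X.B_leeGen_mem k) X.div_lee_sub_mem)
  have hj : ∀ j, π (2 * (∑ k, X.H j k * (2 * X.n * W.dt (X.leeConj k) - X.laplacian (X.leeConj k)))) = 0 := by
    intro j
    have hh := congrArg π (h j)
    have h2 : ∀ δ : Derivation ℂ A A, δ 2 = 0 := fun δ => δ.map_natCast 2
    have hdet : π X.G.det * π X.H.det = 1 := by rw [← map_mul, X.det_mul_det, map_one]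
    have key : π X.G.det * π (2 * (∑ k, X.H j k *
        (2 * X.n * W.dt (X.leeConj k) - X.laplacian (X.leeConj k)))) = 0 := by
      have hc0 := hc 0
      have hc1 := hc 1
      have hc2 := hc 2
      simp only [cofactor, laplacian, leeHess, Matrix.mul_apply, Matrix.trace, Matrix.diag_apply,
        Matrix.of_apply, Fin.sum_univ_three, Derivation.leibniz, smul_eq_mul, map_add, map_sub, map_mul,
        z1, z3, z4, mul_zero, zero_mul, add_zero, zero_add, sub_zero, map_ofNat, h2,
        W.D_B, W.B_B 1 0, W.B_B 2 0, W.B_B 2 1] at hh hc0 hc1 hc2 ⊢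
      linear_combination hh + π X.G.det * π (X.H j 0) * hc0 + π X.G.det * π (X.H j 1) * hc1
        + π X.G.det * π (X.H j 2) * hc2
    rw [← one_mul (π _), ← hdet, mul_comm (π X.G.det), mul_assoc, key, mul_zero]
  have hj' : ∀ j, ∑ k, X.H j k * (2 * X.n * W.dt (X.leeConj k) - X.laplacian (X.leeConj k))
      ∈ X.leeJetIdeal := fun j => mem_of_two_mul_mem (Ideal.Quotient.eq_zero_iff_mem.1 (hj j))
  -- The equation is known after multiplication by g⁻¹; multiplying by g recovers each component.
  have hsum : 2 * X.n * W.dt (X.leeConj p) - X.laplacian (X.leeConj p) =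
      ∑ j, X.G p j * ∑ k, X.H j k * (2 * X.n * W.dt (X.leeConj k) - X.laplacian (X.leeConj k)) := by
    have := congrFun (congrArg (fun M : Matrix (Fin 3) (Fin 3) A => M.mulVec
      fun k => 2 * X.n * W.dt (X.leeConj k) - X.laplacian (X.leeConj k)) X.GH) p
    simp only [Matrix.one_mulVec, ← Matrix.mulVec_mulVec] at this
    exact this.symm
  rw [hsum]
  exact sum_mem fun j _ => Ideal.mul_mem_left _ _ (hj' j)

theorem c_laplacian (x : A) : W.c (X.laplacian x) = X.laplacian (W.c x) := by
  simp only [laplacian, map_sum, map_mul, X.c_H, W.c_D, W.c_B, W.D_B]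
  exact Finset.sum_comm

theorem laplacian_sum (u : Fin 3 → A) : X.laplacian (∑ j, u j) = ∑ j, X.laplacian (u j) := by
  simp only [laplacian, Fin.sum_univ_three, map_add]
  ring

theorem parabolic_lee (h : X.DivergenceEquation) (p : Fin 3) :
    2 * X.n * W.dt (X.lee p) - X.laplacian (X.lee p) ∈ X.leeJetIdeal := by
  have := X.c_mem_leeJetIdeal (X.parabolic_leeConj h p)
  simpa only [map_sub, map_mul, map_ofNat, X.c_n, W.c_dt, X.c_leeConj, X.c_laplacian] using this

/-- The squared norm of `lee`. -/
def leeNormSq : A := ∑ j, ∑ k, X.H j k * (X.lee j * X.leeConj k)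

/-- The squared norm of the derivative of `lee`. -/
def leeGradSq : A := ∑ j, ∑ k, ∑ a, ∑ b, X.H a b * X.H j k *
  (W.D a (X.lee j) * W.B b (X.leeConj k) + W.B b (X.lee j) * W.D a (X.leeConj k))

/-- In the Leibniz expansion the terms with both derivatives on the two factors θ, θ̄ form
`leeGradSq`. Every other term contains an undifferentiated θ or θ̄ times an element of the jet
ideal, so it is at most of size |θ|(|θ| + |∇θ|), which the gradient term can absorb. -/
theorem parabolic_leeNormSq (h : X.DivergenceEquation) :
    2 * X.n * W.dt X.leeNormSq - X.laplacian X.leeNormSq + X.leeGradSq ∈ X.leeIdeal * X.leeJetIdeal := by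
  have mjet : ∀ x ∈ X.leeIdeal, ∀ y ∈ X.leeJetIdeal, ∀ a, a * (x * y) ∈ X.leeIdeal * X.leeJetIdeal :=
    fun x hx y hy a => Ideal.mul_mem_left _ _ (Ideal.mul_mem_mul hx hy)
  have hD : ∀ a j, W.D a (X.lee j) ∈ X.leeJetIdeal := fun a j => X.D_leeGen_mem a (Sum.inl j)
  have hB : ∀ a j, W.B a (X.lee j) ∈ X.leeJetIdeal := fun a j => X.B_leeGen_mem a (Sum.inl j)
  have hD' : ∀ a j, W.D a (X.leeConj j) ∈ X.leeJetIdeal := fun a j => X.D_leeGen_mem a (Sum.inr j)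
  have hB' : ∀ a j, W.B a (X.leeConj j) ∈ X.leeJetIdeal := fun a j => X.B_leeGen_mem a (Sum.inr j)
  have hc : ∀ j, X.leeConj j ∈ X.leeJetIdeal := fun j => X.leeGen_mem_jet (Sum.inr j)
  have key : 2 * X.n * W.dt X.leeNormSq - X.laplacian X.leeNormSq + X.leeGradSq =
      ∑ j, ∑ k, (X.H j k * (X.leeConj k * (2 * X.n * W.dt (X.lee j) - X.laplacian (X.lee j)))
        + X.H j k * (X.lee j * (2 * X.n * W.dt (X.leeConj k) - X.laplacian (X.leeConj k)))
        + (2 * X.n * W.dt (X.H j k) - X.laplacian (X.H j k)) * (X.lee j * X.leeConj k)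
        - ∑ a, ∑ b, (X.H a b * W.D a (X.H j k) * (X.leeConj k * W.B b (X.lee j))
          + X.H a b * W.D a (X.H j k) * (X.lee j * W.B b (X.leeConj k))
          + X.H a b * W.B b (X.H j k) * (X.leeConj k * W.D a (X.lee j))
          + X.H a b * W.B b (X.H j k) * (X.lee j * W.D a (X.leeConj k)))) := by
    have hl : X.laplacian X.leeNormSq =
        ∑ j, ∑ k, X.laplacian (X.H j k * (X.lee j * X.leeConj k)) := by
      simp only [leeNormSq, X.laplacian_sum]
    rw [hl, leeNormSq, leeGradSq, map_sum, Finset.mul_sum, ← Finset.sum_sub_distrib,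
      ← Finset.sum_add_distrib]
    refine Finset.sum_congr rfl fun j _ => ?_
    rw [map_sum, Finset.mul_sum, ← Finset.sum_sub_distrib, ← Finset.sum_add_distrib]
    refine Finset.sum_congr rfl fun k _ => ?_
    simp only [laplacian, Fin.sum_univ_three, Derivation.leibniz, smul_eq_mul, map_add]
    ring
  rw [key]
  exact sum_mem fun j _ => sum_mem fun k _ => sub_mem (add_mem (add_mem
    (mjet _ (X.leeConj_mem k) _ (X.parabolic_lee h j) _)
    (mjet _ (X.lee_mem j) _ (X.parabolic_leeConj h k) _))
    (mjet _ (X.lee_mem j) _ (hc k) _))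
    (sum_mem fun a _ => sum_mem fun b _ => add_mem (add_mem (add_mem
      (mjet _ (X.leeConj_mem k) _ (hB b j) _) (mjet _ (X.lee_mem j) _ (hB' b k) _))
      (mjet _ (X.leeConj_mem k) _ (hD a j) _)) (mjet _ (X.lee_mem j) _ (hD' a k) _))

end HermitianData

/-! ### Alternating arrays -/

/-- Alternating arrays. -/
def IsAlt {n : ℕ} (α : Form n) : Prop :=
  ∀ (σ : Equiv.Perm (Fin n)) (a : Fin n → Idx), α (a ∘ σ) = ((Equiv.Perm.sign σ : ℤ) : ℂ) * α a

/-- The signed sum over all permutations of the arguments. -/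
def altSum {n : ℕ} (F : Form n) : Form n := fun a =>
  ∑ σ : Equiv.Perm (Fin n), ((Equiv.Perm.sign σ : ℤ) : ℂ) * F (a ∘ σ)

theorem isAlt_altSum {n : ℕ} (F : Form n) : IsAlt (altSum F) := by
  intro τ a
  simp only [altSum, Finset.mul_sum]
  refine Fintype.sum_equiv (Equiv.mulLeft τ) _ _ fun σ => ?_
  have h : ((Equiv.Perm.sign τ : ℤ) : ℂ) * ((Equiv.Perm.sign τ : ℤ) : ℂ) = 1 := by
    rcases Int.units_eq_one_or (Equiv.Perm.sign τ) with h | h <;> simp [h]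
  simp only [Equiv.coe_mulLeft, Equiv.Perm.sign_mul, Units.val_mul, Int.cast_mul,
    Equiv.Perm.coe_mul, Function.comp_assoc]
  rw [← mul_assoc, ← mul_assoc, h, one_mul]

theorem altSum_of_isAlt {n : ℕ} {F : Form n} (hF : IsAlt F) (a : Fin n → Idx) :
    altSum F a = (n ! : ℂ) * F a := by
  have h : ∀ τ : Equiv.Perm (Fin n), ((Equiv.Perm.sign τ : ℤ) : ℂ) * F (a ∘ τ) = F a := fun τ => by
    rw [hF, ← mul_assoc]
    rcases Int.units_eq_one_or (Equiv.Perm.sign τ) with h | h <;> simp [h]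
  simp [altSum, h, Fintype.card_perm]

/-- A permutation is determined by the image p of 0 and a permutation of the rest. The remaining
arguments are listed after the transposition of 0 and p, not in increasing order; hence every p ≠ 0
has sign -1. -/
theorem altSum_succ {n : ℕ} (F : Form (n + 1)) (a : Fin (n + 1) → Idx) :
    altSum F a = ∑ p, (if p = 0 then 1 else -1) *
      altSum (fun b => F (Matrix.vecCons (a p) b)) (fun i => a (Equiv.swap 0 p i.succ)) := by
  simp only [altSum, Finset.mul_sum]
  rw [← Equiv.sum_comp Equiv.Perm.decomposeFin.symm, Fintype.sum_prod_type]
  refine Finset.sum_congr rfl fun p _ => Finset.sum_congr rfl fun e _ => ?_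
  rw [Equiv.Perm.decomposeFin.symm_sign, ← mul_assoc]
  congr 1
  · split_ifs <;> simp
  · congr 1
    funext i
    refine Fin.cases ?_ (fun i => ?_) i
    · simp
    · simp [Equiv.Perm.decomposeFin_symm_apply_succ]

theorem wedge_eq_altSum {k l : ℕ} (α : Form k) (β : Form l) (a : Fin (k + l) → Idx) :
    wedge α β a = ((k ! * l ! : ℕ) : ℂ)⁻¹ *
      altSum (fun b => α (fun i => b (Fin.castAdd l i)) * β (fun i => b (Fin.natAdd k i))) a := rfl

theorem isAlt_wedge {k l : ℕ} (α : Form k) (β : Form l) : IsAlt (wedge α β) := by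
  intro σ a
  rw [wedge_eq_altSum, wedge_eq_altSum, isAlt_altSum]
  ring

theorem altSum_one (F : Form 1) (a : Idx) : altSum F ![a] = F ![a] := by
  simp only [altSum, Fintype.sum_unique, Subsingleton.elim _ (1 : Equiv.Perm (Fin 1))]
  simp

theorem altSum_two (F : Form 2) (a b : Idx) : altSum F ![a, b] = F ![a, b] - F ![b, a] := by
  have s0 : (fun i : Fin 1 => ![a, b] (Equiv.swap 0 0 i.succ)) = ![b] := by
    funext i; fin_cases i; rfl
  have s1 : (fun i : Fin 1 => ![a, b] (Equiv.swap 0 1 i.succ)) = ![a] := by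
    funext i; fin_cases i; rfl
  rw [altSum_succ, Fin.sum_univ_two, s0, s1, altSum_one, altSum_one]
  simp
  ring

theorem altSum_three (F : Form 3) (a b c : Idx) : altSum F ![a, b, c] =
    F ![a, b, c] - F ![a, c, b] - F ![b, a, c] + F ![b, c, a] - F ![c, b, a] + F ![c, a, b] := by
  have s0 : (fun i : Fin 2 => ![a, b, c] (Equiv.swap 0 0 i.succ)) = ![b, c] := by
    funext i; fin_cases i <;> rfl
  have s1 : (fun i : Fin 2 => ![a, b, c] (Equiv.swap 0 1 i.succ)) = ![a, c] := by
    funext i; fin_cases i <;> rfl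
  have s2 : (fun i : Fin 2 => ![a, b, c] (Equiv.swap 0 2 i.succ)) = ![b, a] := by
    funext i; fin_cases i <;> rfl
  rw [altSum_succ, Fin.sum_univ_three, s0, s1, s2, altSum_two, altSum_two, altSum_two]
  simp
  ring

theorem altSum_four (F : Form 4) (a b c d : Idx) : altSum F ![a, b, c, d] =
    F ![a, b, c, d] - F ![a, b, d, c] - F ![a, c, b, d] + F ![a, c, d, b] + F ![a, d, b, c]
    - F ![a, d, c, b] - F ![b, a, c, d] + F ![b, a, d, c] + F ![b, c, a, d] - F ![b, c, d, a]
    - F ![b, d, a, c] + F ![b, d, c, a] + F ![c, a, b, d] - F ![c, a, d, b] - F ![c, b, a, d]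
    + F ![c, b, d, a] + F ![c, d, a, b] - F ![c, d, b, a] - F ![d, a, b, c] + F ![d, a, c, b]
    + F ![d, b, a, c] - F ![d, b, c, a] - F ![d, c, a, b] + F ![d, c, b, a] := by
  have s0 : (fun i : Fin 3 => ![a, b, c, d] (Equiv.swap 0 0 i.succ)) = ![b, c, d] := by
    funext i; fin_cases i <;> rfl
  have s1 : (fun i : Fin 3 => ![a, b, c, d] (Equiv.swap 0 1 i.succ)) = ![a, c, d] := by
    funext i; fin_cases i <;> rfl
  have s2 : (fun i : Fin 3 => ![a, b, c, d] (Equiv.swap 0 2 i.succ)) = ![b, a, d] := by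
    funext i; fin_cases i <;> rfl
  have s3 : (fun i : Fin 3 => ![a, b, c, d] (Equiv.swap 0 3 i.succ)) = ![b, c, a] := by
    funext i; fin_cases i <;> rfl
  rw [altSum_succ, Fin.sum_univ_four, s0, s1, s2, s3, altSum_three, altSum_three, altSum_three,
    altSum_three]
  simp
  ring

theorem wedge_two_two (α β : Form 2) (hα : ∀ x y, α ![y, x] = -α ![x, y])
    (hβ : ∀ x y, β ![y, x] = -β ![x, y]) (a b c d : Idx) :
    wedge α β ![a, b, c, d] = α ![a, b] * β ![c, d] - α ![a, c] * β ![b, d] + α ![a, d] * β ![b, c]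
      + α ![b, c] * β ![a, d] - α ![b, d] * β ![a, c] + α ![c, d] * β ![a, b] := by
  have e1 : ∀ x y z w : Idx, (fun i : Fin 2 => ![x, y, z, w] (Fin.castAdd 2 i)) = ![x, y] := by
    intro x y z w; funext i; fin_cases i <;> rfl
  have e2 : ∀ x y z w : Idx, (fun i : Fin 2 => ![x, y, z, w] (Fin.natAdd 2 i)) = ![z, w] := by
    intro x y z w; funext i; fin_cases i <;> rfl
  rw [wedge_eq_altSum, altSum_four]
  simp only [e1, e2, hα a b, hα a c, hα a d, hα b c, hα b d, hα c d, hβ a b, hβ a c, hβ a d, hβ b c,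
    hβ b d, hβ c d]
  norm_num [Nat.factorial]
  ring

theorem oneOneForm_swap (h : Matrix (Fin 3) (Fin 3) ℂ) (x y : Idx) :
    oneOneForm h ![y, x] = -oneOneForm h ![x, y] := by
  rcases x with x | x <;> rcases y with y | y <;> simp [oneOneForm]

@[simp] theorem oneOneForm_inl_inr (h : Matrix (Fin 3) (Fin 3) ℂ) (j k : Fin 3) :
    oneOneForm h ![Sum.inl j, Sum.inr k] = h k j := rfl

@[simp] theorem oneOneForm_inr_inl (h : Matrix (Fin 3) (Fin 3) ℂ) (j k : Fin 3) :
    oneOneForm h ![Sum.inr k, Sum.inl j] = -h k j := rfl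

@[simp] theorem oneOneForm_inl_inl (h : Matrix (Fin 3) (Fin 3) ℂ) (j k : Fin 3) :
    oneOneForm h ![Sum.inl j, Sum.inl k] = 0 := rfl

@[simp] theorem oneOneForm_inr_inr (h : Matrix (Fin 3) (Fin 3) ℂ) (j k : Fin 3) :
    oneOneForm h ![Sum.inr j, Sum.inr k] = 0 := rfl

theorem wedge_oneOneForm (h h' : Matrix (Fin 3) (Fin 3) ℂ) (q r s p : Fin 3) :
    wedge (oneOneForm h) (oneOneForm h') ![Sum.inl q, Sum.inr r, Sum.inl s, Sum.inr p] =
      h r q * h' p s - h r s * h' p q - h p q * h' r s + h p s * h' r q := by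
  rw [wedge_two_two _ _ (oneOneForm_swap h) (oneOneForm_swap h')]
  simp
  ring

/-- Arrays of type `(2,2)`. -/
def IsTwoTwo (α : Form 4) : Prop :=
  ∀ a, α a ≠ 0 → (Finset.univ.filter fun i => (a i).isLeft = true).card = 2

theorem card_isLeft (a b c d : Idx) :
    (Finset.univ.filter fun i => ((![a, b, c, d] : Fin 4 → Idx) i).isLeft = true).card =
      (if a.isLeft then 1 else 0) + (if b.isLeft then 1 else 0) + (if c.isLeft then 1 else 0)
        + (if d.isLeft then 1 else 0) := by
  rw [Finset.card_filter, Fin.sum_univ_four]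
  rfl

theorem vec_four (a : Fin 4 → Idx) : a = ![a 0, a 1, a 2, a 3] := by
  funext i; fin_cases i <;> rfl

theorem isTwoTwo_wedge_oneOneForm (h h' : Matrix (Fin 3) (Fin 3) ℂ) :
    IsTwoTwo (wedge (oneOneForm h) (oneOneForm h')) := by
  intro a ha
  rw [vec_four a] at ha ⊢
  rw [card_isLeft]
  rw [wedge_two_two _ _ (oneOneForm_swap h) (oneOneForm_swap h')] at ha
  generalize a 0 = a0 at *
  generalize a 1 = a1 at *
  generalize a 2 = a2 at *
  generalize a 3 = a3 at *
  rcases a0 with _ | _ <;> rcases a1 with _ | _ <;> rcases a2 with _ | _ <;>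
    rcases a3 with _ | _ <;> simp at ha ⊢

/-- An alternating array of type `(2,2)` vanishes if its components
`α(∂_q, ∂_{r̄}, ∂_s, ∂_{p̄})` do. -/
theorem eq_zero_of_isTwoTwo {α : Form 4} (hα : IsAlt α) (ht : IsTwoTwo α)
    (h : ∀ q r s p, α ![Sum.inl q, Sum.inr r, Sum.inl s, Sum.inr p] = 0) (a : Fin 4 → Idx) :
    α a = 0 := by
  by_contra ha
  have hperm : ∀ (σ : Equiv.Perm (Fin 4)) q r s p,
      a ∘ σ = ![Sum.inl q, Sum.inr r, Sum.inl s, Sum.inr p] → False := by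
    intro σ q r s p hs
    have := hα σ a
    rw [hs, h] at this
    rcases mul_eq_zero.1 this.symm with h0 | h0
    · rcases Int.units_eq_one_or (Equiv.Perm.sign σ) with h | h <;> simp [h] at h0
    · exact ha h0
  have hc := ht a ha
  rw [vec_four a] at hc hperm
  rw [card_isLeft] at hc
  generalize a 0 = a0 at *
  generalize a 1 = a1 at *
  generalize a 2 = a2 at *
  generalize a 3 = a3 at *
  have key : ∀ (σ : Equiv.Perm (Fin 4)) (x y z w : Idx),
      (![x, y, z, w] : Fin 4 → Idx) ∘ σ = ![![x, y, z, w] (σ 0), ![x, y, z, w] (σ 1),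
        ![x, y, z, w] (σ 2), ![x, y, z, w] (σ 3)] := fun σ x y z w => vec_four _
  rcases a0 with q0 | q0 <;> rcases a1 with q1 | q1 <;> rcases a2 with q2 | q2 <;>
    rcases a3 with q3 | q3 <;> simp at hc
  · exact hperm (Equiv.swap 1 2) _ _ _ _ (key _ _ _ _ _)
  · exact hperm 1 _ _ _ _ (key _ _ _ _ _)
  · exact hperm (Equiv.swap 2 3) _ _ _ _ (key _ _ _ _ _)
  · exact hperm (Equiv.swap 0 1) _ _ _ _ (key _ _ _ _ _)
  · exact hperm (Equiv.swap 0 1 * Equiv.swap 2 3) _ _ _ _ (key _ _ _ _ _)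
  · exact hperm (Equiv.swap 0 3) _ _ _ _ (key _ _ _ _ _)

theorem altSum_four_expand (F : Form 4) (a b c d : Idx) : altSum F ![a, b, c, d] =
    altSum (fun v => F (Matrix.vecCons a v)) ![b, c, d]
    - altSum (fun v => F (Matrix.vecCons b v)) ![a, c, d]
    - altSum (fun v => F (Matrix.vecCons c v)) ![b, a, d]
    - altSum (fun v => F (Matrix.vecCons d v)) ![b, c, a] := by
  have s0 : (fun i : Fin 3 => ![a, b, c, d] (Equiv.swap 0 0 i.succ)) = ![b, c, d] := by
    funext i; fin_cases i <;> rfl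
  have s1 : (fun i : Fin 3 => ![a, b, c, d] (Equiv.swap 0 1 i.succ)) = ![a, c, d] := by
    funext i; fin_cases i <;> rfl
  have s2 : (fun i : Fin 3 => ![a, b, c, d] (Equiv.swap 0 2 i.succ)) = ![b, a, d] := by
    funext i; fin_cases i <;> rfl
  have s3 : (fun i : Fin 3 => ![a, b, c, d] (Equiv.swap 0 3 i.succ)) = ![b, c, a] := by
    funext i; fin_cases i <;> rfl
  rw [altSum_succ, Fin.sum_univ_four, s0, s1, s2, s3]
  simp
  ring

theorem altSum_five_expand (F : Form 5) (a b c d e : Idx) : altSum F ![a, b, c, d, e] =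
    altSum (fun v => F (Matrix.vecCons a v)) ![b, c, d, e]
    - altSum (fun v => F (Matrix.vecCons b v)) ![a, c, d, e]
    - altSum (fun v => F (Matrix.vecCons c v)) ![b, a, d, e]
    - altSum (fun v => F (Matrix.vecCons d v)) ![b, c, a, e]
    - altSum (fun v => F (Matrix.vecCons e v)) ![b, c, d, a] := by
  have s0 : (fun i : Fin 4 => ![a, b, c, d, e] (Equiv.swap 0 0 i.succ)) = ![b, c, d, e] := by
    funext i; fin_cases i <;> rfl
  have s1 : (fun i : Fin 4 => ![a, b, c, d, e] (Equiv.swap 0 1 i.succ)) = ![a, c, d, e] := by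
    funext i; fin_cases i <;> rfl
  have s2 : (fun i : Fin 4 => ![a, b, c, d, e] (Equiv.swap 0 2 i.succ)) = ![b, a, d, e] := by
    funext i; fin_cases i <;> rfl
  have s3 : (fun i : Fin 4 => ![a, b, c, d, e] (Equiv.swap 0 3 i.succ)) = ![b, c, a, e] := by
    funext i; fin_cases i <;> rfl
  have s4 : (fun i : Fin 4 => ![a, b, c, d, e] (Equiv.swap 0 4 i.succ)) = ![b, c, d, a] := by
    funext i; fin_cases i <;> rfl
  rw [altSum_succ, Fin.sum_univ_five, s0, s1, s2, s3, s4]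
  simp
  ring

theorem altSum_six_expand (F : Form 6) (a b c d e g : Idx) : altSum F ![a, b, c, d, e, g] =
    altSum (fun v => F (Matrix.vecCons a v)) ![b, c, d, e, g]
    - altSum (fun v => F (Matrix.vecCons b v)) ![a, c, d, e, g]
    - altSum (fun v => F (Matrix.vecCons c v)) ![b, a, d, e, g]
    - altSum (fun v => F (Matrix.vecCons d v)) ![b, c, a, e, g]
    - altSum (fun v => F (Matrix.vecCons e v)) ![b, c, d, a, g]
    - altSum (fun v => F (Matrix.vecCons g v)) ![b, c, d, e, a] := by
  have s0 : (fun i : Fin 5 => ![a, b, c, d, e, g] (Equiv.swap 0 0 i.succ)) = ![b, c, d, e, g] := by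
    funext i; fin_cases i <;> rfl
  have s1 : (fun i : Fin 5 => ![a, b, c, d, e, g] (Equiv.swap 0 1 i.succ)) = ![a, c, d, e, g] := by
    funext i; fin_cases i <;> rfl
  have s2 : (fun i : Fin 5 => ![a, b, c, d, e, g] (Equiv.swap 0 2 i.succ)) = ![b, a, d, e, g] := by
    funext i; fin_cases i <;> rfl
  have s3 : (fun i : Fin 5 => ![a, b, c, d, e, g] (Equiv.swap 0 3 i.succ)) = ![b, c, a, e, g] := by
    funext i; fin_cases i <;> rfl
  have s4 : (fun i : Fin 5 => ![a, b, c, d, e, g] (Equiv.swap 0 4 i.succ)) = ![b, c, d, a, g] := by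
    funext i; fin_cases i <;> rfl
  have s5 : (fun i : Fin 5 => ![a, b, c, d, e, g] (Equiv.swap 0 5 i.succ)) = ![b, c, d, e, a] := by
    funext i; fin_cases i <;> rfl
  rw [altSum_succ, Fin.sum_univ_six, s0, s1, s2, s3, s4, s5]
  simp
  ring

theorem altSum_comp_perm {n : ℕ} (F : Form n) (ρ : Equiv.Perm (Fin n)) (a : Fin n → Idx) :
    altSum (fun b => F (b ∘ ρ)) a = ((Equiv.Perm.sign ρ : ℤ) : ℂ) * altSum F a := by
  simp only [altSum, Finset.mul_sum]
  refine Fintype.sum_equiv (Equiv.mulRight ρ) _ _ fun σ => ?_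
  have h : ((Equiv.Perm.sign ρ : ℤ) : ℂ) * ((Equiv.Perm.sign ρ : ℤ) : ℂ) = 1 := by
    rcases Int.units_eq_one_or (Equiv.Perm.sign ρ) with h | h <;> simp [h]
  simp only [Equiv.coe_mulRight, Equiv.Perm.sign_mul, Units.val_mul, Int.cast_mul,
    Equiv.Perm.coe_mul, Function.comp_assoc]
  linear_combination (-(((Equiv.Perm.sign σ : ℤ) : ℂ) * F (a ∘ σ ∘ ρ))) * h

theorem altSum_const_mul {n : ℕ} (c : ℂ) (F : Form n) (a : Fin n → Idx) :
    altSum (fun b => c * F b) a = c * altSum F a := by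
  simp only [altSum, Finset.mul_sum]
  exact Finset.sum_congr rfl fun _ _ => by ring

theorem altSum_zero_fun {n : ℕ} (a : Fin n → Idx) : altSum (fun _ => (0 : ℂ)) a = 0 := by
  simp [altSum]

/-- With the 2-form in front, expanding two slots leaves a 4-form that is already alternating, whose
signed sum is 4! times its value. This avoids the full sum over 720 permutations. -/
theorem wedge_four_two_eq (A : Form 4) (B : Form 2) (a b c d e g : Idx) :
    wedge A B ![a, b, c, d, e, g] = 1 / 48 * altSum (fun v : Fin 6 → Idx =>
      B ![v 0, v 1] * A ![v 2, v 3, v 4, v 5]) ![a, b, c, d, e, g] := by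
  rw [wedge_eq_altSum, ← one_mul (altSum _ _)]
  -- Moving the last two slots to the front is the square of a rotation, hence even.
  have hs : ((Equiv.Perm.sign (finRotate 6 * finRotate 6) : ℤ) : ℂ) = 1 := by
    rw [Equiv.Perm.sign_mul]
    rcases Int.units_eq_one_or (Equiv.Perm.sign (finRotate 6)) with h | h <;> simp [h]
  rw [← hs, ← altSum_comp_perm]
  congr 1
  · norm_num [Nat.factorial]
  · congr 1
    funext v
    rw [mul_comm]
    congr 2
    · funext i; fin_cases i <;> rfl
    · funext i; fin_cases i <;> rfl

theorem wedge_omega_cube (G : Matrix (Fin 3) (Fin 3) ℂ) :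
    wedge (wedge (omegaForm G) (omegaForm G)) (omegaForm G) topIdx = 6 * Complex.I * G.det := by
  have hA : IsAlt (wedge (omegaForm G) (omegaForm G)) := isAlt_wedge _ _
  have h4 : ∀ (c : ℂ) (x y z w : Idx), altSum (fun v : Fin 4 → Idx =>
      c * wedge (omegaForm G) (omegaForm G) ![v 0, v 1, v 2, v 3]) ![x, y, z, w] =
      c * (24 * wedge (omegaForm G) (omegaForm G) ![x, y, z, w]) := by
    intro c x y z w
    rw [altSum_const_mul, ← show ((4 ! : ℕ) : ℂ) = 24 by norm_num [Nat.factorial], ← altSum_of_isAlt hA]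
    congr 2
  have h5 : ∀ (c : Idx) (x0 x y z w : Idx), altSum (fun v : Fin 5 → Idx =>
      omegaForm G ![c, v 0] * wedge (omegaForm G) (omegaForm G) ![v 1, v 2, v 3, v 4]) ![x0, x, y, z, w] =
      24 * (omegaForm G ![c, x0] * wedge (omegaForm G) (omegaForm G) ![x, y, z, w]
       - omegaForm G ![c, x] * wedge (omegaForm G) (omegaForm G) ![x0, y, z, w]
       - omegaForm G ![c, y] * wedge (omegaForm G) (omegaForm G) ![x, x0, z, w]
       - omegaForm G ![c, z] * wedge (omegaForm G) (omegaForm G) ![x, y, x0, w]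
       - omegaForm G ![c, w] * wedge (omegaForm G) (omegaForm G) ![x, y, z, x0]) := by
    intro c x0 x y z w
    rw [altSum_five_expand]
    have e : ∀ (t : Idx) (v : Fin 4 → Idx), (Matrix.vecCons t v : Fin 5 → Idx) 0 = t ∧
      (Matrix.vecCons t v : Fin 5 → Idx) 1 = v 0 ∧ (Matrix.vecCons t v : Fin 5 → Idx) 2 = v 1 ∧
      (Matrix.vecCons t v : Fin 5 → Idx) 3 = v 2 ∧ (Matrix.vecCons t v : Fin 5 → Idx) 4 = v 3 :=
      fun t v => ⟨rfl, rfl, rfl, rfl, rfl⟩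
    simp only [e, h4]
    ring
  have e : ∀ (t : Idx) (v : Fin 5 → Idx), (Matrix.vecCons t v : Fin 6 → Idx) 0 = t ∧
      (Matrix.vecCons t v : Fin 6 → Idx) 1 = v 0 ∧ (Matrix.vecCons t v : Fin 6 → Idx) 2 = v 1 ∧
      (Matrix.vecCons t v : Fin 6 → Idx) 3 = v 2 ∧ (Matrix.vecCons t v : Fin 6 → Idx) 4 = v 3 ∧
      (Matrix.vecCons t v : Fin 6 → Idx) 5 = v 4 :=
      fun t v => ⟨rfl, rfl, rfl, rfl, rfl, rfl⟩
  rw [topIdx, wedge_four_two_eq, altSum_six_expand]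
  simp only [e, h5]
  have hw := wedge_two_two (omegaForm G) (omegaForm G) (oneOneForm_swap _) (oneOneForm_swap _)
  have w1 : ∀ j k, omegaForm G ![Sum.inl j, Sum.inr k] = Complex.I * G k j := fun j k => rfl
  have w2 : ∀ j k, omegaForm G ![Sum.inr k, Sum.inl j] = -(Complex.I * G k j) := fun j k => rfl
  have w3 : ∀ j k, omegaForm G ![Sum.inl j, Sum.inl k] = 0 := fun j k => rfl
  have w4 : ∀ j k, omegaForm G ![Sum.inr j, Sum.inr k] = 0 := fun j k => rfl
  have hI : Complex.I ^ 3 = -Complex.I := by rw [pow_succ, Complex.I_sq]; ring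
  simp only [hw, w1, w2, w3, w4]
  rw [Matrix.det_fin_three]
  linear_combination (-6 * (G 0 0 * G 1 1 * G 2 2 - G 0 0 * G 1 2 * G 2 1 - G 0 1 * G 1 0 * G 2 2
    + G 0 1 * G 1 2 * G 2 0 + G 0 2 * G 1 0 * G 2 1 - G 0 2 * G 1 1 * G 2 0)) * hI

theorem volForm_eq_zero_of_inr (f : ℂ) (v : Fin 3 → Idx) (i k : Fin 3) (h : v i = Sum.inr k) :
    volForm f v = 0 := by
  rw [volForm, Matrix.det_eq_zero_of_row_eq_zero i (fun j => by simp [h]), mul_zero]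

/-- On the coordinate frame `volForm` vanishes as soon as one of its three slots carries a barred
label, so the barred labels all go to the conjugate form. -/
theorem wedge_vol (f : ℂ) :
    wedge (volForm f) (volFormConj f) topIdx = f * conj f := by
  have hB : IsAlt (volFormConj f) := by
    intro σ a
    simp only [volFormConj]
    have := Matrix.det_permute σ (Matrix.of fun i j : Fin 3 => if a i = Sum.inr j then (1 : ℂ) else 0)
    rw [← mul_assoc, mul_comm _ (conj f), mul_assoc, ← this]
    rfl
  have hlast : volFormConj f ![Sum.inr 0, Sum.inr 1, Sum.inr 2] = conj f := by
    simp [volFormConj, Matrix.det_fin_three]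
  have h3 : ∀ c : ℂ, altSum (fun v : Fin 3 → Idx => c * volFormConj f ![v 0, v 1, v 2])
      ![Sum.inr 0, Sum.inr 1, Sum.inr 2] = 6 * c * conj f := by
    intro c
    have : (fun v : Fin 3 → Idx => volFormConj f ![v 0, v 1, v 2]) = volFormConj f := by
      funext v; congr 1; funext i; fin_cases i <;> rfl
    rw [altSum_const_mul, this, altSum_of_isAlt hB, hlast]
    norm_num [Nat.factorial]
    ring
  have z0 : ∀ k x y, volForm f ![Sum.inr k, x, y] = 0 := fun k x y =>
    volForm_eq_zero_of_inr f _ 0 k rfl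
  have z1 : ∀ k x y, volForm f ![x, Sum.inr k, y] = 0 := fun k x y =>
    volForm_eq_zero_of_inr f _ 1 k rfl
  have z2 : ∀ k x y, volForm f ![x, y, Sum.inr k] = 0 := fun k x y =>
    volForm_eq_zero_of_inr f _ 2 k rfl
  have hv : ∀ v : Fin 6 → Idx, volForm f (fun i => v (Fin.castAdd 3 i)) *
      volFormConj f (fun i => v (Fin.natAdd 3 i)) =
      volForm f ![v 0, v 1, v 2] * volFormConj f ![v 3, v 4, v 5] := by
    intro v
    congr 2
    · funext i; fin_cases i <;> rfl
    · funext i; fin_cases i <;> rfl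
  rw [wedge_eq_altSum]
  change _ * altSum (fun v : Fin 6 → Idx => volForm f (fun i => v (Fin.castAdd 3 i)) *
      volFormConj f (fun i => v (Fin.natAdd 3 i))) topIdx = _
  simp only [hv]
  have e6 : ∀ (t : Idx) (v : Fin 5 → Idx), (Matrix.vecCons t v : Fin 6 → Idx) 0 = t ∧
      (Matrix.vecCons t v : Fin 6 → Idx) 1 = v 0 ∧ (Matrix.vecCons t v : Fin 6 → Idx) 2 = v 1 ∧
      (Matrix.vecCons t v : Fin 6 → Idx) 3 = v 2 ∧ (Matrix.vecCons t v : Fin 6 → Idx) 4 = v 3 ∧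
      (Matrix.vecCons t v : Fin 6 → Idx) 5 = v 4 :=
      fun t v => ⟨rfl, rfl, rfl, rfl, rfl, rfl⟩
  have e5 : ∀ (t : Idx) (v : Fin 4 → Idx), (Matrix.vecCons t v : Fin 5 → Idx) 0 = t ∧
      (Matrix.vecCons t v : Fin 5 → Idx) 1 = v 0 ∧ (Matrix.vecCons t v : Fin 5 → Idx) 2 = v 1 ∧
      (Matrix.vecCons t v : Fin 5 → Idx) 3 = v 2 ∧ (Matrix.vecCons t v : Fin 5 → Idx) 4 = v 3 :=
      fun t v => ⟨rfl, rfl, rfl, rfl, rfl⟩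
  have e4 : ∀ (t : Idx) (v : Fin 3 → Idx), (Matrix.vecCons t v : Fin 4 → Idx) 0 = t ∧
      (Matrix.vecCons t v : Fin 4 → Idx) 1 = v 0 ∧ (Matrix.vecCons t v : Fin 4 → Idx) 2 = v 1 ∧
      (Matrix.vecCons t v : Fin 4 → Idx) 3 = v 2 :=
      fun t v => ⟨rfl, rfl, rfl, rfl⟩
  rw [topIdx, altSum_six_expand]
  simp only [e6, z0, zero_mul, altSum_zero_fun, sub_zero]
  simp only [altSum_five_expand, e5, z1, zero_mul, altSum_zero_fun, sub_zero]
  simp only [altSum_four_expand, e4, z2, zero_mul, altSum_zero_fun, sub_zero, h3]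
  simp [volForm, Matrix.det_fin_three, Nat.factorial]
  ring

/-- Here i Ω ∧ Ω̄ and ω³ have top components i|f|² and 6i det g, whence the constant 1/6. -/
theorem volNorm_sq_mul_det {f : ℂ} {G : Matrix (Fin 3) (Fin 3) ℂ} {d : ℝ} (hd : 0 < d)
    (hG : G.det = d) : (volNorm f G : ℂ) * volNorm f G * G.det = (1 / 6 : ℂ) * (f * conj f) := by
  have h : (Complex.I * wedge (volForm f) (volFormConj f) topIdx) /
      wedge (wedge (omegaForm G) (omegaForm G)) (omegaForm G) topIdx =
      ((Complex.normSq f / (6 * d) : ℝ) : ℂ) := by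
    rw [wedge_vol, wedge_omega_cube, hG, Complex.mul_conj]
    have hd' : (d : ℂ) ≠ 0 := Complex.ofReal_ne_zero.2 hd.ne'
    push_cast
    field_simp
  rw [volNorm, h, Complex.ofReal_re, ← Complex.ofReal_mul, Real.mul_self_sqrt
    (div_nonneg (Complex.normSq_nonneg f) (by positivity)), hG, Complex.mul_conj]
  have hd' : (d : ℂ) ≠ 0 := Complex.ofReal_ne_zero.2 hd.ne'
  push_cast
  field_simp

theorem volNorm_pos {f : ℂ} {G : Matrix (Fin 3) (Fin 3) ℂ} {d : ℝ} (hd : 0 < d)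
    (hG : G.det = d) (hf : f ≠ 0) : 0 < volNorm f G := by
  refine lt_of_le_of_ne (Real.sqrt_nonneg _) fun h => ?_
  have := volNorm_sq_mul_det (f := f) hd hG
  rw [← h] at this
  have : f = 0 := by simpa using this
  exact hf this

/-! ### Exterior derivatives of alternating arrays -/

/-- The array `∑ₗ θˡ ∧ βₗ`. -/
def extSum {n : ℕ} (β : Idx → Form n) : Form (n + 1) := fun a =>
  ∑ i : Fin (n + 1), (-1 : ℂ) ^ (i : ℕ) * β (a i) (fun r => a (i.succAbove r))

/-- Up to 1/n!, the array is the signed sum over all permutations of θ ⊗ β, which is alternating for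
trivial reasons. -/
theorem isAlt_extSum {n : ℕ} {β : Idx → Form n} (hβ : ∀ l, IsAlt (β l)) : IsAlt (extSum β) := by
  have h : ∀ a, extSum β a = (n ! : ℂ)⁻¹ *
      altSum (fun b : Fin (n + 1) → Idx => β (b 0) (fun i => b i.succ)) a := by
    intro a
    rw [altSum_succ, Finset.mul_sum]
    refine Finset.sum_congr rfl fun p _ => ?_
    simp only [Matrix.cons_val_zero, Matrix.cons_val_succ]
    have e : altSum (fun b => β (a p) fun i => b i) (fun i => a (Equiv.swap 0 p i.succ)) =
        (n ! : ℂ) * β (a p) (fun i => a (Equiv.swap 0 p i.succ)) := altSum_of_isAlt (hβ (a p)) _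
    have hn : (n ! : ℂ) ≠ 0 := Nat.cast_ne_zero.2 n.factorial_ne_zero
    rw [e, mul_left_comm, ← mul_assoc _ _ (β _ _), inv_mul_cancel₀ hn, one_mul]
    refine Fin.cases ?_ (fun i => ?_) p
    · simp
    -- The expansion lists the remaining labels through a transposition, `extSum` in increasing
    -- order. They differ by a cycle, whose sign turns the uniform -1 into the alternating sign.
    · have h2 : (fun r => a (Equiv.swap 0 i.succ r.succ)) =
          (fun r => a (i.succ.succAbove r)) ∘ i.cycleRange := by
        funext r
        simp [Fin.succAbove_cycleRange]
      rw [h2, hβ, Fin.sign_cycleRange]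
      simp [pow_succ]
  intro σ a
  rw [h, h, isAlt_altSum]
  ring

theorem dHol_neg (j : Fin 3) (f : C3 → ℂ) (z : C3) : dHol j (fun w => -f w) z = -dHol j f z := by
  have : fderiv ℝ (fun w => -f w) z = -fderiv ℝ f z := fderiv_neg
  simp only [dHol, this, neg_apply]
  ring

theorem dAnti_neg (j : Fin 3) (f : C3 → ℂ) (z : C3) :
    dAnti j (fun w => -f w) z = -dAnti j f z := by
  have : fderiv ℝ (fun w => -f w) z = -fderiv ℝ f z := fderiv_neg
  simp only [dAnti, this, neg_apply]
  ring

theorem dHol_congr {j : Fin 3} {f g : C3 → ℂ} {z : C3} (h : f =ᶠ[nhds z] g) :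
    dHol j f z = dHol j g z := by
  simp only [dHol, h.fderiv_eq]

theorem dAnti_congr {j : Fin 3} {f g : C3 → ℂ} {z : C3} (h : f =ᶠ[nhds z] g) :
    dAnti j f z = dAnti j g z := by
  simp only [dAnti, h.fderiv_eq]

theorem dHol_zero (j : Fin 3) (z : C3) : dHol j (fun _ => 0) z = 0 := by simp [dHol]

theorem dAnti_zero (j : Fin 3) (z : C3) : dAnti j (fun _ => 0) z = 0 := by simp [dAnti]

theorem isAlt_zero {n : ℕ} : IsAlt (0 : Form n) := fun _ _ => by simp

theorem delForm_eq_extSum {n : ℕ} (α : C3 → Form n) (z : C3) : delForm α z =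
    extSum (Sum.elim (fun j b => dHol j (fun w => α w b) z) (fun _ => 0)) := by
  funext a
  refine Finset.sum_congr rfl fun i _ => ?_
  rcases a i with j | j <;> rfl

theorem delbarForm_eq_extSum {n : ℕ} (α : C3 → Form n) (z : C3) : delbarForm α z =
    extSum (Sum.elim (fun _ => 0) (fun j b => dAnti j (fun w => α w b) z)) := by
  funext a
  refine Finset.sum_congr rfl fun i _ => ?_
  rcases a i with j | j <;> rfl

theorem isAlt_delForm {n : ℕ} {α : C3 → Form n} (hα : ∀ w, IsAlt (α w)) (z : C3) :
    IsAlt (delForm α z) := by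
  rw [delForm_eq_extSum]
  refine isAlt_extSum fun l => ?_
  rcases l with j | j
  · intro σ a
    simp only [Sum.elim_inl, hα _ σ a]
    rcases Int.units_eq_one_or (Equiv.Perm.sign σ) with h | h <;> simp [h, dHol_neg]
  · exact isAlt_zero

theorem isAlt_delbarForm {n : ℕ} {α : C3 → Form n} (hα : ∀ w, IsAlt (α w)) (z : C3) :
    IsAlt (delbarForm α z) := by
  rw [delbarForm_eq_extSum]
  refine isAlt_extSum fun l => ?_
  rcases l with j | j
  · exact isAlt_zero
  · intro σ a
    simp only [Sum.elim_inr, hα _ σ a]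
    rcases Int.units_eq_one_or (Equiv.Perm.sign σ) with h | h <;> simp [h, dAnti_neg]

theorem IsAlt.add {n : ℕ} {α β : Form n} (hα : IsAlt α) (hβ : IsAlt β) : IsAlt (α + β) :=
  fun σ a => by simp only [Pi.add_apply, hα σ a, hβ σ a]; ring

theorem IsAlt.sub {n : ℕ} {α β : Form n} (hα : IsAlt α) (hβ : IsAlt β) : IsAlt (α - β) :=
  fun σ a => by simp only [Pi.sub_apply, hα σ a, hβ σ a]; ring

theorem IsAlt.smul {n : ℕ} {α : Form n} (hα : IsAlt α) (c : ℂ) : IsAlt (c • α) :=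
  fun σ a => by simp only [Pi.smul_apply, smul_eq_mul, hα σ a]; ring

theorem IsAlt.sum {n : ℕ} {ι : Type*} (s : Finset ι) {α : ι → Form n} (hα : ∀ i, IsAlt (α i)) :
    IsAlt (∑ i ∈ s, α i) :=
  fun σ a => by simp only [Finset.sum_apply, hα _ σ a, Finset.mul_sum]

theorem IsTwoTwo.add {α β : Form 4} (hα : IsTwoTwo α) (hβ : IsTwoTwo β) : IsTwoTwo (α + β) := by
  intro a ha
  by_contra h
  rw [Pi.add_apply, by_contra fun h' => h (hα a h'), by_contra fun h' => h (hβ a h'), add_zero] at ha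
  exact ha rfl

theorem IsTwoTwo.smul {α : Form 4} (hα : IsTwoTwo α) (c : ℂ) : IsTwoTwo (c • α) :=
  fun a ha => hα a (right_ne_zero_of_mul ha)

theorem IsTwoTwo.sub {α β : Form 4} (hα : IsTwoTwo α) (hβ : IsTwoTwo β) : IsTwoTwo (α - β) := by
  rw [sub_eq_add_neg, ← neg_one_smul ℂ β]
  exact hα.add (hβ.smul _)

theorem IsTwoTwo.sum {ι : Type*} (s : Finset ι) {α : ι → Form 4} (hα : ∀ i, IsTwoTwo (α i)) :
    IsTwoTwo (∑ i ∈ s, α i) := by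
  intro a ha
  rw [Finset.sum_apply] at ha
  obtain ⟨i, _, hi⟩ := Finset.exists_ne_zero_of_sum_ne_zero ha
  exact hα i a hi

/-- An alternating array of degree five vanishes if it vanishes on the tuples that omit one label. -/
theorem eq_zero_of_isAlt_five {α : Form 5} (hα : IsAlt α)
    (h1 : ∀ j : Fin 3, α ![Sum.inl (j + 1), Sum.inl (j + 2), Sum.inr 0, Sum.inr 1, Sum.inr 2] = 0)
    (h2 : ∀ k : Fin 3, α ![Sum.inl 0, Sum.inl 1, Sum.inl 2, Sum.inr (k + 1), Sum.inr (k + 2)] = 0) :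
    α = 0 := by
  funext a
  by_contra ha
  have hinj : Function.Injective a := by
    intro i j hij
    by_contra hne
    have hs : a ∘ Equiv.swap i j = a := by
      funext r
      rcases eq_or_ne r i with rfl | hr
      · simp [hij]
      · rcases eq_or_ne r j with rfl | hr'
        · simp [hij]
        · simp [Equiv.swap_apply_of_ne_of_ne hr hr']
    have := hα (Equiv.swap i j) a
    rw [hs, Equiv.Perm.sign_swap hne] at this
    have h0 : α a = 0 := by
      have h2 : (2 : ℂ) * α a = 0 := by push_cast at this; linear_combination this
      simpa using h2
    exact ha h0
  obtain ⟨m, hm⟩ : ∃ m, m ∉ Set.range a := by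
    by_contra hall
    push Not at hall
    have := Fintype.card_le_of_surjective a hall
    simp at this
  -- An injective 5-tuple among six labels omits exactly one label m. Both tuples enumerate the
  -- labels other than m, so they differ by a permutation and α vanishes on both or on neither.
  have key : ∀ ref : Fin 5 → Idx, Function.Injective ref → (∀ i, ref i ≠ m) → α ref = 0 → False := by
    intro ref hr hrm h0
    have hc : Fintype.card (Fin 5) = Fintype.card {x : Idx // x ≠ m} := by simp
    have b1 : Function.Bijective (fun i => (⟨a i, fun h => hm ⟨i, h⟩⟩ : {x : Idx // x ≠ m})) :=
      (Fintype.bijective_iff_injective_and_card _).2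
        ⟨fun i j h => hinj (congrArg Subtype.val h), hc⟩
    have b2 : Function.Bijective (fun i => (⟨ref i, hrm i⟩ : {x : Idx // x ≠ m})) :=
      (Fintype.bijective_iff_injective_and_card _).2
        ⟨fun i j h => hr (congrArg Subtype.val h), hc⟩
    set σ : Equiv.Perm (Fin 5) := (Equiv.ofBijective _ b1).trans (Equiv.ofBijective _ b2).symm with hσ
    have hs : ref ∘ σ = a := by
      funext i
      have := (Equiv.ofBijective _ b2).apply_symm_apply (Equiv.ofBijective _ b1 i)
      exact congrArg Subtype.val this
    have := hα σ ref
    rw [hs, h0, mul_zero] at this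
    exact ha this
  rcases m with j | k
  · refine key _ ?_ ?_ (h1 j)
    · clear * -; revert j; decide
    · clear * -; revert j; decide
  · refine key _ ?_ ?_ (h2 k)
    · clear * -; revert k; decide
    · clear * -; revert k; decide

theorem IsAlt.swap_one_two {α : Form 4} (hα : IsAlt α) (a b c d : Idx) :
    α ![a, b, c, d] = -α ![a, c, b, d] := by
  have h := hα (Equiv.swap 1 2) ![a, c, b, d]
  have e : (![a, c, b, d] : Fin 4 → Idx) ∘ Equiv.swap 1 2 = ![a, b, c, d] := by
    funext i; fin_cases i <;> rfl
  rw [e, Equiv.Perm.sign_swap (by decide)] at h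
  simpa using h

theorem IsAlt.swap_zero_two {α : Form 4} (hα : IsAlt α) (a b c d : Idx) :
    α ![a, b, c, d] = -α ![c, b, a, d] := by
  have h := hα (Equiv.swap 0 2) ![c, b, a, d]
  have e : (![c, b, a, d] : Fin 4 → Idx) ∘ Equiv.swap 0 2 = ![a, b, c, d] := by
    funext i; fin_cases i <;> rfl
  rw [e, Equiv.Perm.sign_swap (by decide)] at h
  simpa using h

theorem IsAlt.swap_one_three {α : Form 4} (hα : IsAlt α) (a b c d : Idx) :
    α ![a, b, c, d] = -α ![a, d, c, b] := by
  have h := hα (Equiv.swap 1 3) ![a, d, c, b]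
  have e : (![a, d, c, b] : Fin 4 → Idx) ∘ Equiv.swap 1 3 = ![a, b, c, d] := by
    funext i; fin_cases i <;> rfl
  rw [e, Equiv.Perm.sign_swap (by decide)] at h
  simpa using h

theorem extSum_three (β : Idx → Form 2) (a b c : Idx) : extSum β ![a, b, c] =
    β a ![b, c] - β b ![a, c] + β c ![a, b] := by
  have e0 : (fun r => ![a, b, c] ((0 : Fin 3).succAbove r)) = ![b, c] := by
    funext i; fin_cases i <;> rfl
  have e1 : (fun r => ![a, b, c] ((1 : Fin 3).succAbove r)) = ![a, c] := by
    funext i; fin_cases i <;> rfl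
  have e2 : (fun r => ![a, b, c] ((2 : Fin 3).succAbove r)) = ![a, b] := by
    funext i; fin_cases i <;> rfl
  change ∑ i : Fin 3, (-1 : ℂ) ^ (i : ℕ) * β (![a, b, c] i) (fun r => ![a, b, c] (i.succAbove r)) = _
  rw [Fin.sum_univ_three, e0, e1, e2]
  simp
  ring

theorem extSum_four (β : Idx → Form 3) (a b c d : Idx) : extSum β ![a, b, c, d] =
    β a ![b, c, d] - β b ![a, c, d] + β c ![a, b, d] - β d ![a, b, c] := by
  have e0 : (fun r => ![a, b, c, d] ((0 : Fin 4).succAbove r)) = ![b, c, d] := by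
    funext i; fin_cases i <;> rfl
  have e1 : (fun r => ![a, b, c, d] ((1 : Fin 4).succAbove r)) = ![a, c, d] := by
    funext i; fin_cases i <;> rfl
  have e2 : (fun r => ![a, b, c, d] ((2 : Fin 4).succAbove r)) = ![a, b, d] := by
    funext i; fin_cases i <;> rfl
  have e3 : (fun r => ![a, b, c, d] ((3 : Fin 4).succAbove r)) = ![a, b, c] := by
    funext i; fin_cases i <;> rfl
  change ∑ i : Fin 4, (-1 : ℂ) ^ (i : ℕ) * β (![a, b, c, d] i) (fun r => ![a, b, c, d] (i.succAbove r)) = _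
  rw [Fin.sum_univ_four, e0, e1, e2, e3]
  simp [pow_succ]
  ring

theorem extSum_five (β : Idx → Form 4) (a b c d e : Idx) : extSum β ![a, b, c, d, e] =
    β a ![b, c, d, e] - β b ![a, c, d, e] + β c ![a, b, d, e] - β d ![a, b, c, e]
      + β e ![a, b, c, d] := by
  have e0 : (fun r => ![a, b, c, d, e] ((0 : Fin 5).succAbove r)) = ![b, c, d, e] := by
    funext i; fin_cases i <;> rfl
  have e1 : (fun r => ![a, b, c, d, e] ((1 : Fin 5).succAbove r)) = ![a, c, d, e] := by
    funext i; fin_cases i <;> rfl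
  have e2 : (fun r => ![a, b, c, d, e] ((2 : Fin 5).succAbove r)) = ![a, b, d, e] := by
    funext i; fin_cases i <;> rfl
  have e3 : (fun r => ![a, b, c, d, e] ((3 : Fin 5).succAbove r)) = ![a, b, c, e] := by
    funext i; fin_cases i <;> rfl
  have e4 : (fun r => ![a, b, c, d, e] ((4 : Fin 5).succAbove r)) = ![a, b, c, d] := by
    funext i; fin_cases i <;> rfl
  change ∑ i : Fin 5, (-1 : ℂ) ^ (i : ℕ) * β (![a, b, c, d, e] i) (fun r => ![a, b, c, d, e] (i.succAbove r)) = _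
  rw [Fin.sum_univ_five, e0, e1, e2, e3, e4]
  simp [pow_succ]
  ring

theorem isAlt_dForm {n : ℕ} {α : C3 → Form n} (hα : ∀ w, IsAlt (α w)) (z : C3) :
    IsAlt (dForm α z) := (isAlt_delForm hα z).add (isAlt_delbarForm hα z)

/-! ### Closedness of a (2,2)-form as a divergence condition -/

section FourForm

variable {Ψ : C3 → Form 4} {z : C3}

theorem eventuallyEq_zero_of_type (ht : ∀ᶠ w in nhds z, IsTwoTwo (Ψ w)) {a : Fin 4 → Idx}
    (ha : (Finset.univ.filter fun i => (a i).isLeft = true).card ≠ 2) :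
    (fun w => Ψ w a) =ᶠ[nhds z] fun _ => 0 := by
  filter_upwards [ht] with w hw
  exact by_contra fun h => ha (hw a h)

/-- The ∂-terms would differentiate components of type (1,3), which vanish near z; this is why the
type is required on a neighbourhood. Three ∂̄-terms survive, and alternation brings them to the
cyclic order of the dual matrix. -/
theorem dForm_inl (hα : ∀ w, IsAlt (Ψ w)) (ht : ∀ᶠ w in nhds z, IsTwoTwo (Ψ w)) (j : Fin 3) :
    dForm Ψ z ![Sum.inl (j + 1), Sum.inl (j + 2), Sum.inr 0, Sum.inr 1, Sum.inr 2] =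
      -∑ k, dAnti k (fun w => Ψ w ![Sum.inl (j + 1), Sum.inr (k + 1), Sum.inl (j + 2),
        Sum.inr (k + 2)]) z := by
  have hz : ∀ (l q : Fin 3), dHol l (fun w => Ψ w ![Sum.inl q, Sum.inr 0, Sum.inr 1, Sum.inr 2]) z = 0 :=
    fun l q => by
      rw [dHol_congr (eventuallyEq_zero_of_type ht (by rw [card_isLeft]; simp)), dHol_zero]
  rw [dForm, Pi.add_apply, delForm_eq_extSum, delbarForm_eq_extSum, extSum_five, extSum_five]
  simp only [Sum.elim_inl, Sum.elim_inr, Pi.zero_apply, hz, Fin.sum_univ_three]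
  have e : (1 : Fin 3) + 1 = 2 ∧ (1 : Fin 3) + 2 = 0 ∧ (2 : Fin 3) + 1 = 0 ∧ (2 : Fin 3) + 2 = 1 := by
    decide
  have h0 : ∀ w (q s r p : Fin 3), Ψ w ![Sum.inl q, Sum.inl s, Sum.inr r, Sum.inr p] =
      -Ψ w ![Sum.inl q, Sum.inr r, Sum.inl s, Sum.inr p] := fun w q s r p => (hα w).swap_one_two _ _ _ _
  have h1 : ∀ w (q s : Fin 3), Ψ w ![Sum.inl q, Sum.inr 0, Sum.inl s, Sum.inr 2] =
      -Ψ w ![Sum.inl q, Sum.inr 2, Sum.inl s, Sum.inr 0] := fun w q s => (hα w).swap_one_three _ _ _ _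
  simp only [zero_add, e, h0, h1, dAnti_neg]
  ring

theorem dForm_inr (hα : ∀ w, IsAlt (Ψ w)) (ht : ∀ᶠ w in nhds z, IsTwoTwo (Ψ w)) (k : Fin 3) :
    dForm Ψ z ![Sum.inl 0, Sum.inl 1, Sum.inl 2, Sum.inr (k + 1), Sum.inr (k + 2)] =
      -∑ j, dHol j (fun w => Ψ w ![Sum.inl (j + 1), Sum.inr (k + 1), Sum.inl (j + 2),
        Sum.inr (k + 2)]) z := by
  have hz : ∀ (l q : Fin 3), dAnti l (fun w => Ψ w ![Sum.inl 0, Sum.inl 1, Sum.inl 2, Sum.inr q]) z = 0 :=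
    fun l q => by
      rw [dAnti_congr (eventuallyEq_zero_of_type ht (by rw [card_isLeft]; simp)), dAnti_zero]
  rw [dForm, Pi.add_apply, delForm_eq_extSum, delbarForm_eq_extSum, extSum_five, extSum_five]
  simp only [Sum.elim_inl, Sum.elim_inr, Pi.zero_apply, hz, Fin.sum_univ_three]
  have e : (1 : Fin 3) + 1 = 2 ∧ (1 : Fin 3) + 2 = 0 ∧ (2 : Fin 3) + 1 = 0 ∧ (2 : Fin 3) + 2 = 1 := by
    decide
  have h0 : ∀ w (q s r p : Fin 3), Ψ w ![Sum.inl q, Sum.inl s, Sum.inr r, Sum.inr p] =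
      -Ψ w ![Sum.inl q, Sum.inr r, Sum.inl s, Sum.inr p] := fun w q s r p => (hα w).swap_one_two _ _ _ _
  have h1 : ∀ w (r p : Fin 3), Ψ w ![Sum.inl 0, Sum.inr r, Sum.inl 2, Sum.inr p] =
      -Ψ w ![Sum.inl 2, Sum.inr r, Sum.inl 0, Sum.inr p] := fun w r p => (hα w).swap_zero_two _ _ _ _
  simp only [zero_add, e, h0, h1, dHol_neg]
  ring

/-- A form of type `(2,2)` is closed if and only if the divergences of the dual bivector vanish. -/
theorem dForm_eq_zero_iff (hα : ∀ w, IsAlt (Ψ w)) (ht : ∀ᶠ w in nhds z, IsTwoTwo (Ψ w)) :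
    dForm Ψ z = 0 ↔
      (∀ j : Fin 3, ∑ k : Fin 3, dAnti k (fun w => Ψ w ![Sum.inl (j + 1), Sum.inr (k + 1),
        Sum.inl (j + 2), Sum.inr (k + 2)]) z = 0) ∧
      (∀ k : Fin 3, ∑ j : Fin 3, dHol j (fun w => Ψ w ![Sum.inl (j + 1), Sum.inr (k + 1),
        Sum.inl (j + 2), Sum.inr (k + 2)]) z = 0) := by
  constructor
  · intro h
    refine ⟨fun j => ?_, fun k => ?_⟩
    · rw [← neg_eq_zero, ← dForm_inl hα ht, h]; rfl
    · rw [← neg_eq_zero, ← dForm_inr hα ht, h]; rfl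
  · rintro ⟨h1, h2⟩
    refine eq_zero_of_isAlt_five (isAlt_dForm hα z) (fun j => ?_) (fun k => ?_)
    · rw [dForm_inl hα ht, h1, neg_zero]
    · rw [dForm_inr hα ht, h2, neg_zero]

end FourForm

theorem isAlt_oneOneForm (h : Matrix (Fin 3) (Fin 3) ℂ) : IsAlt (oneOneForm h) := by
  intro σ a
  have ha : ∀ b : Fin 2 → Idx, b = ![b 0, b 1] := fun b => by funext i; fin_cases i <;> rfl
  have hσ : σ = 1 ∨ σ = Equiv.swap 0 1 := by
    clear * -; revert σ; decide
  rcases hσ with rfl | rfl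
  · simp
  · rw [ha a, ha (_ ∘ _), Equiv.Perm.sign_swap (by decide)]
    simpa using oneOneForm_swap h (a 0) (a 1)

theorem isAlt_iddbarOmega (G : C3 → Matrix (Fin 3) (Fin 3) ℂ) (z : C3) : IsAlt (iddbarOmega G z) :=
  (isAlt_delForm (fun w => isAlt_delbarForm (fun _ => isAlt_oneOneForm _) w) z).smul _

theorem isTwoTwo_iddbarOmega (G : C3 → Matrix (Fin 3) (Fin 3) ℂ) (z : C3) :
    IsTwoTwo (iddbarOmega G z) := by
  refine IsTwoTwo.smul ?_ _
  intro a ha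
  rw [vec_four a] at ha ⊢
  rw [card_isLeft]
  have w3 : ∀ w j k, omegaForm (G w) ![Sum.inl j, Sum.inl k] = 0 := fun w j k => rfl
  have w4 : ∀ w j k, omegaForm (G w) ![Sum.inr j, Sum.inr k] = 0 := fun w j k => rfl
  generalize a 0 = a0 at *
  generalize a 1 = a1 at *
  generalize a 2 = a2 at *
  generalize a 3 = a3 at *
  rcases a0 with _ | _ <;> rcases a1 with _ | _ <;> rcases a2 with _ | _ <;>
    rcases a3 with _ | _ <;>
    simp [delForm_eq_extSum, delbarForm_eq_extSum, extSum_three, extSum_four, w3, w4, dHol_zero,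
      dAnti_zero] at ha ⊢

theorem iddbarOmega_apply (G : C3 → Matrix (Fin 3) (Fin 3) ℂ) (z : C3) (q r s p : Fin 3) :
    iddbarOmega G z ![Sum.inl q, Sum.inr r, Sum.inl s, Sum.inr p] = Complex.I *
      (dHol q (fun w => dAnti r (fun v => Complex.I * G v p s) w
        - dAnti p (fun v => Complex.I * G v r s) w) z
      + dHol s (fun w => -dAnti r (fun v => Complex.I * G v p q) w
        + dAnti p (fun v => Complex.I * G v r q) w) z) := by
  have w1 : ∀ w j k, omegaForm (G w) ![Sum.inl j, Sum.inr k] = Complex.I * G w k j := fun w j k => rfl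
  have w2 : ∀ w j k, omegaForm (G w) ![Sum.inr k, Sum.inl j] = -(Complex.I * G w k j) :=
    fun w j k => rfl
  simp only [iddbarOmega, Pi.smul_apply, smul_eq_mul, delForm_eq_extSum, delbarForm_eq_extSum,
    extSum_four, extSum_three, Sum.elim_inl, Sum.elim_inr, Pi.zero_apply, w1, w2, dAnti_neg]
  simp [sub_eq_add_neg]

theorem traceRmRm_apply (G : C3 → Matrix (Fin 3) (Fin 3) ℂ) (z : C3) (q r s p : Fin 3) :
    traceRmRm G z ![Sum.inl q, Sum.inr r, Sum.inl s, Sum.inr p] = curvSqAlt G p s r q z := by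
  simp only [traceRmRm, Finset.sum_apply, curvForm, wedge_oneOneForm, Matrix.of_apply, curvSqAlt,
    curvSq, Finset.sum_add_distrib, Finset.sum_sub_distrib]
  ring

theorem isAlt_traceRmRm (G : C3 → Matrix (Fin 3) (Fin 3) ℂ) (z : C3) : IsAlt (traceRmRm G z) :=
  IsAlt.sum _ fun _ => IsAlt.sum _ fun _ => isAlt_wedge _ _

theorem isTwoTwo_traceRmRm (G : C3 → Matrix (Fin 3) (Fin 3) ℂ) (z : C3) :
    IsTwoTwo (traceRmRm G z) :=
  IsTwoTwo.sum _ fun _ => IsTwoTwo.sum _ fun _ => isTwoTwo_wedge_oneOneForm _ _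

theorem isAlt_balancedForm (f : ℂ) (G : Matrix (Fin 3) (Fin 3) ℂ) : IsAlt (balancedForm f G) :=
  (isAlt_wedge _ _).smul _

theorem isTwoTwo_balancedForm (f : ℂ) (G : Matrix (Fin 3) (Fin 3) ℂ) :
    IsTwoTwo (balancedForm f G) :=
  (isTwoTwo_wedge_oneOneForm _ _).smul _

theorem balancedForm_apply (f : ℂ) (G : Matrix (Fin 3) (Fin 3) ℂ) (q r s p : Fin 3) :
    balancedForm f G ![Sum.inl q, Sum.inr r, Sum.inl s, Sum.inr p] =
      -2 * volNorm f G * (G r q * G p s - G p q * G r s) := by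
  simp only [balancedForm, Pi.smul_apply, smul_eq_mul, omegaForm, wedge_oneOneForm,
    Matrix.smul_apply]
  linear_combination (2 * (volNorm f G : ℂ) * (G r q * G p s - G p q * G r s)) * Complex.I_mul_I

/-! ### Smoothness of holomorphic functions of several variables -/

section Osgood

open Metric

theorem hasDerivAt_comp_line {f : C3 → ℂ} {z v : C3} {ζ : ℂ}
    (h : DifferentiableAt ℂ f (z + ζ • v)) :
    HasDerivAt (fun ζ : ℂ => f (z + ζ • v)) (fderiv ℂ f (z + ζ • v) v) ζ := by
  have hl : HasDerivAt (fun ζ : ℂ => z + ζ • v) v ζ := by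
    simpa using ((hasDerivAt_id ζ).smul_const v).const_add z
  exact h.hasFDerivAt.comp_hasDerivAt ζ hl

/-- Cauchy's estimate for the restriction of f to the complex line through w in direction u, on the
disc of radius R/‖u‖. -/
theorem norm_fderiv_le_of_bounded {f : C3 → ℂ} {w : C3} {R M : ℝ} (hR : 0 < R)
    (hd : DifferentiableOn ℂ f (ball w (2 * R))) (hM : ∀ x ∈ ball w (2 * R), ‖f x‖ ≤ M) :
    ‖fderiv ℂ f w‖ ≤ M / R := by
  have hM0 : 0 ≤ M := (norm_nonneg _).trans (hM w (mem_ball_self (by positivity)))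
  refine ContinuousLinearMap.opNorm_le_bound _ (by positivity) fun u => ?_
  rcases eq_or_ne u 0 with rfl | hu
  · simp
  have hu' : 0 < ‖u‖ := norm_pos_iff.2 hu
  have hmem : ∀ ζ : ℂ, ‖ζ‖ ≤ R / ‖u‖ → w + ζ • u ∈ ball w (2 * R) := by
    intro ζ hζ
    rw [mem_ball_iff_norm, add_sub_cancel_left, norm_smul]
    calc ‖ζ‖ * ‖u‖ ≤ R / ‖u‖ * ‖u‖ := by gcongr
      _ = R := by field_simp
      _ < 2 * R := by linarith
  have hder : ∀ ζ : ℂ, ‖ζ‖ ≤ R / ‖u‖ → HasDerivAt (fun ζ : ℂ => f (w + ζ • u))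
      (fderiv ℂ f (w + ζ • u) u) ζ := fun ζ hζ =>
    hasDerivAt_comp_line (hd.differentiableAt (isOpen_ball.mem_nhds (hmem ζ hζ)))
  have h0 := Complex.norm_deriv_le_of_forall_mem_sphere_norm_le (c := 0) (C := M)
    (f := fun ζ : ℂ => f (w + ζ • u)) (R := R / ‖u‖) (by positivity) ?_ ?_
  · rw [(hder 0 (by simp; positivity)).deriv, zero_smul, add_zero] at h0
    calc _ ≤ M / (R / ‖u‖) := h0
      _ = M / R * ‖u‖ := by field_simp
  · refine DifferentiableOn.diffContOnCl fun ζ hζ => ?_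
    rw [closure_ball _ (by positivity), mem_closedBall_zero_iff] at hζ
    exact (hder ζ hζ).differentiableAt.differentiableWithinAt
  · intro ζ hζ
    rw [mem_sphere_zero_iff_norm] at hζ
    exact hM _ (hmem ζ hζ.le)

/-- Along the line in direction v, Cauchy's formula writes the directional derivative as a circle
integral of f. Differentiating under the integral needs only a bound on the first derivative of f,
supplied by Cauchy's estimate. Thus directional derivatives of holomorphic functions are again
holomorphic. -/
theorem differentiableOn_fderiv_apply {U : Set C3} (hU : IsOpen U) {f : C3 → ℂ}
    (hf : DifferentiableOn ℂ f U) (v : C3) : DifferentiableOn ℂ (fun z => fderiv ℂ f z v) U := by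
  intro z₀ hz₀
  refine DifferentiableAt.differentiableWithinAt ?_
  obtain ⟨R, M, hR, hRU, hM⟩ : ∃ R M : ℝ, 0 < R ∧ ball z₀ (4 * R) ⊆ U ∧
      ∀ x ∈ ball z₀ (4 * R), ‖f x‖ ≤ M := by
    have hc : ContinuousAt f z₀ := (hf.differentiableAt (hU.mem_nhds hz₀)).continuousAt
    have h1 : ∀ᶠ x in nhds z₀, ‖f x‖ < ‖f z₀‖ + 1 := hc.norm.eventually_lt_const (by linarith)
    obtain ⟨ε, hε, h⟩ := Metric.eventually_nhds_iff_ball.1 (h1.and (hU.mem_nhds hz₀))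
    refine ⟨ε / 4, ‖f z₀‖ + 1, by positivity, fun x hx => (h x ?_).2, fun x hx => (h x ?_).1.le⟩ <;>
    · convert hx using 2; ring
  have hdiff : ∀ x ∈ ball z₀ (4 * R), DifferentiableAt ℂ f x := fun x hx =>
    hf.differentiableAt (hU.mem_nhds (hRU hx))
  -- The radius keeps the circle around any point of the R-ball inside the 2R-ball, where Cauchy's
  -- estimate applies because f is bounded on the 4R-ball; the summand 1 covers v = 0.
  set ρ : ℝ := R / (‖v‖ + 1) with hρ
  have hρ0 : 0 < ρ := by positivity
  have hρv : ρ * ‖v‖ ≤ R := by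
    rw [hρ, div_mul_eq_mul_div, div_le_iff₀ (by positivity)]
    nlinarith [norm_nonneg v]
  have hmem : ∀ z ∈ ball z₀ R, ∀ ζ : ℂ, ‖ζ‖ ≤ ρ → z + ζ • v ∈ ball z₀ (2 * R) := by
    intro z hz ζ hζ
    rw [mem_ball_iff_norm] at hz ⊢
    calc ‖z + ζ • v - z₀‖ = ‖(z - z₀) + ζ • v‖ := by congr 1; abel
      _ ≤ ‖z - z₀‖ + ‖ζ‖ * ‖v‖ := (norm_add_le _ _).trans (by rw [norm_smul])
      _ < R + R := add_lt_add_of_lt_of_le hz ((by gcongr : ‖ζ‖ * ‖v‖ ≤ ρ * ‖v‖).trans hρv)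
      _ = 2 * R := by ring
  have hsub : ball z₀ (2 * R) ⊆ ball z₀ (4 * R) := ball_subset_ball (by linarith)
  have hbound : ∀ w ∈ ball z₀ (2 * R), ‖fderiv ℂ f w‖ ≤ M / R := by
    intro w hw
    have hsw : ball w (2 * R) ⊆ ball z₀ (4 * R) := by
      intro x hx
      have := dist_triangle x w z₀
      rw [mem_ball] at *
      linarith
    exact norm_fderiv_le_of_bounded hR (fun x hx => (hdiff x (hsw hx)).differentiableWithinAt)
      fun x hx => hM x (hsw hx)
  set c : ℝ → ℂ := fun θ => deriv (circleMap 0 ρ) θ * ((circleMap 0 ρ θ) ^ 2)⁻¹ with hcdef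
  have hcirc : ∀ θ, ‖circleMap 0 ρ θ‖ = ρ := fun θ => by simp [abs_of_pos hρ0]
  have hcc : Continuous c := by
    have hne : ∀ θ, circleMap 0 ρ θ ^ 2 ≠ 0 := fun θ =>
      pow_ne_zero _ (norm_pos_iff.1 (by rw [hcirc]; exact hρ0))
    simp only [hcdef, deriv_circleMap]
    exact ((continuous_circleMap 0 ρ).mul continuous_const).mul
      (((continuous_circleMap 0 ρ).pow 2).inv₀ hne)
  have hcn : ∀ θ, ‖c θ‖ = 1 / ρ := fun θ => by
    simp only [hcdef, deriv_circleMap, norm_mul, norm_inv, norm_pow, hcirc, Complex.norm_I]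
    field_simp
  have hFc : ∀ z ∈ ball z₀ R, Continuous fun θ => c θ * f (z + circleMap 0 ρ θ • v) := by
    intro z hz
    refine hcc.mul (continuous_iff_continuousAt.2 fun θ => ?_)
    have h1 : ContinuousAt f (z + circleMap 0 ρ θ • v) :=
      (hdiff _ (hsub (hmem z hz _ (hcirc θ).le))).continuousAt
    have h2 : Continuous fun θ => z + circleMap 0 ρ θ • v :=
      continuous_const.add ((continuous_circleMap 0 ρ).smul continuous_const)
    exact ContinuousAt.comp (f := fun θ => z + circleMap 0 ρ θ • v) (g := f) h1 h2.continuousAt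
  have hformula : ∀ z ∈ ball z₀ R, fderiv ℂ f z v = (2 * Real.pi * Complex.I : ℂ)⁻¹ *
      ∫ θ in (0 : ℝ)..2 * Real.pi, c θ * f (z + circleMap 0 ρ θ • v) := by
    intro z hz
    have hV : IsOpen {ζ : ℂ | z + ζ • v ∈ ball z₀ (2 * R)} :=
      isOpen_ball.preimage (continuous_const.add (continuous_id.smul continuous_const))
    have hg : DifferentiableOn ℂ (fun ζ : ℂ => f (z + ζ • v)) {ζ : ℂ | z + ζ • v ∈ ball z₀ (2 * R)} :=
      fun ζ hζ => (hasDerivAt_comp_line (hdiff _ (hsub hζ))).differentiableAt.differentiableWithinAt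
    have h := Complex.two_pi_I_inv_smul_circleIntegral_sub_sq_inv_smul_of_differentiable hV
      (c := 0) (R := ρ) (w₀ := 0) (fun ζ hζ => hmem z hz ζ (by simpa using hζ)) hg
      (mem_ball_self hρ0)
    have h0 : HasDerivAt (fun ζ : ℂ => f (z + ζ • v)) (fderiv ℂ f z v) 0 := by
      have := hasDerivAt_comp_line (f := f) (z := z) (v := v) (ζ := 0)
        (hdiff _ (hsub (hmem z hz 0 (by simp [hρ0.le]))))
      simpa using this
    rw [h0.deriv] at h
    rw [← h, smul_eq_mul, circleIntegral]
    congr 1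
    refine intervalIntegral.integral_congr fun θ _ => ?_
    simp [hcdef, mul_assoc]
  have hI : HasFDerivAt (fun z => ∫ θ in (0 : ℝ)..2 * Real.pi, c θ * f (z + circleMap 0 ρ θ • v))
      (∫ θ in (0 : ℝ)..2 * Real.pi, c θ • fderiv ℂ f (z₀ + circleMap 0 ρ θ • v)) z₀ := by
    have hz₀R : z₀ ∈ ball z₀ R := mem_ball_self hR
    refine intervalIntegral.hasFDerivAt_integral_of_dominated_of_fderiv_le
      (F' := fun z θ => c θ • fderiv ℂ f (z + circleMap 0 ρ θ • v))
      (bound := fun _ => 1 / ρ * (M / R)) (ball_mem_nhds z₀ hR) ?_ ?_ ?_ ?_ ?_ ?_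
    · filter_upwards [ball_mem_nhds z₀ hR] with z hz
      exact (hFc z hz).aestronglyMeasurable
    · exact (hFc z₀ hz₀R).intervalIntegrable _ _
    · have h2 : Continuous fun θ => z₀ + circleMap 0 ρ θ • v :=
        continuous_const.add ((continuous_circleMap 0 ρ).smul continuous_const)
      -- Continuity of the derivative of f is not yet known, so the integrand's derivative is only
      -- shown to be measurable.
      have h3 : Measurable fun θ => c θ • fderiv ℂ f (z₀ + circleMap 0 ρ θ • v) :=
        hcc.measurable.smul ((measurable_fderiv ℂ f).comp h2.measurable)
      exact h3.aestronglyMeasurable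
    · refine Filter.Eventually.of_forall fun θ _ z hz => ?_
      rw [norm_smul, hcn]
      gcongr
      exact hbound _ (hmem z hz _ (hcirc θ).le)
    · exact intervalIntegrable_const
    · refine Filter.Eventually.of_forall fun θ _ z hz => ?_
      have h1 := (hdiff _ (hsub (hmem z hz _ (hcirc θ).le))).hasFDerivAt
      have h2 : HasFDerivAt (fun z : C3 => z + circleMap 0 ρ θ • v) (ContinuousLinearMap.id ℂ C3) z :=
        (hasFDerivAt_id z).add_const _
      exact (h1.comp z h2).const_mul (c θ)
  have hd := (hI.differentiableAt.const_mul (2 * Real.pi * Complex.I : ℂ)⁻¹)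
  refine hd.congr_of_eventuallyEq ?_
  filter_upwards [ball_mem_nhds z₀ hR] with z hz
  exact hformula z hz

theorem contDiffOn_of_differentiableOn {U : Set C3} (hU : IsOpen U) (n : ℕ) :
    ∀ {f : C3 → ℂ}, DifferentiableOn ℂ f U → ContDiffOn ℂ n f U := by
  induction n with
  | zero => exact fun hf => contDiffOn_zero.2 hf.continuousOn
  | succ n ih =>
    intro f hf
    rw [Nat.cast_succ, contDiffOn_succ_iff_fderiv_of_isOpen hU]
    refine ⟨hf, by simp, contDiffOn_clm_apply.2 fun v => ih (differentiableOn_fderiv_apply hU hf v)⟩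

theorem contDiffOn_real_of_holomorphic {U : Set C3} (hU : IsOpen U) {f : C3 → ℂ}
    (hf : DifferentiableOn ℂ f U) : ContDiffOn ℝ ∞ f U :=
  (contDiffOn_infty.2 fun n => contDiffOn_of_differentiableOn hU n hf).restrict_scalars ℝ

end Osgood

/-! ### Smooth time-dependent functions on an open subset of `ℂ³` -/

section Slab

open SmoothAlg

/-- The space-time domain `[0,T) × U`. -/
abbrev slab (T : ℝ) (U : Set C3) : Set (ℝ × C3) := Ico 0 T ×ˢ U

variable {T : ℝ} {U : Set C3}

/-- A point of space-time. -/
abbrev slabPt {t : ℝ} (ht : t ∈ Ico 0 T) {z : C3} (hz : z ∈ U) : slab T U := ⟨(t, z), ht, hz⟩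

theorem uniqueDiffOn_slab (hU : IsOpen U) : UniqueDiffOn ℝ (slab T U) :=
  (uniqueDiffOn_Ico 0 T).prod hU.uniqueDiffOn

theorem slab_subset_closure_interior (hU : IsOpen U) :
    slab T U ⊆ closure (interior (slab T U)) := by
  rw [interior_prod_eq, closure_prod_eq, interior_Ico, hU.interior_eq]
  rintro ⟨t, z⟩ ⟨ht, hz⟩
  have hT : (0 : ℝ) ≠ T := (ht.1.trans_lt ht.2).ne
  rw [closure_Ioo hT]
  exact ⟨⟨ht.1, ht.2.le⟩, subset_closure hz⟩

/-- The derivation `(∂/∂xʲ + ε ∂/∂yʲ) / 2` on smooth time-dependent functions. -/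
def slabDeriv (T : ℝ) (hU : IsOpen U) (ε : ℂ) (j : Fin 3) :
    Derivation ℂ (SmoothAlg (slab T U)) (SmoothAlg (slab T U)) :=
  (1 / 2 : ℂ) • (dirDeriv (uniqueDiffOn_slab (T := T) hU) (0, Pi.single j 1)
    + ε • dirDeriv (uniqueDiffOn_slab (T := T) hU) (0, Pi.single j Complex.I))

theorem slabDeriv_apply (hU : IsOpen U) (ε : ℂ) (j : Fin 3) (x : SmoothAlg (slab T U)) :
    slabDeriv T hU ε j x = (1 / 2 : ℂ) • (dirDeriv (uniqueDiffOn_slab (T := T) hU) (0, Pi.single j 1) x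
    + ε • dirDeriv (uniqueDiffOn_slab (T := T) hU) (0, Pi.single j Complex.I) x) := rfl

theorem eval_slabDeriv (hU : IsOpen U) (ε : ℂ) (j : Fin 3) (x : SmoothAlg (slab T U))
    (p : slab T U) : eval p (slabDeriv T hU ε j x) =
      (fderivWithin ℝ (fn x) (slab T U) p (0, Pi.single j 1)
        + ε * fderivWithin ℝ (fn x) (slab T U) p (0, Pi.single j Complex.I)) / 2 := by
  rw [slabDeriv_apply, map_smul, map_add, map_smul, eval_dirDeriv, eval_dirDeriv, smul_eq_mul,
    smul_eq_mul]
  ring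

theorem slabDeriv_comm (hU : IsOpen U) (ε ε' : ℂ) (i j : Fin 3) (x : SmoothAlg (slab T U)) :
    slabDeriv T hU ε i (slabDeriv T hU ε' j x) = slabDeriv T hU ε' j (slabDeriv T hU ε i x) := by
  simp only [slabDeriv_apply, Derivation.map_smul, map_add]
  have h := fun v w => dirDeriv_comm (uniqueDiffOn_slab (T := T) hU)
    (slab_subset_closure_interior hU) v w x
  rw [h (0, Pi.single j 1) (0, Pi.single i 1), h (0, Pi.single j 1) (0, Pi.single i Complex.I),
    h (0, Pi.single j Complex.I) (0, Pi.single i 1),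
    h (0, Pi.single j Complex.I) (0, Pi.single i Complex.I)]
  refine ext_eval fun p => ?_
  simp only [map_smul, map_add, smul_eq_mul]
  ring

/-- The Wirtinger derivations on smooth time-dependent functions. -/
def slabWirtinger (T : ℝ) (hU : IsOpen U) : Wirtinger (SmoothAlg (slab T U)) where
  D := slabDeriv T hU (-Complex.I)
  B := slabDeriv T hU Complex.I
  dt := dirDeriv (uniqueDiffOn_slab hU) (1, 0)
  c := conjHom
  c_c x := ext_eval fun p => by simp
  c_D j x := ext_eval fun p => by
    simp only [eval_conjHom, slabDeriv_apply, ← conjHom_dirDeriv, map_smul, map_add, smul_eq_mul,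
      map_mul, map_div₀, map_neg, map_one, Complex.conj_I, neg_neg, map_ofNat]
  c_dt x := conjHom_dirDeriv _ _ _
  D_D i j x := slabDeriv_comm hU _ _ i j x
  D_B i j x := slabDeriv_comm hU _ _ i j x
  dt_D j x := by
    have h := fun v w => dirDeriv_comm (uniqueDiffOn_slab (T := T) hU)
      (slab_subset_closure_interior hU) v w x
    simp only [slabDeriv_apply, Derivation.map_smul, map_add]
    rw [h (1, 0) (0, Pi.single j 1), h (1, 0) (0, Pi.single j Complex.I)]

theorem hasFDerivAt_slice (hU : IsOpen U) (x : SmoothAlg (slab T U)) {t : ℝ} (ht : t ∈ Ico 0 T)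
    {z : C3} (hz : z ∈ U) {u : C3 → ℂ} (hu : ∀ w (hw : w ∈ U), u w = eval (slabPt ht hw) x) :
    HasFDerivAt u ((fderivWithin ℝ (fn x) (slab T U) (t, z)).comp
      (ContinuousLinearMap.inr ℝ ℝ C3)) z := by
  have h1 : HasFDerivWithinAt (fn x) (fderivWithin ℝ (fn x) (slab T U) (t, z)) (slab T U) (t, z) :=
    (differentiableOn_fn x (t, z) ⟨ht, hz⟩).hasFDerivWithinAt
  have h2 : HasFDerivWithinAt (fun w : C3 => (t, w)) (ContinuousLinearMap.inr ℝ ℝ C3) U z :=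
    (hasFDerivAt_prodMk_right t z).hasFDerivWithinAt
  have h3 := (h1.comp z h2 fun w hw => ⟨ht, hw⟩).hasFDerivAt (hU.mem_nhds hz)
  refine h3.congr_of_eventuallyEq ?_
  filter_upwards [hU.mem_nhds hz] with w hw
  rw [hu w hw, Function.comp_apply, fn_of_mem x (p := (t, w)) ⟨ht, hw⟩]

theorem dHol_eq_eval (hU : IsOpen U) (x : SmoothAlg (slab T U)) {t : ℝ} (ht : t ∈ Ico 0 T)
    {z : C3} (hz : z ∈ U) {u : C3 → ℂ} (hu : ∀ w (hw : w ∈ U), u w = eval (slabPt ht hw) x)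
    (j : Fin 3) : dHol j u z = eval (slabPt ht hz) ((slabWirtinger T hU).D j x) := by
  rw [dHol, (hasFDerivAt_slice hU x ht hz hu).fderiv]
  simp only [slabWirtinger, eval_slabDeriv, ContinuousLinearMap.comp_apply,
    ContinuousLinearMap.inr_apply]
  ring

theorem dAnti_eq_eval (hU : IsOpen U) (x : SmoothAlg (slab T U)) {t : ℝ} (ht : t ∈ Ico 0 T)
    {z : C3} (hz : z ∈ U) {u : C3 → ℂ} (hu : ∀ w (hw : w ∈ U), u w = eval (slabPt ht hw) x)
    (j : Fin 3) : dAnti j u z = eval (slabPt ht hz) ((slabWirtinger T hU).B j x) := by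
  rw [dAnti, (hasFDerivAt_slice hU x ht hz hu).fderiv]
  simp only [slabWirtinger, eval_slabDeriv, ContinuousLinearMap.comp_apply,
    ContinuousLinearMap.inr_apply]

theorem hasDerivWithinAt_eval (hU : IsOpen U) (x : SmoothAlg (slab T U)) {t : ℝ}
    (ht : t ∈ Ico 0 T) {z : C3} (hz : z ∈ U) {u : ℝ → ℂ}
    (hu : ∀ s (hs : s ∈ Ico 0 T), u s = eval (slabPt hs hz) x) :
    HasDerivWithinAt u (eval (slabPt ht hz) ((slabWirtinger T hU).dt x)) (Ico 0 T) t := by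
  have h1 : HasFDerivWithinAt (fn x) (fderivWithin ℝ (fn x) (slab T U) (t, z)) (slab T U) (t, z) :=
    (differentiableOn_fn x (t, z) ⟨ht, hz⟩).hasFDerivWithinAt
  have h2 : HasFDerivWithinAt (fun s : ℝ => (s, z)) (ContinuousLinearMap.inl ℝ ℝ C3) (Ico 0 T) t :=
    (hasFDerivAt_prodMk_left t z).hasFDerivWithinAt
  have hm : MapsTo (fun s : ℝ => (s, z)) (Ico 0 T) (slab T U) := fun w hw => ⟨hw, hz⟩
  have h3 := (h1.comp t h2 hm).hasDerivWithinAt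
  have h4 : ((fderivWithin ℝ (fn x) (slab T U) (t, z)).comp (ContinuousLinearMap.inl ℝ ℝ C3)) 1 =
      eval (slabPt ht hz) ((slabWirtinger T hU).dt x) := rfl
  rw [h4] at h3
  refine h3.congr (fun s hs => ?_) ?_
  · rw [hu s hs, Function.comp_apply, fn_of_mem x (p := (s, z)) ⟨hs, hz⟩]
  · rw [hu t ht, Function.comp_apply, fn_of_mem x (p := (t, z)) ⟨ht, hz⟩]

/-- Derivatives within [0,T) are unique even at the endpoint 0, so an evolution equation becomes an
identity for the derivation ∂ₜ. -/
theorem hasDerivWithinAt_iff_eval (hU : IsOpen U) (x : SmoothAlg (slab T U)) {t : ℝ}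
    (ht : t ∈ Ico 0 T) {z : C3} (hz : z ∈ U) {u : ℝ → ℂ}
    (hu : ∀ s (hs : s ∈ Ico 0 T), u s = eval (slabPt hs hz) x) {y : ℂ} :
    HasDerivWithinAt u y (Ico 0 T) t ↔ eval (slabPt ht hz) ((slabWirtinger T hU).dt x) = y := by
  have h := hasDerivWithinAt_eval hU x ht hz hu
  exact ⟨fun h' => (uniqueDiffOn_Ico 0 T t ht).eq_deriv _ h h', fun h' => h' ▸ h⟩

end Slab

/-! ### Tensor components in charts -/

section Charts

variable {X : Type*} [TopologicalSpace X] [ChartedSpace C3 X]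

theorem coordVec_add (e : OpenPartialHomeomorph X C3) (z u v : C3) :
    coordVec e z (u + v) = coordVec e z u + coordVec e z v :=
  (mfderiv 𝓘(ℂ, C3) 𝓘(ℂ, C3) e.symm z).map_add u v

theorem coordVec_smul (e : OpenPartialHomeomorph X C3) (z : C3) (c : ℂ) (v : C3) :
    coordVec e z (c • v) = c • coordVec e z v :=
  (mfderiv 𝓘(ℂ, C3) 𝓘(ℂ, C3) e.symm z).map_smul c v

theorem coordVec_eq_sum (e : OpenPartialHomeomorph X C3) (z v : C3) :
    coordVec e z v = ∑ j, v j • coordVec e z (Pi.single j 1) := by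
  have h : v = ∑ j, v j • (Pi.single j 1 : C3) := by
    ext i; simp [Finset.sum_apply, Pi.single_apply]
  conv_lhs => rw [h]
  simp only [Fin.sum_univ_three, coordVec_add, coordVec_smul]

theorem HermitianMetric.inner_coordVec (g : HermitianMetric X) (e : OpenPartialHomeomorph X C3)
    (z u v : C3) : g.inner (e.symm z) (coordVec e z u) (coordVec e z v) =
      ∑ k, ∑ j, conj (u k) * g.coeff e z k j * v j := by
  rw [coordVec_eq_sum e z u, coordVec_eq_sum e z v]
  simp only [map_sum, LinearMap.sum_apply, map_smul, LinearMap.map_smulₛₗ, LinearMap.smul_apply,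
    smul_eq_mul, coeff, Matrix.of_apply]
  rw [Finset.sum_comm]
  refine Finset.sum_congr rfl fun j _ => ?_
  rw [Finset.mul_sum]
  exact Finset.sum_congr rfl fun k _ => by ring

variable {e : OpenPartialHomeomorph X C3} {z : C3}

theorem HermitianMetric.coeff_conj (g : HermitianMetric X) (e : OpenPartialHomeomorph X C3) (z : C3)
    (k j : Fin 3) : conj (g.coeff e z k j) = g.coeff e z j k :=
  g.conj_symm _ _ _

theorem isAlt_coeff {n : ℕ} (Φ : RealForm X n) (e : OpenPartialHomeomorph X C3) (z : C3) :
    IsAlt (Φ.coeff e z) := by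
  intro σ a
  simp only [RealForm.coeff, Finset.mul_sum]
  refine Fintype.sum_equiv (Equiv.arrowCongr σ (Equiv.refl Bool)) _ _ fun s => ?_
  have h1 : ∏ i, frameCoeff ((a ∘ σ) i) (s i) =
      ∏ i, frameCoeff (a i) ((Equiv.arrowCongr σ (Equiv.refl Bool)) s i) := by
    rw [← Equiv.prod_comp σ (fun i => frameCoeff (a i) _)]
    simp
  have h2 : (fun i => coordVec e z (frameVec ((a ∘ σ) i) (s i))) =
      (fun i => coordVec e z (frameVec (a i) ((Equiv.arrowCongr σ (Equiv.refl Bool)) s i))) ∘ σ := by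
    ext i; simp
  rw [h1, h2, AlternatingMap.map_perm]
  simp [Units.smul_def]
  ring

/-- The metric coefficients on `[0,T) × e.target`. -/
def metricAlg {T : ℝ} {g : ℝ → HermitianMetric X} (hg : IsSmoothFamily T g)
    (he : e ∈ atlas C3 X) : Matrix (Fin 3) (Fin 3) (SmoothAlg (slab T e.target)) :=
  Matrix.of fun k j => SmoothAlg.of _ (hg e he k j)

theorem eval_det_metricAlg {T : ℝ} {g : ℝ → HermitianMetric X} (hg : IsSmoothFamily T g)
    (he : e ∈ atlas C3 X) {t : ℝ} (ht : t ∈ Ico 0 T) (hz : z ∈ e.target) :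
    SmoothAlg.eval (slabPt ht hz) (metricAlg hg he).det = ((g t).coeff e z).det := by
  rw [AlgHom.map_det]
  rfl

theorem contDiffOn_volCoeff (Ω : HolVolumeForm X) (he : e ∈ atlas C3 X) (T : ℝ) :
    ContDiffOn ℝ ∞ (fun p : ℝ × C3 => Ω.coeff e p.2) (slab T e.target) :=
  (contDiffOn_real_of_holomorphic e.open_target (Ω.holomorphic e he)).comp
    contDiffOn_snd fun _ hp => hp.2

variable [IsManifold 𝓘(ℂ, C3) ω X]

theorem mdifferentiable_chart_of_mem_atlas (he : e ∈ atlas C3 X) :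
    e.MDifferentiable 𝓘(ℂ, C3) 𝓘(ℂ, C3) := by
  have : IsManifold 𝓘(ℂ, C3) 1 X := IsManifold.of_le (n := ω) le_top
  exact mdifferentiable_of_mem_atlas he

theorem coordVec_injective (he : e ∈ atlas C3 X) (hz : z ∈ e.target) :
    Function.Injective (coordVec e z) :=
  (mdifferentiable_chart_of_mem_atlas he).symm.mfderiv_injective hz

theorem HermitianMetric.coeff_pos (g : HermitianMetric X) (he : e ∈ atlas C3 X)
    (hz : z ∈ e.target) {v : C3} (hv : v ≠ 0) :
    0 < (∑ k, ∑ j, conj (v k) * g.coeff e z k j * v j).re := by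
  rw [← g.inner_coordVec]
  refine g.pos _ _ fun h => hv (coordVec_injective he hz ?_)
  rw [h]
  exact ((mfderiv 𝓘(ℂ, C3) 𝓘(ℂ, C3) e.symm z).map_zero).symm

open scoped ComplexOrder in
theorem HermitianMetric.posDef_coeff (g : HermitianMetric X) (he : e ∈ atlas C3 X)
    (hz : z ∈ e.target) : (g.coeff e z).PosDef := by
  have hh : (g.coeff e z).IsHermitian := by
    ext i j; exact g.coeff_conj e z j i
  refine Matrix.PosDef.of_dotProduct_mulVec_pos hh fun v hv => ?_
  have h := g.coeff_pos he hz hv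
  have e1 : ∑ k, ∑ j, conj (v k) * g.coeff e z k j * v j =
      star v ⬝ᵥ (g.coeff e z).mulVec v := by
    simp [dotProduct, Matrix.mulVec, Finset.mul_sum, mul_assoc]
  rw [e1] at h
  refine Complex.pos_iff.2 ⟨h, ?_⟩
  have := hh.im_star_dotProduct_mulVec_self v
  exact this.symm

theorem HolVolumeForm.coeff_ne_zero (Ω : HolVolumeForm X) (he : e ∈ atlas C3 X)
    (hz : z ∈ e.target) : Ω.coeff e z ≠ 0 := by
  have hl := (mdifferentiable_chart_of_mem_atlas he).symm.mfderiv_bijective hz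
  let L : C3 ≃ₗ[ℂ] TangentSpace 𝓘(ℂ, C3) (e.symm z) :=
    LinearEquiv.ofBijective (mfderiv 𝓘(ℂ, C3) 𝓘(ℂ, C3) e.symm z).toLinearMap hl
  let b := (Pi.basisFun ℂ (Fin 3)).map L
  have h : Ω.coeff e z = Ω.form (e.symm z) b := by
    rw [HolVolumeForm.coeff]
    congr 1
    ext i
    simp only [b, Module.Basis.map_apply, Pi.basisFun_apply]
    rfl
  rw [h]
  exact ((Ω.form (e.symm z)).map_basis_ne_zero_iff b).2 (Ω.ne_zero _)

open scoped ComplexOrder in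
theorem HermitianMetric.det_coeff_pos (g : HermitianMetric X) (he : e ∈ atlas C3 X)
    (hz : z ∈ e.target) : 0 < (g.coeff e z).det.re ∧
      (g.coeff e z).det = ((g.coeff e z).det.re : ℂ) := by
  have h := Complex.pos_iff.1 (g.posDef_coeff he hz).det_pos
  exact ⟨h.1, Complex.ext rfl (by simpa using h.2.symm)⟩

/-- In this form the norm is the square root of a positive smooth function, which gives its
smoothness. -/
theorem volNorm_eq_sqrt {f : ℂ} {G : Matrix (Fin 3) (Fin 3) ℂ} {d : ℝ} (hd : 0 < d)
    (hG : G.det = d) : volNorm f G = Real.sqrt (Complex.normSq f / (6 * G.det.re)) := by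
  have h := volNorm_sq_mul_det (f := f) hd hG
  rw [Complex.mul_conj, hG] at h
  have h' : volNorm f G * volNorm f G * d = 1 / 6 * Complex.normSq f := by 
    have := congrArg Complex.re h
    simpa using this
  have e1 : Complex.normSq f / (6 * d) = volNorm f G * volNorm f G := by
    rw [div_eq_iff (by positivity)]; linarith
  have h0 : 0 ≤ volNorm f G := Real.sqrt_nonneg _
  rw [hG, Complex.ofReal_re, e1, Real.sqrt_mul_self h0]

theorem isUnit_det_metricAlg {T : ℝ} {g : ℝ → HermitianMetric X} (hg : IsSmoothFamily T g)
    (he : e ∈ atlas C3 X) : IsUnit (metricAlg hg he).det := by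
  refine SmoothAlg.isUnit_of_eval_ne_zero fun p => ?_
  obtain ⟨⟨t, z⟩, ht, hz⟩ := p
  rw [eval_det_metricAlg hg he ht hz, ((g t).det_coeff_pos he hz).2]
  exact Complex.ofReal_ne_zero.2 ((g t).det_coeff_pos he hz).1.ne'

/-- The coefficient of the volume form on `[0,T) × e.target`. -/
def volAlg (Ω : HolVolumeForm X) (T : ℝ) (he : e ∈ atlas C3 X) : SmoothAlg (slab T e.target) :=
  SmoothAlg.of _ (contDiffOn_volCoeff Ω he T)

theorem isUnit_volAlg (Ω : HolVolumeForm X) (T : ℝ) (he : e ∈ atlas C3 X) :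
    IsUnit (volAlg Ω T he) :=
  SmoothAlg.isUnit_of_eval_ne_zero fun p => Ω.coeff_ne_zero he p.2.2

theorem volNorm_coeff_pos (Ω : HolVolumeForm X) (g : HermitianMetric X) (he : e ∈ atlas C3 X)
    (hz : z ∈ e.target) : 0 < volNorm (Ω.coeff e z) (g.coeff e z) :=
  volNorm_pos (g.det_coeff_pos he hz).1 (g.det_coeff_pos he hz).2 (Ω.coeff_ne_zero he hz)

theorem contDiffOn_volNorm (Ω : HolVolumeForm X) {T : ℝ} {g : ℝ → HermitianMetric X}
    (hg : IsSmoothFamily T g) (he : e ∈ atlas C3 X) :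
    ContDiffOn ℝ ∞ (fun p : ℝ × C3 => (volNorm (Ω.coeff e p.2) ((g p.1).coeff e p.2) : ℂ))
      (slab T e.target) := by
  have h1 : ContDiffOn ℝ ∞ (fun p : ℝ × C3 => ((g p.1).coeff e p.2).det) (slab T e.target) := by
    refine (SmoothAlg.contDiffOn_fn (metricAlg hg he).det).congr fun p hp => ?_
    rw [SmoothAlg.fn_of_mem _ hp]
    exact (eval_det_metricAlg hg he hp.1 hp.2).symm
  have h2 : ContDiffOn ℝ ∞ (fun p : ℝ × C3 => ((g p.1).coeff e p.2).det.re) (slab T e.target) :=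
    Complex.reCLM.contDiff.comp_contDiffOn h1
  have h3 : ContDiffOn ℝ ∞ (fun p : ℝ × C3 => Complex.normSq (Ω.coeff e p.2)) (slab T e.target) := by
    have h := contDiffOn_volCoeff Ω he T
    have h' := (Complex.reCLM.contDiff.comp_contDiffOn h).pow 2
    have h'' := (Complex.imCLM.contDiff.comp_contDiffOn h).pow 2
    refine (h'.add h'').congr fun p _ => ?_
    simp [Complex.normSq_apply, sq]
  refine Complex.ofRealCLM.contDiff.comp_contDiffOn ?_
  have h4 : ContDiffOn ℝ ∞ (fun p : ℝ × C3 => Real.sqrt (Complex.normSq (Ω.coeff e p.2) /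
      (6 * ((g p.1).coeff e p.2).det.re))) (slab T e.target) := by
    refine ContDiffOn.sqrt (h3.div (contDiffOn_const.mul h2) fun p hp => ?_) fun p hp => ?_
    · have := ((g p.1).det_coeff_pos he hp.2).1
      positivity
    · have := ((g p.1).det_coeff_pos he hp.2).1
      have := Complex.normSq_pos.2 (Ω.coeff_ne_zero he hp.2)
      positivity
  refine h4.congr fun p hp => ?_
  exact volNorm_eq_sqrt ((g p.1).det_coeff_pos he hp.2).1 ((g p.1).det_coeff_pos he hp.2).2

/-- The norm of the volume form on `[0,T) × e.target`. -/
def normAlg (Ω : HolVolumeForm X) {T : ℝ} {g : ℝ → HermitianMetric X}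
    (hg : IsSmoothFamily T g) (he : e ∈ atlas C3 X) : SmoothAlg (slab T e.target) :=
  SmoothAlg.of _ (contDiffOn_volNorm Ω hg he)

theorem isUnit_normAlg (Ω : HolVolumeForm X) {T : ℝ} {g : ℝ → HermitianMetric X}
    (hg : IsSmoothFamily T g) (he : e ∈ atlas C3 X) : IsUnit (normAlg Ω hg he) :=
  SmoothAlg.isUnit_of_eval_ne_zero fun p =>
    Complex.ofReal_ne_zero.2 (volNorm_coeff_pos Ω (g p.1.1) he p.2.2).ne'

theorem dAnti_eq_zero_of_holomorphic {U : Set C3} (hU : IsOpen U) {f : C3 → ℂ}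
    (hf : DifferentiableOn ℂ f U) {w : C3} (hw : w ∈ U) (k : Fin 3) : dAnti k f w = 0 := by
  have h := ((hf w hw).differentiableAt (hU.mem_nhds hw)).hasFDerivAt.restrictScalars ℝ
  have h1 : (Pi.single k Complex.I : C3) = Complex.I • Pi.single k 1 := by
    ext i; simp [Pi.single_apply]
  rw [dAnti, h.fderiv]
  simp only [ContinuousLinearMap.coe_restrictScalars', h1, map_smul, smul_eq_mul, ← mul_assoc,
    Complex.I_mul_I]
  ring

/-- The Hermitian geometry of a smooth family of metrics in a chart. -/
def chartData (Ω : HolVolumeForm X) {T : ℝ} {g : ℝ → HermitianMetric X}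
    (hg : IsSmoothFamily T g) (he : e ∈ atlas C3 X) :
    HermitianData (slabWirtinger T e.open_target) where
  G := metricAlg hg he
  H := (metricAlg hg he)⁻¹
  GH := Matrix.mul_nonsing_inv _ (isUnit_det_metricAlg hg he)
  c_G k j := SmoothAlg.ext_eval fun p => (g p.1.1).coeff_conj e p.1.2 k j
  f := volAlg Ω T he
  fi := ↑(isUnit_volAlg Ω T he).unit⁻¹
  f_fi := (isUnit_volAlg Ω T he).mul_val_inv
  B_f k := SmoothAlg.ext_eval fun p => by
    obtain ⟨⟨t, z⟩, ht, hz⟩ := p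
    rw [map_zero]
    refine Eq.trans (dAnti_eq_eval e.open_target (volAlg Ω T he) ht hz (u := Ω.coeff e)
      (fun _ _ => rfl) k).symm ?_
    exact dAnti_eq_zero_of_holomorphic e.open_target (Ω.holomorphic e he) hz k
  dt_f := SmoothAlg.ext_eval fun p => by
    obtain ⟨⟨t, z⟩, ht, hz⟩ := p
    rw [map_zero]
    exact (hasDerivWithinAt_iff_eval e.open_target (volAlg Ω T he) ht hz
      (u := fun _ => Ω.coeff e z) (fun _ _ => rfl)).1 (hasDerivWithinAt_const _ _ _)
  n := normAlg Ω hg he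
  ni := ↑(isUnit_normAlg Ω hg he).unit⁻¹
  n_ni := (isUnit_normAlg Ω hg he).mul_val_inv
  c_n := SmoothAlg.ext_eval fun p => Complex.conj_ofReal _
  κ := 1 / 6
  n_sq := SmoothAlg.ext_eval fun p => by
    obtain ⟨⟨t, z⟩, ht, hz⟩ := p
    have hd := (g t).det_coeff_pos he hz
    have h := volNorm_sq_mul_det (f := Ω.coeff e z) hd.1 hd.2
    rw [map_mul, map_mul, map_mul, map_mul, eval_det_metricAlg hg he ht hz, AlgHom.commutes]
    exact h

end Charts

/-! ### The flows in terms of the smooth function algebra of a chart -/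

section Bridge

open SmoothAlg

variable {X : Type*} [TopologicalSpace X] [ChartedSpace C3 X] [IsManifold 𝓘(ℂ, C3) ω X]
  {e : OpenPartialHomeomorph X C3} (Ω : HolVolumeForm X) {T : ℝ} {g : ℝ → HermitianMetric X}
  (hg : IsSmoothFamily T g) (he : e ∈ atlas C3 X) {t : ℝ} (ht : t ∈ Ico 0 T) {z : C3}
  (hz : z ∈ e.target)

theorem eval_G (k j : Fin 3) :
    eval (slabPt ht hz) ((chartData Ω hg he).G k j) = (g t).coeff e z k j := rfl

theorem eval_n :
    eval (slabPt ht hz) (chartData Ω hg he).n = volNorm (Ω.coeff e z) ((g t).coeff e z) := rfl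

theorem eval_H (i j : Fin 3) :
    eval (slabPt ht hz) ((chartData Ω hg he).H i j) = ((g t).coeff e z)⁻¹ i j := by
  have h := congrArg (fun M => M.map (eval (slabPt ht hz))) (chartData Ω hg he).GH
  simp only [Matrix.map_mul] at h
  have h2 : (1 : Matrix (Fin 3) (Fin 3) (SmoothAlg (slab T e.target))).map
      (eval (slabPt ht hz)) = 1 := Matrix.map_one _ (map_zero _) (map_one _)
  rw [h2] at h
  exact (congrFun (congrFun (Matrix.inv_eq_right_inv h) i) j).symm

theorem chernConn_eq (j p q : Fin 3) : chernConn ((g t).coeff e) j p q z =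
    eval (slabPt ht hz) ((chartData Ω hg he).conn j p q) := by
  simp only [chernConn, HermitianData.conn, map_sum, map_mul, eval_H]
  exact Finset.sum_congr rfl fun m _ => congrArg _
    (dHol_eq_eval e.open_target _ ht hz (fun w hw => rfl) j)

theorem curv_eq (k j p q : Fin 3) : curv ((g t).coeff e) k j p q z =
    eval (slabPt ht hz) ((chartData Ω hg he).curvature k j p q) := by
  rw [curv, HermitianData.curvature, map_neg,
    dAnti_eq_eval e.open_target _ ht hz (fun w hw => chernConn_eq Ω hg he ht hw j p q)]

theorem curvSqAlt_eq (p s r q : Fin 3) : curvSqAlt ((g t).coeff e) p s r q z =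
    eval (slabPt ht hz) ((chartData Ω hg he).curvatureSqAlt p s r q) := by
  simp only [curvSqAlt, curvSq, HermitianData.curvatureSqAlt, HermitianData.curvatureSq, map_sub,
    map_add, map_sum, map_mul, curv_eq Ω hg he ht hz]

theorem ricciTilde_eq (k j : Fin 3) : ricciTilde ((g t).coeff e) k j z =
    eval (slabPt ht hz) ((chartData Ω hg he).ricci k j) := by
  simp only [ricciTilde, curvLow, HermitianData.ricci, HermitianData.curvatureLow, map_sum, map_mul,
    curv_eq Ω hg he ht hz, eval_H, eval_G]

theorem torsion_eq (k j m : Fin 3) : torsion ((g t).coeff e) k j m z =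
    eval (slabPt ht hz) ((chartData Ω hg he).tors k j m) := by
  rw [torsion, HermitianData.tors, map_sub,
    dHol_eq_eval e.open_target _ ht hz (fun w hw => (eval_G Ω hg he ht hw k m).symm),
    dHol_eq_eval e.open_target _ ht hz (fun w hw => (eval_G Ω hg he ht hw k j).symm)]

theorem torsionConj_eq (k j m : Fin 3) : torsionConj ((g t).coeff e) k j m z =
    eval (slabPt ht hz) ((chartData Ω hg he).torsConj k j m) := by
  rw [torsionConj, HermitianData.torsConj, map_sub,
    dAnti_eq_eval e.open_target _ ht hz (fun w hw => (eval_G Ω hg he ht hw m k).symm),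
    dAnti_eq_eval e.open_target _ ht hz (fun w hw => (eval_G Ω hg he ht hw j k).symm)]

theorem iddbarOmega_eq (q r s p : Fin 3) :
    iddbarOmega ((g t).coeff e) z ![Sum.inl q, Sum.inr r, Sum.inl s, Sum.inr p] =
      eval (slabPt ht hz) ((chartData Ω hg he).ddbar q r s p) := by
  have h1 : ∀ w (hw : w ∈ e.target) a b c, dAnti a (fun v => Complex.I * (g t).coeff e v b c) w =
      eval (slabPt ht hw) (Complex.I • (slabWirtinger T e.open_target).B a
        ((chartData Ω hg he).G b c)) := fun w hw a b c => by
    rw [dAnti_eq_eval e.open_target (Complex.I • (chartData Ω hg he).G b c) ht hw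
      (fun v hv => by rw [map_smul, eval_G, smul_eq_mul]), Derivation.map_smul]
  rw [iddbarOmega_apply,
    dHol_eq_eval e.open_target (Complex.I • ((slabWirtinger T e.open_target).B r
      ((chartData Ω hg he).G p s) - (slabWirtinger T e.open_target).B p
        ((chartData Ω hg he).G r s))) ht hz
      (fun v hv => by rw [h1 v hv, h1 v hv, smul_sub, map_sub]),
    dHol_eq_eval e.open_target (Complex.I • (-(slabWirtinger T e.open_target).B r
      ((chartData Ω hg he).G p q) + (slabWirtinger T e.open_target).B p
        ((chartData Ω hg he).G r q))) ht hz
      (fun v hv => by rw [h1 v hv, h1 v hv, smul_add, smul_neg, map_add, map_neg])]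
  simp only [Derivation.map_smul, map_sub, map_add, map_neg, map_smul, HermitianData.ddbar,
    smul_eq_mul]
  linear_combination (eval (slabPt ht hz) ((slabWirtinger T e.open_target).D q
      ((slabWirtinger T e.open_target).B r ((chartData Ω hg he).G p s)))
    - eval (slabPt ht hz) ((slabWirtinger T e.open_target).D q
      ((slabWirtinger T e.open_target).B p ((chartData Ω hg he).G r s)))
    - eval (slabPt ht hz) ((slabWirtinger T e.open_target).D s
      ((slabWirtinger T e.open_target).B r ((chartData Ω hg he).G p q)))
    + eval (slabPt ht hz) ((slabWirtinger T e.open_target).D s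
      ((slabWirtinger T e.open_target).B p ((chartData Ω hg he).G r q)))) * Complex.I_mul_I

theorem balancedForm_eq (q r s p : Fin 3) :
    balancedForm (Ω.coeff e z) ((g t).coeff e z) ![Sum.inl q, Sum.inr r, Sum.inl s, Sum.inr p] =
      eval (slabPt ht hz) ((chartData Ω hg he).balanced q r s p) := by
  rw [balancedForm_apply, HermitianData.balanced]
  simp only [map_mul, map_sub, map_neg, map_ofNat, eval_G, eval_n]

end Bridge

/-! ### The residual of the Anomaly flow -/

namespace HermitianData

variable {A : Type*} [CommRing A] [Algebra ℂ A] {W : Wirtinger A} (X : HermitianData W)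

/-- The components of `∂ₜ(‖Ω‖ω²) - i∂∂̄ω + a Tr (Rm ∧ Rm)`. -/
def anomaly (a : ℂ) (q r s p : Fin 3) : A :=
  W.dt (X.balanced q r s p) - X.ddbar q r s p + a • X.curvatureSqAlt p s r q

theorem anomaly_swap_inl (a : ℂ) (q r s p : Fin 3) :
    X.anomaly a s r q p = -X.anomaly a q r s p := by
  have h : X.balanced s r q p = -X.balanced q r s p := by rw [balanced, balanced]; ring
  simp only [anomaly, h, ddbar, curvatureSqAlt, map_neg, smul_add, smul_sub]
  rw [W.D_B s r, W.D_B s p]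
  ring

theorem anomaly_swap_inr (a : ℂ) (q r s p : Fin 3) :
    X.anomaly a q p s r = -X.anomaly a q r s p := by
  have h : X.balanced q p s r = -X.balanced q r s p := by rw [balanced, balanced]; ring
  simp only [anomaly, h, ddbar, curvatureSqAlt, map_neg, smul_add, smul_sub]
  ring

/-- Apart from the Φ-term and the factor 4n, the right-hand side is the defect of the metric flow
plus `leeHess`. -/
theorem contract_anomaly (a : ℂ) (p q : Fin 3) :
    2 * ∑ s, ∑ r, X.H s r * X.anomaly a q r s p = 4 * X.n * W.dt (X.G p q)
      + 2 * X.ricci p q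
      - 2 * ∑ α, ∑ β, ∑ s, ∑ r, X.H α β * X.H s r * X.tors β s q * X.torsConj α r p
      + X.leeHess p q + 2 * a • ∑ s, ∑ r, X.H s r * X.curvatureSqAlt p s r q := by
  have h1 := X.contract_dt_balanced p q
  have h2 := X.contract_ddbar p q
  simp only [anomaly, mul_add, mul_sub, Finset.sum_add_distrib, Finset.sum_sub_distrib,
    mul_smul_comm, ← Finset.smul_sum] at h1 h2 ⊢
  linear_combination 2 * h1 - h2

/-- Closedness of i∂∂̄ω and of Tr(Rm ∧ Rm) leaves only the time derivative of the divergence of V.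
-/
theorem div_anomaly (a : ℂ) (j : Fin 3) :
    ∑ k, W.B k (X.anomaly a (j + 1) (k + 1) (j + 2) (k + 2)) =
      -2 * W.dt (∑ k, W.B k (X.cofactor j k)) := by
  have h1 := X.div_ddbar j
  have h2 := X.div_curvatureSqAlt j
  have h3 : ∀ δ : Derivation ℂ A A, δ 2 = 0 := fun δ => δ.map_natCast 2
  simp only [anomaly, map_add, map_sub, Finset.sum_add_distrib, Finset.sum_sub_distrib, h1,
    Derivation.map_smul, ← Finset.smul_sum, h2, dual_balanced, map_sum, W.dt_B, Finset.mul_sum]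
  simp [h3]

theorem c_cofactor (j k : Fin 3) : W.c (X.cofactor j k) = X.cofactor k j := by
  simp only [cofactor, map_mul, X.c_n, X.c_det, X.c_H]

end HermitianData

/-- A `(2,2)`-form with vanishing contraction vanishes. -/
theorem eq_zero_of_contract_eq_zero {G H : Matrix (Fin 3) (Fin 3) ℂ} (hGH : G * H = 1)
    {F : Fin 3 → Fin 3 → Fin 3 → Fin 3 → ℂ} (h1 : ∀ q r s p, F s r q p = -F q r s p)
    (h2 : ∀ q r s p, F q p s r = -F q r s p) (h : ∀ p q, ∑ s, ∑ r, H s r * F q r s p = 0)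
    (q r s p : Fin 3) : F q r s p = 0 := by
  have d1 : ∀ q r p, F q r q p = 0 := fun q r p => self_eq_neg.1 (h1 q r q p)
  have d2 : ∀ q r s, F q r s r = 0 := fun q r s => self_eq_neg.1 (h2 q r s r)
  have h3 : ∀ j k, F (j + 1) (k + 1) (j + 2) (k + 2) = 0 := fun j k => by
    have := two_mul_dual_eq hGH F 0 d1 d2 h1 h2 (by simpa using h) j k
    simpa using this
  have hc : ∀ a b : Fin 3, a = b ∨ ∃ j : Fin 3, (a = j + 1 ∧ b = j + 2) ∨ (b = j + 1 ∧ a = j + 2) := by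
    decide
  rcases hc q s with rfl | ⟨j, ⟨rfl, rfl⟩ | ⟨rfl, rfl⟩⟩
  · exact d1 _ _ _
  all_goals rcases hc r p with rfl | ⟨k, ⟨rfl, rfl⟩ | ⟨rfl, rfl⟩⟩
  · exact d2 _ _ _
  · exact h3 j k
  · rw [h2, h3, neg_zero]
  · exact d2 _ _ _
  · rw [h1, h3, neg_zero]
  · rw [h1, h2, h3, neg_zero, neg_zero]

/-! ### Both flows and the balanced condition as equations in the algebra of a chart -/

section Bridge

open SmoothAlg

variable {X : Type*} [TopologicalSpace X] [ChartedSpace C3 X] [IsManifold 𝓘(ℂ, C3) ω X]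
  {e : OpenPartialHomeomorph X C3} (Ω : HolVolumeForm X) {T : ℝ} {g : ℝ → HermitianMetric X}
  (hg : IsSmoothFamily T g) (he : e ∈ atlas C3 X) {t : ℝ} (ht : t ∈ Ico 0 T) {z : C3}
  (hz : z ∈ e.target)

/-- The tuple of frame vectors `∂_q, ∂̄_r, ∂_s, ∂̄_p`. -/
abbrev mixedIdx (q r s p : Fin 3) : Fin 4 → Idx := ![Sum.inl q, Sum.inr r, Sum.inl s, Sum.inr p]

theorem differentiableWithinAt_oneOneForm {h : ℝ → Matrix (Fin 3) (Fin 3) ℂ} {S : Set ℝ} {t : ℝ}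
    (hh : ∀ k j, DifferentiableWithinAt ℝ (fun s => h s k j) S t) (a : Fin 2 → Idx) :
    DifferentiableWithinAt ℝ (fun s => oneOneForm (h s) a) S t := by
  have ha : a = ![a 0, a 1] := by ext i; fin_cases i <;> rfl
  rw [ha]
  rcases a 0 with j | j <;> rcases a 1 with k | k <;>
    simp only [oneOneForm_inl_inl, oneOneForm_inl_inr, oneOneForm_inr_inl, oneOneForm_inr_inr]
  · exact differentiableWithinAt_const _
  · exact hh _ _
  · exact (hh _ _).neg
  · exact differentiableWithinAt_const _

include hg he ht hz in
theorem differentiableWithinAt_balancedForm (a : Fin 4 → Idx) :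
    DifferentiableWithinAt ℝ (fun s => balancedForm (Ω.coeff e z) ((g s).coeff e z) a)
      (Ico 0 T) t := by
  have hG : ∀ k j, DifferentiableWithinAt ℝ (fun s => (g s).coeff e z k j) (Ico 0 T) t := fun k j =>
    (hasDerivWithinAt_eval e.open_target ((chartData Ω hg he).G k j) ht hz
      fun s hs => rfl).differentiableWithinAt
  have hn : DifferentiableWithinAt ℝ
      (fun s => (volNorm (Ω.coeff e z) ((g s).coeff e z) : ℂ)) (Ico 0 T) t :=
    (hasDerivWithinAt_eval e.open_target (chartData Ω hg he).n ht hz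
      fun s hs => rfl).differentiableWithinAt
  have ho : ∀ b, DifferentiableWithinAt ℝ (fun s => omegaForm ((g s).coeff e z) b) (Ico 0 T) t :=
    fun b => differentiableWithinAt_oneOneForm (fun k j => (hG k j).const_smul Complex.I) b
  refine hn.mul (DifferentiableWithinAt.const_mul ?_ _)
  refine DifferentiableWithinAt.fun_sum fun σ _ => DifferentiableWithinAt.const_mul ?_ _
  exact (ho _).mul (ho _)

-- Only the components in the order unbarred, barred, unbarred, barred have to be compared: all
-- terms of the flow are alternating of type (2,2), the time derivative included. This is where the
-- type of Φ is used.
include hg in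
theorem isAnomalyFlow_iff {slope : ℝ} {Φ : ℝ → RealForm X 4}
    (hΦ : ∀ t ∈ Ico 0 T, IsClosedTwoTwoForm (Φ t)) :
    IsAnomalyFlow Ω slope T Φ g ↔ ∀ (e : OpenPartialHomeomorph X C3) (he : e ∈ atlas C3 X) (t : ℝ)
      (ht : t ∈ Ico 0 T) (z : C3) (hz : z ∈ e.target) (q r s p : Fin 3),
      eval (slabPt ht hz) ((chartData Ω hg he).anomaly slope q r s p) =
        slope * (Φ t).coeff e z (mixedIdx q r s p) := by
  have key : ∀ (e : OpenPartialHomeomorph X C3) (he : e ∈ atlas C3 X) (t : ℝ)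
      (ht : t ∈ Ico 0 T) (z : C3) (hz : z ∈ e.target) (q r s p : Fin 3),
      HasDerivWithinAt (fun s' => balancedForm (Ω.coeff e z) ((g s').coeff e z) (mixedIdx q r s p))
      (iddbarOmega ((g t).coeff e) z (mixedIdx q r s p) - (slope : ℂ) *
        (traceRmRm ((g t).coeff e) z (mixedIdx q r s p) - (Φ t).coeff e z (mixedIdx q r s p)))
      (Ico 0 T) t ↔ eval (slabPt ht hz) ((chartData Ω hg he).anomaly slope q r s p) =
        slope * (Φ t).coeff e z (mixedIdx q r s p) := by
    intro e he t ht z hz q r s p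
    rw [hasDerivWithinAt_iff_eval e.open_target ((chartData Ω hg he).balanced q r s p) ht hz
      (fun s' hs' => balancedForm_eq Ω hg he hs' hz q r s p), iddbarOmega_eq Ω hg he ht hz,
      traceRmRm_apply, curvSqAlt_eq Ω hg he ht hz, HermitianData.anomaly, map_add, map_sub, map_smul,
      smul_eq_mul]
    constructor <;> intro h <;> linear_combination h
  refine ⟨fun h e he t ht z hz q r s p => (key e he t ht z hz q r s p).1 (h t ht e he z hz _),
    fun h t ht e he z hz a => ?_⟩
  have hd := differentiableWithinAt_balancedForm Ω hg he ht hz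
  have hu := uniqueDiffOn_Ico 0 T t ht
  let α : Form 4 := fun a =>
    derivWithin (fun s => balancedForm (Ω.coeff e z) ((g s).coeff e z) a) (Ico 0 T) t
  have hα : IsAlt α := fun σ a => by
    simp only [α]
    rw [← derivWithin_const_mul _ (hd a)]
    congr 1
    ext s
    exact isAlt_balancedForm _ _ σ a
  have hα2 : IsTwoTwo α := fun a ha => by
    by_contra hc
    apply ha
    have : (fun s => balancedForm (Ω.coeff e z) ((g s).coeff e z) a) = fun _ => 0 := by
      ext s
      by_contra h'
      exact hc (isTwoTwo_balancedForm _ _ a h')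
    simp only [α, this]
    simp
  let β : Form 4 := α - (iddbarOmega ((g t).coeff e) z - (slope : ℂ) • (traceRmRm ((g t).coeff e) z -
    (Φ t).coeff e z))
  have hβ : IsAlt β := hα.sub ((isAlt_iddbarOmega _ _).sub
    (((isAlt_traceRmRm _ _).sub (isAlt_coeff _ _ _)).smul _))
  have hβ2 : IsTwoTwo β := hα2.sub ((isTwoTwo_iddbarOmega _ _).sub
    (((isTwoTwo_traceRmRm _ _).sub ((hΦ t ht).type e he z hz)).smul _))
  have hβ0 : β = 0 := funext <| eq_zero_of_isTwoTwo hβ hβ2 fun q r s p =>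
    sub_eq_zero.2 (((key e he t ht z hz q r s p).2 (h e he t ht z hz q r s p)).derivWithin hu)
  have h' := (hd a).hasDerivWithinAt
  rwa [show derivWithin (fun s => balancedForm (Ω.coeff e z) ((g s).coeff e z) a) (Ico 0 T) t = _ from
    sub_eq_zero.1 (congrFun hβ0 a)] at h'

-- By `contract_anomaly` the metric flow fixes the contraction of the residual to be half of
-- `leeHess` instead of zero. This discrepancy is the only difference between the flows.
include hg in
theorem isMetricFlow_iff {slope : ℝ} {Φ : ℝ → RealForm X 4} :
    IsMetricFlow Ω slope T Φ g ↔ ∀ (e : OpenPartialHomeomorph X C3) (he : e ∈ atlas C3 X) (t : ℝ)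
      (ht : t ∈ Ico 0 T) (z : C3) (hz : z ∈ e.target) (p q : Fin 3),
      2 * ∑ s, ∑ r, eval (slabPt ht hz) ((chartData Ω hg he).H s r) *
        (eval (slabPt ht hz) ((chartData Ω hg he).anomaly slope q r s p) -
          slope * (Φ t).coeff e z (mixedIdx q r s p)) =
        eval (slabPt ht hz) ((chartData Ω hg he).leeHess p q) := by
  have key : ∀ (e : OpenPartialHomeomorph X C3) (he : e ∈ atlas C3 X) (t : ℝ)
      (ht : t ∈ Ico 0 T) (z : C3) (hz : z ∈ e.target) (p q : Fin 3),
      HasDerivWithinAt (fun s => (g s).coeff e z p q)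
      (metricSpeed ((g t).coeff e) (Ω.coeff e) slope ((Φ t).coeff e) p q z)
      (Ico 0 T) t ↔ 2 * ∑ s, ∑ r, eval (slabPt ht hz) ((chartData Ω hg he).H s r) *
        (eval (slabPt ht hz) ((chartData Ω hg he).anomaly slope q r s p) -
          slope * (Φ t).coeff e z (mixedIdx q r s p)) =
        eval (slabPt ht hz) ((chartData Ω hg he).leeHess p q) := by
    intro e he t ht z hz p q
    have hn : eval (slabPt ht hz) (chartData Ω hg he).n ≠ 0 :=
      Complex.ofReal_ne_zero.2 (volNorm_coeff_pos Ω (g t) he hz).ne'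
    have hc := congrArg (eval (slabPt ht hz)) ((chartData Ω hg he).contract_anomaly slope p q)
    simp only [map_add, map_sub, map_mul, map_sum, map_smul, map_ofNat, smul_eq_mul] at hc
    rw [hasDerivWithinAt_iff_eval e.open_target ((chartData Ω hg he).G p q) ht hz
      (fun s' hs' => (eval_G Ω hg he hs' hz p q).symm), metricSpeed,
      ← eval_n Ω hg he ht hz, one_div, inv_mul_eq_div, eq_div_iff (mul_ne_zero two_ne_zero hn)]
    simp only [← eval_H Ω hg he ht hz, torsion_eq Ω hg he ht hz,
      torsionConj_eq Ω hg he ht hz, ricciTilde_eq Ω hg he ht hz, curvSqAlt_eq Ω hg he ht hz, mul_sub,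
      Finset.sum_sub_distrib] at hc ⊢
    have hs : ∑ s, ∑ r, eval (slabPt ht hz) ((chartData Ω hg he).H s r) *
        (slope * (Φ t).coeff e z (mixedIdx q r s p)) =
        slope * ∑ s, ∑ r, eval (slabPt ht hz) ((chartData Ω hg he).H s r) *
        (Φ t).coeff e z (mixedIdx q r s p) := by
      simp only [Finset.mul_sum]
      exact Finset.sum_congr rfl fun _ _ => Finset.sum_congr rfl fun _ _ => by ring
    rw [hs]
    constructor <;> intro h
    · linear_combination hc + 2 * h
    · linear_combination (1 / 2 : ℂ) * h - (1 / 2 : ℂ) * hc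
  exact ⟨fun h e he t ht z hz p q => (key e he t ht z hz p q).1 (h t ht e he z hz p q),
    fun h t ht e he z hz p q => (key e he t ht z hz p q).2 (h e he t ht z hz p q)⟩

theorem eval_div_cofactor (hθ : ∀ q, eval (slabPt ht hz) ((chartData Ω hg he).lee q) = 0)
    (j : Fin 3) : eval (slabPt ht hz)
      (∑ k, (slabWirtinger T e.open_target).B k ((chartData Ω hg he).cofactor j k)) = 0 := by
  have h := congrArg (eval (slabPt ht hz)) ((chartData Ω hg he).two_mul_div_cofactor j)
  have hc : ∀ k, eval (slabPt ht hz) ((chartData Ω hg he).leeConj k) = 0 := fun k =>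
    (eval_conjHom _ _).trans (by rw [hθ, map_zero])
  rw [map_mul, map_ofNat, map_neg, map_sum _ (fun k => _ * _)] at h
  simp only [map_mul, hc, mul_zero, Finset.sum_const_zero, neg_zero] at h
  exact (mul_eq_zero.1 h).resolve_left two_ne_zero

/-- The converse of `eval_div_cofactor`: n, det g and g⁻¹ are invertible at each point, so
V^{jk}θ̄_k = 0 forces θ̄ = 0. -/
theorem eval_lee_eq_zero (hV : ∀ j, eval (slabPt ht hz)
      (∑ k, (slabWirtinger T e.open_target).B k ((chartData Ω hg he).cofactor j k)) = 0)
    (q : Fin 3) : eval (slabPt ht hz) ((chartData Ω hg he).lee q) = 0 := by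
  have h1 : ∀ j, ∑ k, ((g t).coeff e z)⁻¹ j k *
      eval (slabPt ht hz) ((chartData Ω hg he).leeConj k) = 0 := fun j => by
    have h := congrArg (eval (slabPt ht hz)) ((chartData Ω hg he).two_mul_div_cofactor j)
    rw [map_mul, hV, mul_zero, map_neg, map_sum] at h
    simp only [HermitianData.cofactor, map_mul, eval_H, mul_assoc, ← Finset.mul_sum] at h
    have hn : eval (slabPt ht hz) (chartData Ω hg he).n ≠ 0 :=
      Complex.ofReal_ne_zero.2 (volNorm_coeff_pos Ω (g t) he hz).ne'
    have hd : eval (slabPt ht hz) (chartData Ω hg he).G.det ≠ 0 := by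
      refine (eval_det_metricAlg hg he ht hz).trans_ne ?_
      rw [((g t).det_coeff_pos he hz).2]
      exact Complex.ofReal_ne_zero.2 ((g t).det_coeff_pos he hz).1.ne'
    have h' := neg_eq_zero.1 h.symm
    exact (mul_eq_zero.1 ((mul_eq_zero.1 h').resolve_left hn)).resolve_left hd
  have h2 : ((g t).coeff e z)⁻¹.mulVec
      (fun k => eval (slabPt ht hz) ((chartData Ω hg he).leeConj k)) = 0 := by
    ext j; exact h1 j
  have hu : IsUnit ((g t).coeff e z).det := by
    rw [((g t).det_coeff_pos he hz).2]
    exact (Complex.ofReal_ne_zero.2 ((g t).det_coeff_pos he hz).1.ne').isUnit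
  have h3 := congrArg (fun v => ((g t).coeff e z).mulVec v) h2
  simp only [Matrix.mulVec_mulVec, Matrix.mul_nonsing_inv _ hu, Matrix.one_mulVec,
    Matrix.mulVec_zero] at h3
  have h4 := congrFun h3 q
  have h5 : conj (eval (slabPt ht hz) ((chartData Ω hg he).lee q)) = 0 := h4
  exact (map_eq_zero _).1 h5

include hg in
/-- A metric of the family is conformally balanced if and only if its form `lee` vanishes in all
charts. -/
theorem isConformallyBalanced_iff (ht : t ∈ Ico 0 T) : IsConformallyBalanced Ω (g t) ↔
    ∀ (e : OpenPartialHomeomorph X C3) (he : e ∈ atlas C3 X) (z : C3) (hz : z ∈ e.target)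
      (q : Fin 3), eval (slabPt ht hz) ((chartData Ω hg he).lee q) = 0 := by
  have hb : ∀ (e : OpenPartialHomeomorph X C3) (he : e ∈ atlas C3 X) (w : C3) (hw : w ∈ e.target)
      (j k : Fin 3), balancedForm (Ω.coeff e w) ((g t).coeff e w)
        ![Sum.inl (j + 1), Sum.inr (k + 1), Sum.inl (j + 2), Sum.inr (k + 2)] =
      eval (slabPt ht hw) (-2 * (chartData Ω hg he).cofactor j k) := fun e he w hw j k => by
    rw [balancedForm_eq Ω hg he ht hw, HermitianData.dual_balanced]
  have h2 : ∀ {A : Type _} [CommRing A] [Algebra ℂ A] (δ : Derivation ℂ A A) (x : A),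
      δ (-2 * x) = -2 * δ x := fun {A} _ _ δ x => by
    have h3 : δ 2 = 0 := δ.map_natCast 2
    simp [h3]
  have key : ∀ (e : OpenPartialHomeomorph X C3) (he : e ∈ atlas C3 X) (z : C3) (hz : z ∈ e.target),
      dForm (fun w => balancedForm (Ω.coeff e w) ((g t).coeff e w)) z = 0 ↔ ∀ j,
        eval (slabPt ht hz)
          (∑ k, (slabWirtinger T e.open_target).B k ((chartData Ω hg he).cofactor j k)) = 0 := by
    intro e he z hz
    have hB : ∀ j, ∑ k, dAnti k (fun w => balancedForm (Ω.coeff e w) ((g t).coeff e w)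
        ![Sum.inl (j + 1), Sum.inr (k + 1), Sum.inl (j + 2), Sum.inr (k + 2)]) z =
        -2 * eval (slabPt ht hz)
          (∑ k, (slabWirtinger T e.open_target).B k ((chartData Ω hg he).cofactor j k)) := by
      intro j
      rw [map_sum, Finset.mul_sum]
      refine Finset.sum_congr rfl fun k _ => ?_
      rw [dAnti_eq_eval e.open_target _ ht hz (fun w hw => hb e he w hw j k), h2, map_mul, map_neg,
        map_ofNat]
    -- V is Hermitian, so the ∂-divergences are the conjugates of the ∂̄-divergences and give no
    -- further condition.
    have hD : ∀ k, ∑ j, dHol j (fun w => balancedForm (Ω.coeff e w) ((g t).coeff e w)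
        ![Sum.inl (j + 1), Sum.inr (k + 1), Sum.inl (j + 2), Sum.inr (k + 2)]) z =
        -2 * conj (eval (slabPt ht hz)
          (∑ j, (slabWirtinger T e.open_target).B j ((chartData Ω hg he).cofactor k j))) := by
      intro k
      rw [← eval_conjHom]
      change _ = -2 * eval (slabPt ht hz) ((slabWirtinger T e.open_target).c _)
      rw [map_sum, map_sum, Finset.mul_sum]
      refine Finset.sum_congr rfl fun j _ => ?_
      rw [dHol_eq_eval e.open_target _ ht hz (fun w hw => hb e he w hw j k), h2, map_mul, map_neg,
        map_ofNat, Wirtinger.c_B, HermitianData.c_cofactor]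
    rw [dForm_eq_zero_iff (fun w => isAlt_balancedForm _ _)
      (Filter.Eventually.of_forall fun w => isTwoTwo_balancedForm _ _)]
    simp only [hB, hD]
    constructor
    · rintro ⟨h, -⟩ j
      simpa using h j
    · intro h
      exact ⟨fun j => by rw [h, mul_zero], fun k => by rw [h, map_zero, mul_zero]⟩
  constructor
  · intro h e he z hz
    exact eval_lee_eq_zero Ω hg he ht hz ((key e he z hz).1 (h e he z hz))
  · intro h e he z hz
    exact (key e he z hz).2 (eval_div_cofactor Ω hg he ht hz (h e he z hz))

end Bridge

/-! ### Equivalence of the flows for conformally balanced metrics -/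

section Equivalence

open SmoothAlg

/-- The divergence of the dual of a closed `(2,2)`-form vanishes. -/
theorem IsClosedTwoTwoForm.div_eq_zero {X : Type*} [TopologicalSpace X] [ChartedSpace C3 X]
    {Ψ : RealForm X 4} (hΨ : IsClosedTwoTwoForm Ψ)
    {e : OpenPartialHomeomorph X C3} (he : e ∈ atlas C3 X) {z : C3} (hz : z ∈ e.target)
    (j : Fin 3) : ∑ k, dAnti k (fun w => Ψ.coeff e w
      (mixedIdx (j + 1) (k + 1) (j + 2) (k + 2))) z = 0 :=
  ((dForm_eq_zero_iff (fun w => isAlt_coeff Ψ e w) (by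
    filter_upwards [e.open_target.mem_nhds hz] with w hw using hΨ.type e he w hw)).1
      (hΨ.closed e he z hz)).1 j

variable {X : Type*} [TopologicalSpace X] [ChartedSpace C3 X] [IsManifold 𝓘(ℂ, C3) ω X]
  (Ω : HolVolumeForm X) {slope T : ℝ} {Φ : ℝ → RealForm X 4} {g : ℝ → HermitianMetric X}
  (hg : IsSmoothFamily T g)

theorem eval_leeHess_eq_zero {e : OpenPartialHomeomorph X C3} (he : e ∈ atlas C3 X) {t : ℝ}
    (ht : t ∈ Ico 0 T)
    (hθ : ∀ z (hz : z ∈ e.target) q, eval (slabPt ht hz) ((chartData Ω hg he).lee q) = 0)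
    {z : C3} (hz : z ∈ e.target) (p q : Fin 3) :
    eval (slabPt ht hz) ((chartData Ω hg he).leeHess p q) = 0 := by
  have hc : ∀ z (hz : z ∈ e.target) q,
      eval (slabPt ht hz) ((chartData Ω hg he).leeConj q) = 0 := fun z hz q =>
    (eval_conjHom _ _).trans (by rw [hθ, map_zero])
  rw [HermitianData.leeHess, map_add,
    ← dAnti_eq_eval e.open_target _ ht hz (fun w hw => (hθ w hw q).symm),
    ← dHol_eq_eval e.open_target _ ht hz (fun w hw => (hc w hw p).symm), dHol_zero, dAnti_zero,
    add_zero]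

include hg in
/-- Along the Anomaly flow the divergence of `‖Ω‖ω²` is preserved. -/
theorem isConformallyBalanced_of_isAnomalyFlow
    (hΦ : ∀ t ∈ Ico 0 T, IsClosedTwoTwoForm (Φ t)) (hbal : IsConformallyBalanced Ω (g 0))
    (h : IsAnomalyFlow Ω slope T Φ g) {t : ℝ} (ht : t ∈ Ico 0 T) :
    IsConformallyBalanced Ω (g t) := by
  have h0 : (0 : ℝ) ∈ Ico 0 T := ⟨le_rfl, ht.1.trans_lt ht.2⟩
  rw [isConformallyBalanced_iff Ω hg ht]
  intro e he z hz
  refine eval_lee_eq_zero Ω hg he ht hz fun j => ?_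
  have hini := eval_div_cofactor Ω hg he h0 hz
    ((isConformallyBalanced_iff Ω hg h0).1 hbal e he z hz) j
  set V := ∑ k, (slabWirtinger T e.open_target).B k ((chartData Ω hg he).cofactor j k) with hV
  -- Along the flow the residual is a multiple of Φ on the whole chart, and Φ is closed; the
  -- divergence of the residual is therefore zero, and it equals -2∂ₜ of the divergence of V.
  have hdt : ∀ s (hs : s ∈ Ico 0 T), eval (slabPt hs hz) ((slabWirtinger T e.open_target).dt V) = 0 := by
    intro s hs
    have h1 := congrArg (eval (slabPt hs hz)) ((chartData Ω hg he).div_anomaly slope j)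
    have h2 : ∀ k, eval (slabPt hs hz) ((slabWirtinger T e.open_target).B k
        ((chartData Ω hg he).anomaly slope (j + 1) (k + 1) (j + 2) (k + 2))) =
        slope * dAnti k (fun w => (Φ s).coeff e w (mixedIdx (j + 1) (k + 1) (j + 2) (k + 2))) z := by
      intro k
      rw [← dAnti_eq_eval e.open_target _ hs hz (fun w hw =>
        ((isAnomalyFlow_iff Ω hg hΦ).1 h e he s hs w hw (j + 1) (k + 1) (j + 2) (k + 2)).symm)]
      have hd := (((hΦ s hs).smooth e he (mixedIdx (j + 1) (k + 1) (j + 2) (k + 2))).differentiableOn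
        (by simp) z hz).differentiableAt (e.open_target.mem_nhds hz)
      simp only [dAnti]
      rw [fderiv_const_mul hd]
      simp only [smul_apply, smul_eq_mul]
      ring
    rw [map_sum] at h1
    simp only [h2, ← Finset.mul_sum, (hΦ s hs).div_eq_zero he hz, mul_zero] at h1
    rw [map_mul, map_neg, map_ofNat] at h1
    exact (mul_eq_zero.1 h1.symm).resolve_left (by norm_num)
  have hder : ∀ s ∈ Ico 0 T, HasDerivWithinAt (fun s => fn V (s, z)) 0 (Ico 0 T) s := fun s hs => by
    rw [hasDerivWithinAt_iff_eval e.open_target V hs hz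
      fun s' hs' => fn_of_mem V (p := (s', z)) ⟨hs', hz⟩]
    exact hdt s hs
  have hconst := (convex_Ico 0 T).norm_image_sub_le_of_norm_hasDerivWithin_le (C := 0)
    (f := fun s => fn V (s, z)) hder (fun s _ => by simp) h0 ht
  rw [zero_mul, norm_le_zero_iff, sub_eq_zero] at hconst
  rw [fn_of_mem V (p := (t, z)) ⟨ht, hz⟩, fn_of_mem V (p := (0, z)) ⟨h0, hz⟩] at hconst
  exact hconst.trans hini

include hg in
/-- For conformally balanced metrics the Anomaly flow is the flow of the metric coefficients. -/
theorem isAnomalyFlow_iff_isMetricFlow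
    (hΦ : ∀ t ∈ Ico 0 T, IsClosedTwoTwoForm (Φ t))
    (hbal : ∀ t ∈ Ico 0 T, IsConformallyBalanced Ω (g t)) :
    IsAnomalyFlow Ω slope T Φ g ↔ IsMetricFlow Ω slope T Φ g := by
  rw [isAnomalyFlow_iff Ω hg hΦ, isMetricFlow_iff Ω hg]
  have hL : ∀ (e : OpenPartialHomeomorph X C3) (he : e ∈ atlas C3 X) (t : ℝ) (ht : t ∈ Ico 0 T)
      (z : C3) (hz : z ∈ e.target) (p q : Fin 3),
      eval (slabPt ht hz) ((chartData Ω hg he).leeHess p q) = 0 := fun e he t ht z hz p q =>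
    eval_leeHess_eq_zero Ω hg he ht ((isConformallyBalanced_iff Ω hg ht).1 (hbal t ht) e he) hz p q
  constructor
  · intro h e he t ht z hz p q
    simp only [h, sub_self, mul_zero, Finset.sum_const_zero, hL]
  · intro h e he t ht z hz q r s p
    have hGH := congrArg (fun M => M.map (eval (slabPt ht hz))) (chartData Ω hg he).GH
    simp only [Matrix.map_mul, Matrix.map_one _ (map_zero (eval (slabPt ht hz)))
      (map_one (eval (slabPt ht hz)))] at hGH
    have hA := isAlt_coeff (Φ t) e z
    -- With `leeHess` zero, the residual minus the Φ-term is a (2,2)-array with vanishing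
    -- contraction, hence zero.
    refine sub_eq_zero.1 (eq_zero_of_contract_eq_zero hGH (F := fun q r s p =>
      eval (slabPt ht hz) ((chartData Ω hg he).anomaly slope q r s p) -
        slope * (Φ t).coeff e z (mixedIdx q r s p)) (fun q r s p => ?_) (fun q r s p => ?_)
      (fun p q => ?_) q r s p)
    · simp only [mixedIdx]
      rw [HermitianData.anomaly_swap_inl, hA.swap_zero_two, map_neg]
      ring
    · simp only [mixedIdx]
      rw [HermitianData.anomaly_swap_inr, hA.swap_one_three, map_neg]
      ring
    · have h1 := h e he t ht z hz p q
      rw [hL] at h1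
      exact (mul_eq_zero.1 h1).resolve_left two_ne_zero

include hg in
theorem isAnomalyFlow_iff_balanced_and_isMetricFlow
    (hΦ : ∀ t ∈ Ico 0 T, IsClosedTwoTwoForm (Φ t)) (hbal : IsConformallyBalanced Ω (g 0)) :
    IsAnomalyFlow Ω slope T Φ g ↔
      (∀ t ∈ Ico 0 T, IsConformallyBalanced Ω (g t)) ∧ IsMetricFlow Ω slope T Φ g := by
  constructor
  · intro h
    have hb : ∀ t ∈ Ico 0 T, IsConformallyBalanced Ω (g t) := fun t ht =>
      isConformallyBalanced_of_isAnomalyFlow Ω hg hΦ hbal h ht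
    exact ⟨hb, (isAnomalyFlow_iff_isMetricFlow Ω hg hΦ hb).1 h⟩
  · rintro ⟨hb, h⟩
    exact (isAnomalyFlow_iff_isMetricFlow Ω hg hΦ hb).2 h

end Equivalence

section WirtingerRules

variable {u v : C3 → ℂ} {z : C3} (hu : DifferentiableAt ℝ u z) (hv : DifferentiableAt ℝ v z)
  (c : ℂ) (j : Fin 3)

include hu

theorem dAnti_const_mul : dAnti j (fun w => c * u w) z = c * dAnti j u z := by
  simp only [dAnti, fderiv_const_mul hu, smul_apply, smul_eq_mul]
  ring

include hv

theorem dAnti_sub : dAnti j (fun w => u w - v w) z = dAnti j u z - dAnti j v z := by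
  simp only [dAnti, fderiv_fun_sub hu hv, sub_apply]
  ring

theorem dHol_mul : dHol j (fun w => u w * v w) z = u z * dHol j v z + dHol j u z * v z := by
  simp only [dHol, fderiv_fun_mul hu hv, add_apply, smul_apply, smul_eq_mul]
  ring

end WirtingerRules

/-! ### The evolution equation for `lee` along the metric flow -/

section Divergence

open SmoothAlg

variable {X : Type*} [TopologicalSpace X] [ChartedSpace C3 X] [IsManifold 𝓘(ℂ, C3) ω X]
  (Ω : HolVolumeForm X) {slope T : ℝ} {Φ : ℝ → RealForm X 4} {g : ℝ → HermitianMetric X}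
  (hg : IsSmoothFamily T g)

/-- The contraction of the residual is `leeHess`/2 by `isMetricFlow_iff`, and `two_mul_dual_eq`
inverts the contraction; the factor 4 collects the two halves. -/
theorem four_mul_dual_anomaly_sub (h : IsMetricFlow Ω slope T Φ g) {e : OpenPartialHomeomorph X C3}
    (he : e ∈ atlas C3 X) {t : ℝ} (ht : t ∈ Ico 0 T) {z : C3} (hz : z ∈ e.target) (j k : Fin 3) :
    4 * (eval (slabPt ht hz)
        ((chartData Ω hg he).anomaly slope (j + 1) (k + 1) (j + 2) (k + 2)) -
        slope * (Φ t).coeff e z (mixedIdx (j + 1) (k + 1) (j + 2) (k + 2))) =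
      eval (slabPt ht hz) ((chartData Ω hg he).G.det * (2 * ((chartData Ω hg he).H *
        Matrix.of (chartData Ω hg he).leeHess * (chartData Ω hg he).H) j k -
        ((chartData Ω hg he).H * Matrix.of (chartData Ω hg he).leeHess).trace *
          (chartData Ω hg he).H j k)) := by
  have hGH := congrArg (fun M => M.map (eval (slabPt ht hz))) (chartData Ω hg he).GH
  simp only [Matrix.map_mul, Matrix.map_one _ (map_zero (eval (slabPt ht hz)))
    (map_one (eval (slabPt ht hz)))] at hGH
  have hA := isAlt_coeff (Φ t) e z
  have h1 : ∀ q r s p, eval (slabPt ht hz) ((chartData Ω hg he).anomaly slope s r q p) -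
        slope * (Φ t).coeff e z (mixedIdx s r q p) =
      -(eval (slabPt ht hz) ((chartData Ω hg he).anomaly slope q r s p) -
        slope * (Φ t).coeff e z (mixedIdx q r s p)) := fun q r s p => by
    simp only [mixedIdx]
    rw [HermitianData.anomaly_swap_inl, hA.swap_zero_two, map_neg]
    ring
  have h2 : ∀ q r s p, eval (slabPt ht hz) ((chartData Ω hg he).anomaly slope q p s r) -
        slope * (Φ t).coeff e z (mixedIdx q p s r) =
      -(eval (slabPt ht hz) ((chartData Ω hg he).anomaly slope q r s p) -
        slope * (Φ t).coeff e z (mixedIdx q r s p)) := fun q r s p => by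
    simp only [mixedIdx]
    rw [HermitianData.anomaly_swap_inr, hA.swap_one_three, map_neg]
    ring
  have key := two_mul_dual_eq hGH (fun q r s p =>
      eval (slabPt ht hz) ((chartData Ω hg he).anomaly slope q r s p) -
        slope * (Φ t).coeff e z (mixedIdx q r s p))
    ((1 / 2 : ℂ) • (Matrix.of (chartData Ω hg he).leeHess).map (eval (slabPt ht hz)))
    (fun q r p => self_eq_neg.1 (h1 q r q p)) (fun q r s => self_eq_neg.1 (h2 q r s r)) h1 h2
    (fun p q => by
      have h3 := (isMetricFlow_iff Ω hg).1 h e he t ht z hz p q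
      rw [Matrix.smul_apply, smul_eq_mul, Matrix.map_apply, Matrix.of_apply, ← h3]
      simp only [Matrix.map_apply]
      ring) j k
  rw [Matrix.mul_smul, Matrix.smul_mul, Matrix.trace_smul, Matrix.smul_apply, ← Matrix.map_mul,
    ← Matrix.map_mul, Matrix.map_apply, ← AddMonoidHom.map_trace, Matrix.map_apply, smul_eq_mul,
    smul_eq_mul] at key
  have hd : ((chartData Ω hg he).G.map (eval (slabPt ht hz))).det =
      eval (slabPt ht hz) (chartData Ω hg he).G.det := ((eval (slabPt ht hz)).map_det _).symm
  rw [hd] at key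
  simp only [map_mul, map_sub, map_ofNat]
  linear_combination 2 * key

/-- Taking the ∂̄-divergence of `four_mul_dual_anomaly_sub` removes the closed form Φ and, by
`div_anomaly`, leaves -8∂ₜ(div V), which is 4∂ₜ(Vθ̄) by `two_mul_div_cofactor`. -/
theorem divergenceEquation_of_isMetricFlow (hΦ : ∀ t ∈ Ico 0 T, IsClosedTwoTwoForm (Φ t))
    (h : IsMetricFlow Ω slope T Φ g) {e : OpenPartialHomeomorph X C3} (he : e ∈ atlas C3 X) :
    (chartData Ω hg he).DivergenceEquation := by
  intro j
  refine ext_eval fun p => ?_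
  obtain ⟨⟨t, z⟩, ht, hz⟩ := p
  change t ∈ Ico 0 T at ht
  change z ∈ e.target at hz
  change eval (slabPt ht hz) _ = eval (slabPt ht hz) _
  have h1 := congrArg (fun x => eval (slabPt ht hz) ((slabWirtinger T e.open_target).dt x))
    ((chartData Ω hg he).two_mul_div_cofactor j)
  have h2 := congrArg (eval (slabPt ht hz)) ((chartData Ω hg he).div_anomaly slope j)
  have hδ : (slabWirtinger T e.open_target).dt 2 = 0 :=
    (slabWirtinger T e.open_target).dt.map_natCast 2
  simp only [Derivation.leibniz, hδ, add_zero, smul_eq_mul, mul_zero, map_neg, map_mul,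
    map_ofNat] at h1 h2
  have hcl := (hΦ t ht).div_eq_zero he hz j
  have h3 : ∀ k, eval (slabPt ht hz) ((slabWirtinger T e.open_target).B k
      ((chartData Ω hg he).G.det * (2 * ((chartData Ω hg he).H *
        Matrix.of (chartData Ω hg he).leeHess * (chartData Ω hg he).H) j k -
        ((chartData Ω hg he).H * Matrix.of (chartData Ω hg he).leeHess).trace *
          (chartData Ω hg he).H j k))) =
      4 * (eval (slabPt ht hz) ((slabWirtinger T e.open_target).B k
        ((chartData Ω hg he).anomaly slope (j + 1) (k + 1) (j + 2) (k + 2))) -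
      slope * dAnti k (fun w => (Φ t).coeff e w (mixedIdx (j + 1) (k + 1) (j + 2) (k + 2))) z) := by
    intro k
    have hd := (((hΦ t ht).smooth e he (mixedIdx (j + 1) (k + 1) (j + 2) (k + 2))).differentiableOn
      (by simp) z hz).differentiableAt (e.open_target.mem_nhds hz)
    have hd' := (hasFDerivAt_slice e.open_target
      ((chartData Ω hg he).anomaly slope (j + 1) (k + 1) (j + 2) (k + 2)) ht hz
      (u := fun w => fn ((chartData Ω hg he).anomaly slope (j + 1) (k + 1) (j + 2) (k + 2)) (t, w))
      (fun w hw => fn_of_mem (S := slab T e.target) _ (p := (t, w)) ⟨ht, hw⟩)).differentiableAt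
    rw [← dAnti_eq_eval e.open_target _ ht hz (u := fun w =>
        4 * (fn ((chartData Ω hg he).anomaly slope (j + 1) (k + 1) (j + 2) (k + 2)) (t, w) -
        slope * (Φ t).coeff e w (mixedIdx (j + 1) (k + 1) (j + 2) (k + 2)))) (fun w hw => by
        rw [← four_mul_dual_anomaly_sub Ω hg h he ht hw, fn_of_mem (S := slab T e.target) _ (p := (t, w)) ⟨ht, hw⟩]),
      ← dAnti_eq_eval e.open_target _ ht hz (u := fun w =>
        fn ((chartData Ω hg he).anomaly slope (j + 1) (k + 1) (j + 2) (k + 2)) (t, w))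
        (fun w hw => fn_of_mem (S := slab T e.target) _ (p := (t, w)) ⟨ht, hw⟩)]
    rw [dAnti_const_mul (hd'.fun_sub (hd.const_mul _)), dAnti_sub hd' (hd.const_mul _), dAnti_const_mul hd]
  rw [map_sum] at h2
  rw [map_sum, Finset.sum_congr rfl fun k _ => h3 k, ← Finset.mul_sum, Finset.sum_sub_distrib,
    ← Finset.mul_sum, hcl, h2, map_mul, map_ofNat, ← map_sum]
  linear_combination 4 * h1

end Divergence

/-! ### Unitary coframes -/

/-- The rows of `b` decompose the Hermitian matrix `H` into squares, and `τ` bounds the inverse. -/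
structure IsCoframe (H b : Matrix (Fin 3) (Fin 3) ℂ) (τ : ℝ) : Prop where
  eq_sum : ∀ j k, H j k = ∑ d, b d j * conj (b d k)
  pos : 0 < τ
  le : ∀ v : Fin 3 → ℂ, ∑ i, ‖v i‖ ^ 2 ≤ τ * ∑ d, ‖∑ j, b d j * v j‖ ^ 2

namespace IsCoframe

variable {H b : Matrix (Fin 3) (Fin 3) ℂ} {τ : ℝ}

theorem transpose (h : IsCoframe H b τ) : IsCoframe H.transpose (b.map conj) τ where
  eq_sum j k := by
    rw [Matrix.transpose_apply, h.eq_sum]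
    exact Finset.sum_congr rfl fun d _ => by simp [mul_comm]
  pos := h.pos
  le v := by
    have h1 := h.le fun j => conj (v j)
    have h2 : ∀ d, ‖∑ j, b d j * conj (v j)‖ = ‖∑ j, (b.map conj) d j * v j‖ := fun d => by
      rw [← RCLike.norm_conj]
      simp
    simpa only [h2, RCLike.norm_conj] using h1

theorem sum_eq (h : IsCoframe H b τ) (v w : Fin 3 → ℂ) : ∑ j, ∑ k, H j k * (v j * conj (w k)) =
    ∑ d, (∑ j, b d j * v j) * conj (∑ j, b d j * w j) := by
  simp only [h.eq_sum, Fin.sum_univ_three, map_add, map_mul]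
  ring

theorem sum_norm_sq_le (h : IsCoframe H b τ) (v : Fin 3 → ℂ) :
    ∑ i, ‖v i‖ ^ 2 ≤ τ * (∑ j, ∑ k, H j k * (v j * conj (v k))).re := by
  rw [h.sum_eq, Complex.re_sum]
  simp only [Complex.mul_conj, Complex.normSq_eq_norm_sq, Complex.ofReal_re]
  exact h.le v

/-- Diagonalising K in the index j and then H in the index a costs one factor τ each. -/
theorem sum_sum_norm_sq_le (h : IsCoframe H b τ) {K c : Matrix (Fin 3) (Fin 3) ℂ}
    (hK : IsCoframe K c τ) (M : Fin 3 → Fin 3 → ℂ) : ∑ a, ∑ j, ‖M a j‖ ^ 2 ≤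
      τ ^ 2 * (∑ j, ∑ k, ∑ a, ∑ b, H a b * K j k * (M a j * conj (M b k))).re := by
  have e : ∑ j, ∑ k, ∑ a, ∑ b, H a b * K j k * (M a j * conj (M b k)) =
      ∑ d, ∑ a, ∑ b, H a b * ((∑ j, c d j * M a j) * conj (∑ j, c d j * M b j)) := by
    have e1 : ∀ a b, ∑ j, ∑ k, K j k * (M a j * conj (M b k)) =
        ∑ d, (∑ j, c d j * M a j) * conj (∑ j, c d j * M b j) := fun a b => hK.sum_eq _ _
    calc _ = ∑ a, ∑ b, H a b * ∑ j, ∑ k, K j k * (M a j * conj (M b k)) := by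
          simp only [Fin.sum_univ_three]; ring
      _ = _ := by
          simp only [e1]
          rw [Finset.sum_comm (f := fun d a => ∑ b, _)]
          refine Finset.sum_congr rfl fun a _ => ?_
          rw [Finset.sum_comm]
          exact Finset.sum_congr rfl fun b _ => Finset.mul_sum _ _ _
  rw [e, Complex.re_sum]
  calc ∑ a, ∑ j, ‖M a j‖ ^ 2 ≤ ∑ a, τ * ∑ d, ‖∑ j, c d j * M a j‖ ^ 2 :=
        Finset.sum_le_sum fun a _ => hK.le _
    _ = τ * ∑ d, ∑ a, ‖∑ j, c d j * M a j‖ ^ 2 := by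
        rw [← Finset.mul_sum, Finset.sum_comm]
    _ ≤ τ * ∑ d, τ * (∑ a, ∑ b, H a b * ((∑ j, c d j * M a j) * conj (∑ j, c d j * M b j))).re :=
        mul_le_mul_of_nonneg_left (Finset.sum_le_sum fun d _ => h.sum_norm_sq_le _) h.pos.le
    _ = _ := by rw [← Finset.mul_sum]; ring

end IsCoframe

-- Factor G = C*C and take the rows of b from the transpose of C⁻¹. Then v = Cᵀ(bv), and
-- Cauchy–Schwarz bounds |v|² by the Frobenius norm of C, squared, which is tr G. The trace serves
-- as τ because it is continuous in G.
open scoped ComplexOrder MatrixOrder Matrix.Norms.L2Operator in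
theorem exists_isCoframe {G : Matrix (Fin 3) (Fin 3) ℂ} (hG : G.PosDef) :
    ∃ b, IsCoframe G⁻¹ b (∑ i, (G i i).re) := by
  obtain ⟨C, hC⟩ := CStarAlgebra.nonneg_iff_eq_star_mul_self.1 hG.posSemidef.nonneg
  rw [Matrix.star_eq_conjTranspose] at hC
  have hdet : IsUnit C.det := by
    have h := hG.det_pos.ne'
    rw [hC, Matrix.det_mul] at h
    exact (right_ne_zero_of_mul h).isUnit
  have hGC : G⁻¹ = C⁻¹ * (C⁻¹).conjTranspose := by
    rw [hC, Matrix.mul_inv_rev, Matrix.conjTranspose_nonsing_inv]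
  have htr : ∑ i, (G i i).re = ∑ i, ∑ d, ‖C d i‖ ^ 2 := by
    refine Finset.sum_congr rfl fun i _ => ?_
    rw [hC, Matrix.mul_apply, Complex.re_sum]
    refine Finset.sum_congr rfl fun d _ => ?_
    rw [Matrix.conjTranspose_apply, mul_comm]
    change (C d i * conj (C d i)).re = _
    rw [Complex.mul_conj, Complex.normSq_eq_norm_sq, Complex.ofReal_re]
  have hle : ∀ v : Fin 3 → ℂ, ∑ i, ‖v i‖ ^ 2 ≤
      (∑ i, (G i i).re) * ∑ d, ‖∑ j, (C⁻¹).transpose d j * v j‖ ^ 2 := fun v => by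
    have hv : ∀ i, v i = ∑ d, C d i * ∑ j, (C⁻¹).transpose d j * v j := by
      have h : C.transpose.mulVec ((C⁻¹).transpose.mulVec v) = v := by
        rw [Matrix.mulVec_mulVec, ← Matrix.transpose_mul, Matrix.nonsing_inv_mul _ hdet,
          Matrix.transpose_one, Matrix.one_mulVec]
      intro i
      exact (congrFun h i).symm
    rw [htr, Finset.sum_mul]
    refine Finset.sum_le_sum fun i _ => ?_
    calc ‖v i‖ ^ 2 = ‖∑ d, C d i * ∑ j, (C⁻¹).transpose d j * v j‖ ^ 2 := by rw [← hv i]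
      _ ≤ (∑ d, ‖C d i‖ * ‖∑ j, (C⁻¹).transpose d j * v j‖) ^ 2 := by
          gcongr
          exact (norm_sum_le _ _).trans (Finset.sum_le_sum fun d _ => (norm_mul _ _).le)
      _ ≤ _ := Finset.sum_mul_sq_le_sq_mul_sq _ _ _
  refine ⟨(C⁻¹).transpose, fun j k => ?_, ?_, hle⟩
  · rw [hGC, Matrix.mul_apply]
    rfl
  · have h0 : 0 ≤ ∑ i, (G i i).re := by rw [htr]; positivity
    refine lt_of_le_of_ne h0 fun h => ?_
    have h1 := hle (Pi.single 0 1)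
    rw [← h, zero_mul] at h1
    simp [Pi.single_apply, Fin.sum_univ_three] at h1
    norm_num at h1

/-! ### Pointwise bounds for ideals of smooth functions -/

namespace SmoothAlg

variable {E : Type*} [NormedAddCommGroup E] [NormedSpace ℝ E] {S : Set E}

theorem exists_bound_of_mem_span {ι : Type*} [Fintype ι] {v : ι → SmoothAlg S} {x : SmoothAlg S}
    (hx : x ∈ Ideal.span (Set.range v)) : ∃ c : S → ℝ, Continuous c ∧ (∀ p, 0 ≤ c p) ∧
      ∀ p, ‖eval p x‖ ≤ c p * ∑ i, ‖eval p (v i)‖ := by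
  obtain ⟨a, rfl⟩ := Ideal.mem_span_range_iff_exists_fun.1 hx
  refine ⟨fun p => ∑ i, ‖eval p (a i)‖, continuous_finsetSum _ fun i _ => (continuous_eval _).norm,
    fun p => by positivity, fun p => ?_⟩
  rw [map_sum, Finset.sum_mul]
  refine (norm_sum_le _ _).trans (Finset.sum_le_sum fun i _ => ?_)
  rw [map_mul, norm_mul]
  exact mul_le_mul_of_nonneg_left
    (Finset.single_le_sum (f := fun i => ‖eval p (v i)‖) (fun i _ => norm_nonneg _)
      (Finset.mem_univ i)) (norm_nonneg _)

/-- Ideal membership becomes an estimate with a continuous coefficient, which compactness will later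
bound. -/
theorem exists_bound_of_mem_mul {ι κ : Type*} [Fintype ι] [Fintype κ] {v : ι → SmoothAlg S}
    {w : κ → SmoothAlg S} {x : SmoothAlg S}
    (hx : x ∈ Ideal.span (Set.range v) * Ideal.span (Set.range w)) :
    ∃ c : S → ℝ, Continuous c ∧ (∀ p, 0 ≤ c p) ∧
      ∀ p, ‖eval p x‖ ≤ c p * ((∑ i, ‖eval p (v i)‖) * ∑ i, ‖eval p (w i)‖) := by
  induction hx using Submodule.mul_induction_on' with
  | mem_mul_mem y hy z hz =>
    obtain ⟨c, hc, hc0, h⟩ := exists_bound_of_mem_span hy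
    obtain ⟨c', hc', hc0', h'⟩ := exists_bound_of_mem_span hz
    refine ⟨fun p => c p * c' p, hc.mul hc', fun p => mul_nonneg (hc0 p) (hc0' p), fun p => ?_⟩
    rw [map_mul, norm_mul]
    calc _ ≤ _ := mul_le_mul (h p) (h' p) (norm_nonneg _)
          (mul_nonneg (hc0 p) (Finset.sum_nonneg fun _ _ => norm_nonneg _))
      _ = _ := by ring
  | add y hy z hz h h' =>
    obtain ⟨c, hc, hc0, h⟩ := h
    obtain ⟨c', hc', hc0', h'⟩ := h'
    refine ⟨fun p => c p + c' p, hc.add hc', fun p => add_nonneg (hc0 p) (hc0' p), fun p => ?_⟩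
    rw [map_add, add_mul]
    exact (norm_add_le _ _).trans (add_le_add (h p) (h' p))

end SmoothAlg

theorem sq_sum_sum_le (x : Fin 3 → Fin 3 → ℝ) : (∑ i, ∑ j, x i j) ^ 2 ≤ 9 * ∑ i, ∑ j, x i j ^ 2 := by
  have h := sq_sum_le_card_mul_sum_sq (s := Finset.univ) (f := fun p : Fin 3 × Fin 3 => x p.1 p.2)
  simpa [Fintype.sum_prod_type] using h

/-- Young's inequality cθZ ≤ Z²/(72τ²) + 18c²τ²θ², whose defect is twice a square. Its first term is
at most γ, so the gradient absorbs it. -/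
theorem absorb_gradient {r γ u c τ θ Z m S : ℝ} (hc : 0 ≤ c) (hτ : 0 < τ)
    (hr : r ≤ c * (θ * (θ + Z))) (hZ : Z ^ 2 ≤ 72 * S) (hS : S ≤ τ ^ 2 * γ) (hθ : θ ^ 2 ≤ 12 * m)
    (hm : m ≤ τ * u) : r - γ ≤ (c + 18 * c ^ 2 * τ ^ 2) * (12 * τ) * u := by
  have h1 : Z ^ 2 / (72 * τ ^ 2) ≤ γ := by
    rw [div_le_iff₀ (by positivity)]; linarith
  have h2 : Z ^ 2 / (72 * τ ^ 2) + 18 * c ^ 2 * τ ^ 2 * θ ^ 2 - c * θ * Z =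
      2 * (Z / (12 * τ) - 3 * c * τ * θ) ^ 2 := by
    field_simp
    ring
  have h3 : 0 ≤ 2 * (Z / (12 * τ) - 3 * c * τ * θ) ^ 2 := by positivity
  have h4 : θ ^ 2 ≤ 12 * τ * u := by linarith
  have h5 : 0 ≤ c + 18 * c ^ 2 * τ ^ 2 := by positivity
  have h6 := mul_le_mul_of_nonneg_left h4 h5
  calc r - γ ≤ (c + 18 * c ^ 2 * τ ^ 2) * θ ^ 2 := by linarith
    _ ≤ _ := by linarith

/-! ### The differential inequality for |θ|² -/

section Estimate

open SmoothAlg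

variable {T : ℝ} {U : Set C3} {hU : IsOpen U} (X : HermitianData (slabWirtinger T hU))
  {p : slab T U} {b : Matrix (Fin 3) (Fin 3) ℂ} {τ : ℝ}

theorem sum_norm_lee_sq_le (hb : IsCoframe (X.H.map (eval p)) b τ) :
    ∑ q, ‖eval p (X.lee q)‖ ^ 2 ≤ τ * (eval p X.leeNormSq).re := by
  have h := hb.sum_norm_sq_le fun q => eval p (X.lee q)
  simp only [HermitianData.leeNormSq, map_sum, map_mul]
  exact h

theorem eval_leeNormSq_nonneg (hb : IsCoframe (X.H.map (eval p)) b τ) :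
    0 ≤ (eval p X.leeNormSq).re := by
  have h := sum_norm_lee_sq_le X hb
  have h0 : 0 ≤ ∑ q, ‖eval p (X.lee q)‖ ^ 2 := by positivity
  exact nonneg_of_mul_nonneg_right (h0.trans h) hb.pos

theorem sum_norm_derivative_sq_le (hb : IsCoframe (X.H.map (eval p)) b τ) :
    (∑ a, ∑ j, ‖eval p ((slabWirtinger T hU).D a (X.lee j))‖ ^ 2) +
      ∑ a, ∑ j, ‖eval p ((slabWirtinger T hU).B a (X.lee j))‖ ^ 2 ≤
      τ ^ 2 * (eval p X.leeGradSq).re := by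
  have h1 := hb.sum_sum_norm_sq_le hb fun a j =>
    eval p ((slabWirtinger T hU).D a (X.lee j))
  -- In the ∂̄-derivatives the differentiation index is barred, so the inverse metric enters
  -- transposed.
  have h2 := hb.transpose.sum_sum_norm_sq_le hb fun a j =>
    eval p ((slabWirtinger T hU).B a (X.lee j))
  refine (add_le_add h1 h2).trans_eq ?_
  rw [← mul_add, ← Complex.add_re]
  congr 2
  have c1 : ∀ a j, conj (eval p ((slabWirtinger T hU).D a (X.lee j))) =
      eval p ((slabWirtinger T hU).B a (X.leeConj j)) := fun a j => by
    rw [← eval_conjHom]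
    exact congrArg _ ((slabWirtinger T hU).c_D a _)
  have c2 : ∀ a j, conj (eval p ((slabWirtinger T hU).B a (X.lee j))) =
      eval p ((slabWirtinger T hU).D a (X.leeConj j)) := fun a j => by
    rw [← eval_conjHom]
    exact congrArg _ ((slabWirtinger T hU).c_B a _)
  simp only [c1, c2, HermitianData.leeGradSq, map_sum, map_add, map_mul, Matrix.transpose_apply,
    Matrix.map_apply, mul_add, Finset.sum_add_distrib]
  congr 1
  exact Finset.sum_congr rfl fun j _ => Finset.sum_congr rfl fun k _ => Finset.sum_comm

/-- The differential inequality for the squared norm of `lee`. -/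
theorem exists_parabolic_bound (h : X.DivergenceEquation) {τ : slab T U → ℝ}
    (hτ : Continuous τ) (hb' : ∀ p, ∃ b, IsCoframe (X.H.map (eval p)) b (τ p)) :
    ∃ C : slab T U → ℝ, Continuous C ∧ ∀ p,
      (eval p (2 * X.n *
        (slabWirtinger T hU).dt X.leeNormSq -
        X.laplacian X.leeNormSq)).re ≤
      C p * (eval p X.leeNormSq).re := by
  obtain ⟨c, hc, hc0, hb⟩ := exists_bound_of_mem_mul (X.parabolic_leeNormSq h)
  refine ⟨fun p => (c p + 18 * c p ^ 2 * τ p ^ 2) * (12 * τ p),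
    by fun_prop, fun p => ?_⟩
  obtain ⟨b, hfr⟩ := hb' p
  have c0 : ∀ j, ‖eval p (X.leeConj j)‖ = ‖eval p (X.lee j)‖ := fun j => by
    rw [← RCLike.norm_conj, ← eval_conjHom]
    exact congrArg (fun x => ‖eval p x‖) (X.c_leeConj j)
  have c1 : ∀ a j, ‖eval p ((slabWirtinger T hU).B a (X.leeConj j))‖ = ‖eval p ((slabWirtinger T hU).D a (X.lee j))‖ := fun a j => by
    rw [← RCLike.norm_conj, ← eval_conjHom]
    exact congrArg (fun x => ‖eval p x‖) (((slabWirtinger T hU).c_B a _).trans (by rw [X.c_leeConj]))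
  have c2 : ∀ a j, ‖eval p ((slabWirtinger T hU).D a (X.leeConj j))‖ = ‖eval p ((slabWirtinger T hU).B a (X.lee j))‖ := fun a j => by
    rw [← RCLike.norm_conj, ← eval_conjHom]
    exact congrArg (fun x => ‖eval p x‖) (((slabWirtinger T hU).c_D a _).trans (by rw [X.c_leeConj]))
  set M := ∑ a, ∑ j, ‖eval p ((slabWirtinger T hU).D a (X.lee j))‖ with hM
  set N := ∑ a, ∑ j, ‖eval p ((slabWirtinger T hU).B a (X.lee j))‖ with hN
  have hθ : ∑ a, ‖eval p (X.leeGen a)‖ = 2 * ∑ q, ‖eval p (X.lee q)‖ := by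
    rw [Fintype.sum_sum_type]
    simp only [HermitianData.leeGen, Sum.elim_inl, Sum.elim_inr, c0]
    ring
  have hJ : ∑ a, ‖eval p (X.leeJet a)‖ = 2 * ∑ q, ‖eval p (X.lee q)‖ + 2 * (M + N) := by
    rw [Fintype.sum_sum_type, Fintype.sum_prod_type, Fintype.sum_sum_type]
    simp only [Fintype.sum_sum_type, HermitianData.leeJet, HermitianData.leeGen, Sum.elim_inl,
      Sum.elim_inr, c0, c1, c2, Finset.sum_add_distrib, ← hM, ← hN]
    ring
  have hr := hb p
  rw [hθ, hJ] at hr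
  have hM2 := sq_sum_sum_le fun a j => ‖eval p ((slabWirtinger T hU).D a (X.lee j))‖
  have hN2 := sq_sum_sum_le fun a j => ‖eval p ((slabWirtinger T hU).B a (X.lee j))‖
  -- The constant is 2²·3: θ and θ̄ contribute equally, and Cauchy–Schwarz runs over three
  -- components.
  have hθ2 : (2 * ∑ q, ‖eval p (X.lee q)‖) ^ 2 ≤ 12 * ∑ q, ‖eval p (X.lee q)‖ ^ 2 := by
    have := sq_sum_le_card_mul_sum_sq (s := Finset.univ) (f := fun q => ‖eval p (X.lee q)‖)
    rw [mul_pow]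
    simp at this
    linarith
  have hre := (Complex.re_le_norm _).trans hr
  have key := absorb_gradient (hc0 p) hfr.pos hre (S := _) ?_ (sum_norm_derivative_sq_le X hfr) hθ2
    (sum_norm_lee_sq_le X hfr)
  · rw [map_add, Complex.add_re] at key
    simpa using key
  · rw [← hM] at hM2
    rw [← hN] at hN2
    -- Here Z = 2(M + N), so Z² ≤ 8(M² + N²), and each square is at most 9 times its sum of squares,
    -- giving 72.
    nlinarith [sq_nonneg (M - N)]

end Estimate

section ChartEstimate

open SmoothAlg

variable {X : Type*} [TopologicalSpace X] [ChartedSpace C3 X] [IsManifold 𝓘(ℂ, C3) ω X]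
  (Ω : HolVolumeForm X) {T : ℝ} {g : ℝ → HermitianMetric X} (hg : IsSmoothFamily T g)
  {e : OpenPartialHomeomorph X C3} (he : e ∈ atlas C3 X)

/-- The trace of the metric coefficients. -/
def metricTrace (p : slab T e.target) : ℝ := ∑ i, (eval p ((chartData Ω hg he).G i i)).re

theorem continuous_metricTrace : Continuous (metricTrace Ω hg he) :=
  continuous_finsetSum _ fun _ _ => Complex.continuous_re.comp (continuous_eval _)

theorem exists_isCoframe_H (p : slab T e.target) :
    ∃ b, IsCoframe ((chartData Ω hg he).H.map (eval p)) b (metricTrace Ω hg he p) := by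
  obtain ⟨⟨t, z⟩, ht, hz⟩ := p
  obtain ⟨b, hb⟩ := exists_isCoframe ((g t).posDef_coeff he hz)
  refine ⟨b, ?_⟩
  have hH : (chartData Ω hg he).H.map (eval (slabPt ht hz)) = ((g t).coeff e z)⁻¹ := by
    ext i j
    exact eval_H Ω hg he ht hz i j
  rw [hH]
  exact hb

end ChartEstimate

/-! ### The Laplacian at a maximum -/

-- A positive second derivative would make a also a local minimum, so the function would be constant
-- near a and its second derivative zero.
open Filter Topology in
theorem second_derivative_nonpos_of_isLocalMax {h h' : ℝ → ℝ} {h'' a : ℝ} (hmax : IsLocalMax h a)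
    (h1 : ∀ᶠ s in 𝓝 a, HasDerivAt h (h' s) s) (h2 : HasDerivAt h' h'' a) : h'' ≤ 0 := by
  by_contra! hpos
  have e1 : deriv h =ᶠ[𝓝 a] h' := h1.mono fun s hs => hs.deriv
  have e2 : deriv (deriv h) a = h'' := by rw [e1.deriv_eq, h2.deriv]
  have hmin := isLocalMin_of_deriv_deriv_pos (by rw [e2]; exact hpos) hmax.deriv_eq_zero
    h1.self_of_nhds.continuousAt
  have hc : h =ᶠ[𝓝 a] fun _ => h a := by
    filter_upwards [hmax, hmin] with s h3 h4 using le_antisymm h3 h4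
  have e3 : deriv h =ᶠ[𝓝 a] fun _ => 0 := by
    have := hc.deriv
    simpa using this
  rw [e3.deriv_eq, deriv_const] at e2
  exact hpos.ne e2

section Laplacian

open SmoothAlg

variable {T : ℝ} {U : Set C3} {hU : IsOpen U}

/-- The decomposition of a real-linear form into complex-linear and antilinear parts. -/
theorem real_linear_eq_sum (L : C3 →L[ℝ] ℂ) (w : C3) : L w = ∑ a,
    (w a * ((L (Pi.single a 1) - Complex.I * L (Pi.single a Complex.I)) / 2) +
      conj (w a) * ((L (Pi.single a 1) + Complex.I * L (Pi.single a Complex.I)) / 2)) := by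
  have hw : w = ∑ a, ((w a).re • (Pi.single a 1 : C3) + (w a).im • (Pi.single a Complex.I : C3)) := by
    ext i
    simp only [Finset.sum_apply, Pi.add_apply, Pi.smul_apply,
      Pi.single_apply, smul_ite, smul_zero, Finset.sum_add_distrib, Finset.sum_ite_eq,
      Finset.mem_univ, if_true, Complex.real_smul, mul_one, Complex.re_add_im]
  conv_lhs => rw [hw]
  rw [map_sum]
  refine Finset.sum_congr rfl fun a _ => ?_
  rw [map_add, map_smul, map_smul, Complex.real_smul, Complex.real_smul]
  have h1 : w a = (w a).re + (w a).im * Complex.I := (Complex.re_add_im _).symm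
  have h2 : conj (w a) = (w a).re - (w a).im * Complex.I := Complex.ext (by simp) (by simp)
  rw [h2]
  conv_rhs => rw [h1]
  simp only [Complex.add_re, Complex.ofReal_re, Complex.mul_re, Complex.I_re, mul_zero,
    Complex.ofReal_im, Complex.I_im, mul_one, sub_self, add_zero, Complex.add_im, Complex.mul_im,
    zero_add]
  linear_combination (((w a).im : ℂ) * L (Pi.single a Complex.I)) * Complex.I_mul_I

theorem dirDeriv_eq_sum (hU : IsOpen U) (w : C3) (x : SmoothAlg (slab T U)) :
    dirDeriv (uniqueDiffOn_slab (T := T) hU) (0, w) x = ∑ a, (w a • (slabWirtinger T hU).D a x +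
      conj (w a) • (slabWirtinger T hU).B a x) := by
  refine ext_eval fun p => ?_
  rw [eval_dirDeriv, map_sum]
  refine (real_linear_eq_sum ((fderivWithin ℝ (fn x) (slab T U) p).comp
    (ContinuousLinearMap.inr ℝ ℝ C3)) w).trans (Finset.sum_congr rfl fun a _ => ?_)
  rw [map_add, map_smul, map_smul]
  simp only [slabWirtinger, eval_slabDeriv, smul_eq_mul, ContinuousLinearMap.comp_apply,
    ContinuousLinearMap.inr_apply, neg_mul, sub_eq_add_neg]

/-- In the sum over the directions w and iw the pure terms ∂∂ and ∂̄∂̄ cancel, since i² = -1; only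
the Levi form in direction w remains. -/
theorem dirDeriv_dirDeriv_add (hU : IsOpen U) (w : C3) (x : SmoothAlg (slab T U)) :
    dirDeriv (uniqueDiffOn_slab (T := T) hU) (0, w)
        (dirDeriv (uniqueDiffOn_slab (T := T) hU) (0, w) x) +
      dirDeriv (uniqueDiffOn_slab (T := T) hU) (0, Complex.I • w)
        (dirDeriv (uniqueDiffOn_slab (T := T) hU) (0, Complex.I • w) x) =
    4 * ∑ a, ∑ b, (w a * conj (w b)) • (slabWirtinger T hU).D a ((slabWirtinger T hU).B b x) := by
  refine ext_eval fun p => ?_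
  simp only [dirDeriv_eq_sum hU, Fin.sum_univ_three, map_add, Derivation.map_smul, map_smul,
    smul_eq_mul, Pi.smul_apply, map_mul, Complex.conj_I, ← (slabWirtinger T hU).D_B, map_ofNat,
    smul_add]
  ring_nf
  simp only [Complex.I_sq]
  ring

theorem hasDerivAt_line (hU : IsOpen U) (x : SmoothAlg (slab T U)) {t : ℝ} (ht : t ∈ Ico 0 T)
    {z w : C3} {s : ℝ} (hz : z + s • w ∈ U) : HasDerivAt (fun s : ℝ => fn x (t, z + s • w))
      (fn (dirDeriv (uniqueDiffOn_slab (T := T) hU) (0, w) x) (t, z + s • w)) s := by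
  have h1 := hasFDerivAt_slice hU x ht hz (u := fun v => fn x (t, v))
    (fun v hv => fn_of_mem (S := slab T U) _ (p := (t, v)) ⟨ht, hv⟩)
  have h2 : HasDerivAt (fun s : ℝ => z + s • w) w s := by
    simpa using ((hasDerivAt_id s).smul_const w).const_add z
  have h3 := h1.comp_hasDerivAt s h2
  rw [fn_of_mem (S := slab T U) _ (p := (t, z + s • w)) ⟨ht, hz⟩, eval_dirDeriv]
  exact h3

open Filter Topology in
theorem re_dirDeriv_dirDeriv_nonpos (hU : IsOpen U) (x : SmoothAlg (slab T U)) {t : ℝ}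
    (ht : t ∈ Ico 0 T) {z : C3} (hz : z ∈ U) (hmax : IsLocalMax (fun v => (fn x (t, v)).re) z)
    (w : C3) : (eval (slabPt ht hz) (dirDeriv (uniqueDiffOn_slab (T := T) hU) (0, w)
      (dirDeriv (uniqueDiffOn_slab (T := T) hU) (0, w) x))).re ≤ 0 := by
  have hc : ContinuousAt (fun s : ℝ => z + s • w) 0 := by fun_prop
  have h0 : z + (0 : ℝ) • w = z := by simp
  have hmem : ∀ᶠ s in 𝓝 (0 : ℝ), z + s • w ∈ U := by
    refine hc.eventually_mem ?_
    rw [h0]; exact hU.mem_nhds hz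
  have hm : IsLocalMax (fun s : ℝ => (fn x (t, z + s • w)).re) 0 := by
    have := hc.eventually (p := fun v => (fn x (t, v)).re ≤ (fn x (t, z)).re) (by simp only [h0]; exact hmax)
    filter_upwards [this] with s hs
    rwa [h0]
  have key := second_derivative_nonpos_of_isLocalMax hm
    (hmem.mono fun s hs => Complex.reCLM.hasFDerivAt.comp_hasDerivAt s (hasDerivAt_line hU x ht hs))
    (Complex.reCLM.hasFDerivAt.comp_hasDerivAt 0 (hasDerivAt_line hU _ ht (by rwa [h0])))
  rw [h0, fn_of_mem (S := slab T U) _ (p := (t, z)) ⟨ht, hz⟩] at key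
  exact key

/-- The coframe splits Δ into Levi forms along the vectors b_d. Each is a positive multiple of a sum
of two real second derivatives, nonpositive at a maximum. -/
theorem re_eval_laplacian_nonpos (X : HermitianData (slabWirtinger T hU)) (x : SmoothAlg (slab T U))
    {t : ℝ} (ht : t ∈ Ico 0 T) {z : C3} (hz : z ∈ U) {b : Matrix (Fin 3) (Fin 3) ℂ} {τ : ℝ}
    (hb : IsCoframe (X.H.map (eval (slabPt ht hz))) b τ)
    (hmax : IsLocalMax (fun v => (fn x (t, v)).re) z) :
    (eval (slabPt ht hz) (X.laplacian x)).re ≤ 0 := by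
  have h1 : ∀ d, (∑ a, ∑ c, b d a * conj (b d c) * eval (slabPt ht hz)
      ((slabWirtinger T hU).D a ((slabWirtinger T hU).B c x))).re ≤ 0 := fun d => by
    have h2 := re_dirDeriv_dirDeriv_nonpos hU x ht hz hmax (b d)
    have h3 := re_dirDeriv_dirDeriv_nonpos hU x ht hz hmax (Complex.I • b d)
    have h4 := congrArg (fun y => (eval (slabPt ht hz) y).re) (dirDeriv_dirDeriv_add hU (b d) x)
    simp only [map_add, Complex.add_re, map_mul, map_sum, map_smul, smul_eq_mul, map_ofNat] at h4
    rw [show (4 : ℂ) = ((4 : ℝ) : ℂ) by norm_num, Complex.re_ofReal_mul] at h4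
    linarith
  have h2 : eval (slabPt ht hz) (X.laplacian x) = ∑ d, ∑ a, ∑ c, b d a * conj (b d c) *
      eval (slabPt ht hz) ((slabWirtinger T hU).D a ((slabWirtinger T hU).B c x)) := by
    have h3 : ∀ a c, eval (slabPt ht hz) (X.H a c) = ∑ d, b d a * conj (b d c) := hb.eq_sum
    simp only [HermitianData.laplacian, map_sum, map_mul, h3, Finset.sum_mul]
    conv_rhs => rw [Finset.sum_comm]
    refine Finset.sum_congr rfl fun a _ => ?_
    rw [Finset.sum_comm]
  rw [h2, Complex.re_sum]
  exact Finset.sum_nonpos fun d _ => h1 d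

end Laplacian

/-! ### Holomorphic changes of coordinates -/

section HolomorphicChange

variable {z : C3}

theorem dHol_sum {ι : Type*} (s : Finset ι) {u : ι → C3 → ℂ}
    (hu : ∀ i, DifferentiableAt ℝ (u i) z) (j : Fin 3) :
    dHol j (fun w => ∑ i ∈ s, u i w) z = ∑ i ∈ s, dHol j (u i) z := by
  simp only [dHol, fderiv_fun_sum fun i _ => hu i, sum_apply, Finset.mul_sum,
    ← Finset.sum_sub_distrib, Finset.sum_div]

theorem single_I (j : Fin 3) : (Pi.single j Complex.I : C3) = Complex.I • Pi.single j 1 := by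
  ext i; simp [Pi.single_apply]

theorem dHol_of_holomorphic {u : C3 → ℂ} (hu : DifferentiableAt ℂ u z) (j : Fin 3) :
    dHol j u z = fderiv ℂ u z (Pi.single j 1) := by
  rw [dHol, (hu.hasFDerivAt.restrictScalars ℝ).fderiv]
  simp only [ContinuousLinearMap.coe_restrictScalars', single_I, map_smul, smul_eq_mul]
  linear_combination (-(fderiv ℂ u z (Pi.single j 1)) / 2) * Complex.I_mul_I

theorem differentiableAt_conj {u : C3 → ℂ} (hu : DifferentiableAt ℝ u z) :
    DifferentiableAt ℝ (fun w => conj (u w)) z :=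
  Complex.conjCLE.differentiableAt.comp z hu

theorem dHol_conj_of_holomorphic {u : C3 → ℂ} (hu : DifferentiableAt ℂ u z) (j : Fin 3) :
    dHol j (fun w => conj (u w)) z = 0 := by
  have h := Complex.conjCLE.hasFDerivAt.comp z (hu.hasFDerivAt.restrictScalars ℝ)
  have h' : fderiv ℝ (fun w => conj (u w)) z = _ := h.fderiv
  rw [dHol, h']
  simp only [ContinuousLinearMap.comp_apply, ContinuousLinearMap.coe_restrictScalars', single_I,
    map_smul, smul_eq_mul, ContinuousLinearEquiv.coe_coe, Complex.conjCLE_apply, map_mul,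
    Complex.conj_I]
  linear_combination (conj (fderiv ℂ u z (Pi.single j 1)) / 2) * Complex.I_mul_I

theorem dHol_comp {F : C3 → C3} {h : C3 → ℂ} (hh : DifferentiableAt ℝ h (F z))
    (hF : DifferentiableAt ℂ F z) (j : Fin 3) : dHol j (fun w => h (F w)) z =
      ∑ c, dHol c h (F z) * fderiv ℂ F z (Pi.single j 1) c := by
  have h1 : fderiv ℝ (fun w => h (F w)) z = _ :=
    (hh.hasFDerivAt.comp z (hF.hasFDerivAt.restrictScalars ℝ)).fderiv
  rw [dHol, h1]
  simp only [ContinuousLinearMap.comp_apply, ContinuousLinearMap.coe_restrictScalars', single_I,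
    map_smul]
  rw [real_linear_eq_sum _ (fderiv ℂ F z (Pi.single j 1)),
    real_linear_eq_sum _ (Complex.I • fderiv ℂ F z (Pi.single j 1)), Finset.mul_sum,
    ← Finset.sum_sub_distrib, Finset.sum_div]
  refine Finset.sum_congr rfl fun c _ => ?_
  simp only [Pi.smul_apply, smul_eq_mul, map_mul, Complex.conj_I, dHol, single_I]
  have hI : Complex.I ^ 3 = -Complex.I := by rw [pow_succ, Complex.I_sq, neg_one_mul]
  ring_nf
  rw [hI, Complex.I_sq]
  ring

/-- The transformation of `lee` under a change of coordinates with Jacobi matrix `J`. -/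
theorem lee_transform {J P H H' : Matrix (Fin 3) (Fin 3) ℂ} (hJP : J * P = 1)
    {dG dG' K : Fin 3 → Matrix (Fin 3) (Fin 3) ℂ} {l l' : Fin 3 → ℂ}
    (hG : ∀ s, H * dG s = P * H' * (∑ c, J c s • dG' c) * J + P * K s)
    (hK : ∀ s b q, K s b q = K q b s)
    (hl : ∀ q, l q = ∑ c, J c q * l' c + (P * K q).trace) (q : Fin 3) :
    2 * ∑ s, (H * dG s) s q - (H * dG q).trace - l q =
      ∑ c, J c q * (2 * ∑ s, (H' * dG' s) s c - (H' * dG' c).trace - l' c) := by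
  have hPJ : P * J = 1 := mul_eq_one_comm.1 hJP
  have h1 : (H * dG q).trace = ∑ c, J c q * (H' * dG' c).trace + (P * K q).trace := by
    rw [hG, Matrix.trace_add, Matrix.trace_mul_comm, ← mul_assoc, ← mul_assoc, hJP, one_mul,
      Matrix.mul_sum, Matrix.trace_sum]
    simp [Matrix.trace_smul]
  -- K consists of second derivatives of the coordinate change. Its symmetry identifies this sum
  -- with the trace, so the inhomogeneous terms of `lee` occur with coefficients 2 - 1 - 1 = 0.
  have h2 : ∑ s, (P * K s) s q = (P * K q).trace := by
    simp only [Matrix.trace, Matrix.diag_apply, Matrix.mul_apply]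
    exact Finset.sum_congr rfl fun s _ => Finset.sum_congr rfl fun b _ => by rw [hK]
  have h3 : ∑ s, (P * H' * (∑ c, J c s • dG' c) * J) s q =
      ∑ c, J c q * ∑ s, (H' * dG' s) s c := by
    calc _ = ∑ c, (J * (P * (H' * dG' c * J))) c q := by
          have : ∀ s, (P * H' * (∑ c, J c s • dG' c) * J) s q =
              ∑ c, J c s * (P * (H' * dG' c * J)) s q := fun s => by
            rw [Matrix.mul_sum, Matrix.sum_mul, Matrix.sum_apply]
            refine Finset.sum_congr rfl fun c _ => ?_
            rw [Matrix.mul_smul, Matrix.smul_mul, Matrix.smul_apply, smul_eq_mul]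
            simp only [mul_assoc]
          rw [Finset.sum_congr rfl fun s _ => this s, Finset.sum_comm]
          rfl
      _ = ∑ c, (H' * dG' c * J) c q := by
          simp only [← mul_assoc, hJP, one_mul]
      _ = _ := by
          simp only [Matrix.mul_apply (N := J), Finset.mul_sum]
          rw [Finset.sum_comm]
          exact Finset.sum_congr rfl fun _ _ => Finset.sum_congr rfl fun _ _ => mul_comm _ _
  have h4 : ∑ s, (H * dG s) s q = ∑ c, J c q * ∑ s, (H' * dG' s) s c + (P * K q).trace := by
    simp only [hG, Matrix.add_apply, Finset.sum_add_distrib, h2, h3]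
  rw [h1, h4, hl]
  simp only [mul_sub, Finset.sum_sub_distrib, mul_left_comm _ (2 : ℂ), ← Finset.mul_sum]
  ring

end HolomorphicChange

/-! ### Transition maps and the transformation of components -/

section Transition

variable {X : Type*} [TopologicalSpace X] {e e' : OpenPartialHomeomorph X C3}

/-- The domain of the transition map between two charts. -/
def overlap (e e' : OpenPartialHomeomorph X C3) : Set C3 := (e.symm.trans e').source

/-- The transition map between two charts. -/
def transition (e e' : OpenPartialHomeomorph X C3) (z : C3) : C3 := e' (e.symm z)

theorem mem_overlap {z : C3} : z ∈ overlap e e' ↔ z ∈ e.target ∧ e.symm z ∈ e'.source := by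
  simp [overlap]

theorem isOpen_overlap : IsOpen (overlap e e') := (e.symm.trans e').open_source

theorem transition_mem {z : C3} (hz : z ∈ overlap e e') : transition e e' z ∈ e'.target :=
  e'.map_source (mem_overlap.1 hz).2

theorem symm_transition {z : C3} (hz : z ∈ overlap e e') :
    e'.symm (transition e e' z) = e.symm z :=
  e'.left_inv (mem_overlap.1 hz).2

variable [ChartedSpace C3 X] [IsManifold 𝓘(ℂ, C3) ω X]

theorem differentiableAt_transition (he : e ∈ atlas C3 X) (he' : e' ∈ atlas C3 X) {z : C3}
    (hz : z ∈ overlap e e') : DifferentiableAt ℂ (transition e e') z := by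
  rw [← mdifferentiableAt_iff_differentiableAt]
  exact MDifferentiableAt.comp z
    ((mdifferentiable_chart_of_mem_atlas he').mdifferentiableAt (mem_overlap.1 hz).2)
    ((mdifferentiable_chart_of_mem_atlas he).mdifferentiableAt_symm (mem_overlap.1 hz).1)

theorem coordVec_transition (he : e ∈ atlas C3 X) (he' : e' ∈ atlas C3 X) {z : C3}
    (hz : z ∈ overlap e e') (v : C3) : (coordVec e z v : C3) =
      (coordVec e' (transition e e' z) (fderiv ℂ (transition e e') z v) : C3) := by
  have h1 : e.symm =ᶠ[nhds z] e'.symm ∘ transition e e' := by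
    filter_upwards [isOpen_overlap.mem_nhds hz] with w hw using (symm_transition hw).symm
  have h2 := mfderiv_comp (I := 𝓘(ℂ, C3)) (I' := 𝓘(ℂ, C3)) (I'' := 𝓘(ℂ, C3)) z
    ((mdifferentiable_chart_of_mem_atlas he').mdifferentiableAt_symm (transition_mem hz))
    (mdifferentiableAt_iff_differentiableAt.2 (differentiableAt_transition he he' hz))
  have h3 : (mfderiv 𝓘(ℂ, C3) 𝓘(ℂ, C3) e.symm z : C3 →L[ℂ] C3) =
      mfderiv 𝓘(ℂ, C3) 𝓘(ℂ, C3) (e'.symm ∘ transition e e') z := h1.mfderiv_eq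
  have h4 := congrArg (fun L : C3 →L[ℂ] C3 => L v) (h3.trans h2)
  rw [mfderiv_eq_fderiv] at h4
  exact h4

/-- The Jacobi matrix of the transition map. -/
def jacobi (e e' : OpenPartialHomeomorph X C3) (z : C3) : Matrix (Fin 3) (Fin 3) ℂ :=
  Matrix.of fun a s => fderiv ℂ (transition e e') z (Pi.single s 1) a

theorem HermitianMetric.coeff_transition (g : HermitianMetric X) (he : e ∈ atlas C3 X)
    (he' : e' ∈ atlas C3 X) {z : C3} (hz : z ∈ overlap e e') (k j : Fin 3) :
    g.coeff e z k j = ∑ a, ∑ b, conj (jacobi e e' z a k) *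
      (g.coeff e' (transition e e' z) a b * jacobi e e' z b j) := by
  obtain ⟨F, hF⟩ : ∃ F : X → C3 → C3 → ℂ, ∀ x u v, F x u v = g.inner x u v := ⟨_, fun _ _ _ => rfl⟩
  have h2 := g.inner_coordVec e' (transition e e' z)
    (fderiv ℂ (transition e e') z (Pi.single k 1)) (fderiv ℂ (transition e e') z (Pi.single j 1))
  have h3 : g.coeff e z k j = F (e.symm z) (coordVec e z (Pi.single k 1))
    (coordVec e z (Pi.single j 1)) := (hF _ _ _).symm
  rw [h3, coordVec_transition he he' hz, coordVec_transition he he' hz, ← symm_transition hz]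
  refine (hF _ _ _).trans ?_
  simp only [← mul_assoc]
  exact h2

theorem HolVolumeForm.coeff_transition (Ω : HolVolumeForm X) (he : e ∈ atlas C3 X)
    (he' : e' ∈ atlas C3 X) {z : C3} (hz : z ∈ overlap e e') :
    Ω.coeff e z = (jacobi e e' z).det * Ω.coeff e' (transition e e' z) := by
  obtain ⟨F, hF⟩ : ∃ F : X → (Fin 3 → C3) → ℂ, ∀ x u, F x u = Ω.form x u := ⟨_, fun _ _ => rfl⟩
  have h3 : Ω.coeff e z = F (e.symm z) (fun i => coordVec e z (Pi.single i 1)) := (hF _ _).symm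
  have h6 : (fun i : Fin 3 => (coordVec e z (Pi.single i 1) : C3)) = fun i =>
      (coordVec e' (transition e e' z) (fderiv ℂ (transition e e') z (Pi.single i 1)) : C3) :=
    funext fun i => coordVec_transition he he' hz _
  rw [h3, h6, ← symm_transition hz]
  refine (hF _ _).trans ?_
  let L : C3 →ₗ[ℂ] TangentSpace 𝓘(ℂ, C3) (e'.symm (transition e e' z)) :=
    (mfderiv 𝓘(ℂ, C3) 𝓘(ℂ, C3) e'.symm (transition e e' z)).toLinearMap
  have h4 := congrArg (fun F : C3 [⋀^Fin 3]→ₗ[ℂ] ℂ =>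
      F (fun i => fderiv ℂ (transition e e') z (Pi.single i 1)))
    (AlternatingMap.eq_smul_basis_det (Pi.basisFun ℂ (Fin 3))
      ((Ω.form (e'.symm (transition e e' z))).compLinearMap L))
  simp only [AlternatingMap.smul_apply, smul_eq_mul, Pi.basisFun_det_apply] at h4
  rw [← Matrix.det_transpose, mul_comm]
  have h5 : (Pi.basisFun ℂ (Fin 3) : Fin 3 → C3) = fun i => Pi.single i 1 := by
    ext i; simp
  rw [h5] at h4
  exact h4

end Transition

theorem dHol_det {M : C3 → Matrix (Fin 3) (Fin 3) ℂ} {z : C3}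
    (h : ∀ i j, DifferentiableAt ℝ (fun w => M w i j) z) (q : Fin 3) :
    dHol q (fun w => (M w).det) z =
      ((M z).adjugate * Matrix.of fun i j => dHol q (fun w => M w i j) z).trace := by
  have e : ∀ (L : C3 → ℂ), fderiv ℝ L z (Pi.single q 1) -
      Complex.I * fderiv ℝ L z (Pi.single q Complex.I) = 2 * dHol q L z := fun L => by
    rw [dHol]; ring
  rw [dHol]
  simp only [Matrix.det_fin_three]
  have h00 := h 0 0
  have h01 := h 0 1
  have h02 := h 0 2
  have h10 := h 1 0
  have h11 := h 1 1
  have h12 := h 1 2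
  have h20 := h 2 0
  have h21 := h 2 1
  have h22 := h 2 2
  simp (disch := fun_prop) only [fderiv_fun_sub, fderiv_fun_add, fderiv_fun_mul, sub_apply, add_apply,
    smul_apply, smul_eq_mul]
  simp only [Matrix.trace, Matrix.diag_apply, Matrix.mul_apply, Fin.sum_univ_three,
    Matrix.adjugate_fin_three, Matrix.of_apply, Matrix.cons_val', Matrix.cons_val_zero,
    Matrix.cons_val_one, Matrix.cons_val, dHol]
  ring

/-! ### Chart independence of |θ|² -/

section LeeInvariance

open SmoothAlg

variable {X : Type*} [TopologicalSpace X] [ChartedSpace C3 X] [IsManifold 𝓘(ℂ, C3) ω X]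
  {e e' : OpenPartialHomeomorph X C3}

theorem jacobi_apply (he : e ∈ atlas C3 X) (he' : e' ∈ atlas C3 X) {z : C3}
    (hz : z ∈ overlap e e') (a s : Fin 3) : jacobi e e' z a s =
      fderiv ℂ (fun w => transition e e' w a) z (Pi.single s 1) := by
  rw [(hasFDerivAt_pi'.1 (differentiableAt_transition he he' hz).hasFDerivAt a).fderiv]
  rfl

theorem differentiableOn_transition_apply (he : e ∈ atlas C3 X) (he' : e' ∈ atlas C3 X)
    (a : Fin 3) : DifferentiableOn ℂ (fun w => transition e e' w a) (overlap e e') := fun _ hw =>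
  (differentiableAt_pi.1 (differentiableAt_transition he he' hw) a).differentiableWithinAt

theorem differentiableAt_jacobi (he : e ∈ atlas C3 X) (he' : e' ∈ atlas C3 X) {z : C3}
    (hz : z ∈ overlap e e') (a s : Fin 3) : DifferentiableAt ℂ (fun w => jacobi e e' w a s) z :=
  ((differentiableOn_fderiv_apply isOpen_overlap (differentiableOn_transition_apply he he' a)
    (Pi.single s 1)).congr fun _ hw => jacobi_apply he he' hw a s).differentiableAt
      (isOpen_overlap.mem_nhds hz)

/-- Expressing derivatives of the Jacobi matrix as second derivatives of the transition map makes
their symmetry available; this is what `lee_transform` requires. -/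
theorem dHol_jacobi (he : e ∈ atlas C3 X) (he' : e' ∈ atlas C3 X) {z : C3}
    (hz : z ∈ overlap e e') (s a q : Fin 3) : dHol s (fun w => jacobi e e' w a q) z =
      fderiv ℂ (fderiv ℂ fun w => transition e e' w a) z (Pi.single s 1) (Pi.single q 1) := by
  have hc : ContDiffAt ℂ 2 (fun w => transition e e' w a) z :=
    (contDiffOn_of_differentiableOn isOpen_overlap 2
      (differentiableOn_transition_apply he he' a)).contDiffAt (isOpen_overlap.mem_nhds hz)
  have hd : DifferentiableAt ℂ (fderiv ℂ fun w => transition e e' w a) z :=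
    (hc.fderiv_right (m := 1) (by norm_num)).differentiableAt (by norm_num)
  rw [dHol_of_holomorphic (differentiableAt_jacobi he he' hz a q)]
  have h1 : (fun w => jacobi e e' w a q) =ᶠ[nhds z]
      fun w => fderiv ℂ (fun w => transition e e' w a) w (Pi.single q 1) := by
    filter_upwards [isOpen_overlap.mem_nhds hz] with w hw using jacobi_apply he he' hw a q
  rw [h1.fderiv_eq, fderiv_clm_apply hd (differentiableAt_const _)]
  simp

theorem dHol_jacobi_symm (he : e ∈ atlas C3 X) (he' : e' ∈ atlas C3 X) {z : C3}
    (hz : z ∈ overlap e e') (s a q : Fin 3) : dHol s (fun w => jacobi e e' w a q) z =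
      dHol q (fun w => jacobi e e' w a s) z := by
  have hc : ContDiffAt ℂ 2 (fun w => transition e e' w a) z :=
    (contDiffOn_of_differentiableOn isOpen_overlap 2
      (differentiableOn_transition_apply he he' a)).contDiffAt (isOpen_overlap.mem_nhds hz)
  rw [dHol_jacobi he he' hz, dHol_jacobi he he' hz]
  exact hc.isSymmSndFDerivAt (by simp) _ _

variable (Ω : HolVolumeForm X) {T : ℝ} {g : ℝ → HermitianMetric X} (hg : IsSmoothFamily T g)

theorem eval_lee_eq (he : e ∈ atlas C3 X) {t : ℝ} (ht : t ∈ Ico 0 T) {z : C3} (hz : z ∈ e.target)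
    (q : Fin 3) : eval (slabPt ht hz) ((chartData Ω hg he).lee q) =
      2 * ∑ s, (((g t).coeff e z)⁻¹ *
          Matrix.of fun r q => dHol s (fun w => (g t).coeff e w r q) z) s q -
        (((g t).coeff e z)⁻¹ * Matrix.of fun r s => dHol q (fun w => (g t).coeff e w r s) z).trace -
        dHol q (Ω.coeff e) z / Ω.coeff e z := by
  have h1 : ∀ s r q, dHol s (fun w => (g t).coeff e w r q) z =
      eval (slabPt ht hz) ((slabWirtinger T e.open_target).D s ((chartData Ω hg he).G r q)) :=
    fun s r q => dHol_eq_eval e.open_target _ ht hz (fun w hw => (eval_G Ω hg he ht hw r q).symm) s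
  have h2 : dHol q (Ω.coeff e) z =
      eval (slabPt ht hz) ((slabWirtinger T e.open_target).D q (chartData Ω hg he).f) :=
    dHol_eq_eval e.open_target _ ht hz (fun w hw => rfl) q
  have h3 : eval (slabPt ht hz) (chartData Ω hg he).fi = (Ω.coeff e z)⁻¹ := by
    have := congrArg (eval (slabPt ht hz)) (chartData Ω hg he).f_fi
    rw [map_mul, map_one] at this
    exact eq_inv_of_mul_eq_one_right this
  simp only [HermitianData.lee, HermitianData.ell, map_sub, map_mul, map_sum, map_ofNat,
    Matrix.trace, Matrix.diag_apply, Matrix.mul_apply, Matrix.of_apply, h1, h2, h3, eval_H,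
    div_eq_mul_inv]

variable {t : ℝ} {z : C3}

include hg in
theorem dHol_coeff_transition (he : e ∈ atlas C3 X) (he' : e' ∈ atlas C3 X) (ht : t ∈ Ico 0 T)
    (hz : z ∈ overlap e e') (s r q : Fin 3) : dHol s (fun w => (g t).coeff e w r q) z =
      ∑ a, ∑ b, conj (jacobi e e' z a r) *
        ((g t).coeff e' (transition e e' z) a b * dHol s (fun w => jacobi e e' w b q) z +
          (∑ c, dHol c (fun w => (g t).coeff e' w a b) (transition e e' z) * jacobi e e' z c s) *
            jacobi e e' z b q) := by
  have h1 : (fun w => (g t).coeff e w r q) =ᶠ[nhds z] fun w => ∑ a, ∑ b, conj (jacobi e e' w a r) *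
      ((g t).coeff e' (transition e e' w) a b * jacobi e e' w b q) := by
    filter_upwards [isOpen_overlap.mem_nhds hz] with w hw
      using (g t).coeff_transition he he' hw r q
  have hF := differentiableAt_transition he he' hz
  have hJ := fun a s => (differentiableAt_jacobi he he' hz a s)
  have hJ' := fun a s => (hJ a s).restrictScalars ℝ
  have hc := fun a s => differentiableAt_conj (hJ' a s)
  have hG : ∀ a b, DifferentiableAt ℝ (fun w => (g t).coeff e' w a b) (transition e e' z) :=
    fun a b => (hasFDerivAt_slice e'.open_target (metricAlg hg he' a b) ht (transition_mem hz)
      (fun w hw => rfl)).differentiableAt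
  have hGF : ∀ a b, DifferentiableAt ℝ (fun w => (g t).coeff e' (transition e e' w) a b) z :=
    fun a b => (hG a b).comp z (hF.restrictScalars ℝ)
  rw [dHol_congr h1, dHol_sum _ fun a => DifferentiableAt.fun_sum fun b _ =>
    (hc a r).fun_mul ((hGF a b).fun_mul (hJ' b q))]
  refine Finset.sum_congr rfl fun a _ => ?_
  rw [dHol_sum _ fun b => (hc a r).fun_mul ((hGF a b).fun_mul (hJ' b q))]
  refine Finset.sum_congr rfl fun b _ => ?_
  rw [dHol_mul (hc a r) ((hGF a b).fun_mul (hJ' b q)), dHol_conj_of_holomorphic (hJ a r),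
    dHol_mul (hGF a b) (hJ' b q), dHol_comp (hG a b) hF]
  simp only [zero_mul, add_zero]
  rfl

theorem dHol_volCoeff_transition (he : e ∈ atlas C3 X) (he' : e' ∈ atlas C3 X)
    (hz : z ∈ overlap e e') (q : Fin 3) : dHol q (Ω.coeff e) z / Ω.coeff e z =
      ∑ c, jacobi e e' z c q * (dHol c (Ω.coeff e') (transition e e' z) /
        Ω.coeff e' (transition e e' z)) +
      ((jacobi e e' z)⁻¹ * Matrix.of fun a s => dHol q (fun w => jacobi e e' w a s) z).trace := by
  have h1 : Ω.coeff e =ᶠ[nhds z] fun w => (jacobi e e' w).det * Ω.coeff e' (transition e e' w) := by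
    filter_upwards [isOpen_overlap.mem_nhds hz] with w hw using Ω.coeff_transition he he' hw
  have hF := differentiableAt_transition he he' hz
  have hJ' := fun a s => (differentiableAt_jacobi he he' hz a s).restrictScalars ℝ
  have hdet : DifferentiableAt ℝ (fun w => (jacobi e e' w).det) z := by
    simp only [Matrix.det_fin_three]
    have h00 := hJ' 0 0
    have h01 := hJ' 0 1
    have h02 := hJ' 0 2
    have h10 := hJ' 1 0
    have h11 := hJ' 1 1
    have h12 := hJ' 1 2
    have h20 := hJ' 2 0
    have h21 := hJ' 2 1
    have h22 := hJ' 2 2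
    fun_prop
  have hf : DifferentiableAt ℝ (Ω.coeff e') (transition e e' z) :=
    (((Ω.holomorphic e' he') _ (transition_mem hz)).differentiableAt
      (e'.open_target.mem_nhds (transition_mem hz))).restrictScalars ℝ
  have hz1 := Ω.coeff_transition he he' hz
  have hne := Ω.coeff_ne_zero he (mem_overlap.1 hz).1
  have hne' := Ω.coeff_ne_zero he' (transition_mem hz)
  have hJne : (jacobi e e' z).det ≠ 0 := fun h => hne (by rw [hz1, h, zero_mul])
  have hfF : DifferentiableAt ℝ (fun w => Ω.coeff e' (transition e e' w)) z :=
    hf.comp z (hF.restrictScalars ℝ)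
  rw [dHol_congr h1, dHol_mul hdet hfF, dHol_comp hf hF, dHol_det hJ',
    hz1, Matrix.inv_def, Ring.inverse_eq_inv', Matrix.smul_mul, Matrix.trace_smul, smul_eq_mul]
  have e1 : ∑ c, jacobi e e' z c q * (dHol c (Ω.coeff e') (transition e e' z) /
        Ω.coeff e' (transition e e' z)) = (∑ c, dHol c (Ω.coeff e') (transition e e' z) *
        fderiv ℂ (transition e e') z (Pi.single q 1) c) / Ω.coeff e' (transition e e' z) := by
    rw [Finset.sum_div]
    exact Finset.sum_congr rfl fun c _ => by
      rw [jacobi, Matrix.of_apply]; ring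
  rw [e1]
  field_simp

theorem HermitianMetric.coeff_transition_mul (g : HermitianMetric X) (he : e ∈ atlas C3 X)
    (he' : e' ∈ atlas C3 X) (hz : z ∈ overlap e e') : g.coeff e z =
      (jacobi e e' z).conjTranspose * (g.coeff e' (transition e e' z) * jacobi e e' z) := by
  ext r q
  rw [g.coeff_transition he he' hz]
  simp only [Matrix.mul_apply, Finset.mul_sum, Matrix.conjTranspose_apply]
  rfl

theorem isUnit_det_jacobi (g : HermitianMetric X) (he : e ∈ atlas C3 X) (he' : e' ∈ atlas C3 X)
    (hz : z ∈ overlap e e') : IsUnit (jacobi e e' z).det := by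
  have h := (g.det_coeff_pos he (mem_overlap.1 hz).1)
  rw [isUnit_iff_ne_zero]
  intro h0
  rw [g.coeff_transition_mul he he' hz, Matrix.det_mul, Matrix.det_mul, h0] at h
  simp at h

theorem HermitianMetric.isUnit_det_coeff (g : HermitianMetric X) (he : e ∈ atlas C3 X)
    (hz : z ∈ e.target) : IsUnit (g.coeff e z).det := by
  rw [(g.det_coeff_pos he hz).2]
  exact (Complex.ofReal_ne_zero.2 (g.det_coeff_pos he hz).1.ne').isUnit

/-- From g = J*g'J. It removes the conjugate Jacobi matrix from g⁻¹∂g, so that the first-order terms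
transform through J alone. -/
theorem inv_coeff_mul_conjTranspose (g : HermitianMetric X) (he : e ∈ atlas C3 X)
    (he' : e' ∈ atlas C3 X) (hz : z ∈ overlap e e') :
    (g.coeff e z)⁻¹ * (jacobi e e' z).conjTranspose =
      (jacobi e e' z)⁻¹ * (g.coeff e' (transition e e' z))⁻¹ := by
  have hJ := isUnit_det_jacobi g he he' hz
  have h1 := Matrix.nonsing_inv_mul _ (g.isUnit_det_coeff he (mem_overlap.1 hz).1)
  have h2 := Matrix.mul_nonsing_inv _ (g.isUnit_det_coeff he' (transition_mem hz))
  have h3 := congrArg (fun M => (g.coeff e z)⁻¹ * M) (g.coeff_transition_mul he he' hz)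
  simp only [h1] at h3
  calc _ = (g.coeff e z)⁻¹ * ((jacobi e e' z).conjTranspose *
        (g.coeff e' (transition e e' z) * (jacobi e e' z * (jacobi e e' z)⁻¹) *
          (g.coeff e' (transition e e' z))⁻¹)) := by
        rw [Matrix.mul_nonsing_inv _ hJ, mul_one, h2, mul_one]
    _ = (g.coeff e z)⁻¹ * ((jacobi e e' z).conjTranspose *
        (g.coeff e' (transition e e' z) * jacobi e e' z)) *
          ((jacobi e e' z)⁻¹ * (g.coeff e' (transition e e' z))⁻¹) := by
        simp only [mul_assoc]
    _ = _ := by rw [← h3, one_mul]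

/-- `lee` transforms as a `(1,0)`-form. -/
theorem eval_lee_transition (he : e ∈ atlas C3 X) (he' : e' ∈ atlas C3 X) (ht : t ∈ Ico 0 T)
    (hz : z ∈ overlap e e') (q : Fin 3) :
    eval (slabPt ht (mem_overlap.1 hz).1) ((chartData Ω hg he).lee q) = ∑ c, jacobi e e' z c q *
      eval (slabPt ht (transition_mem hz)) ((chartData Ω hg he').lee c) := by
  simp only [eval_lee_eq]
  have hJ := isUnit_det_jacobi (g t) he he' hz
  have hG' := (g t).isUnit_det_coeff he' (transition_mem hz)
  refine lee_transform (P := (jacobi e e' z)⁻¹)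
    (K := fun s => Matrix.of fun b q => dHol s (fun w => jacobi e e' w b q) z)
    (dG := fun s => Matrix.of fun r q => dHol s (fun w => (g t).coeff e w r q) z)
    (dG' := fun s => Matrix.of fun r q => dHol s (fun w => (g t).coeff e' w r q)
      (transition e e' z))
    (l := fun q => dHol q (Ω.coeff e) z / Ω.coeff e z)
    (l' := fun c => dHol c (Ω.coeff e') (transition e e' z) / Ω.coeff e' (transition e e' z))
    (Matrix.mul_nonsing_inv _ hJ) (fun s => ?_) (fun s b q => dHol_jacobi_symm he he' hz s b q)
    (fun q => dHol_volCoeff_transition Ω he he' hz q) q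
  have h1 : (Matrix.of fun r q => dHol s (fun w => (g t).coeff e w r q) z) =
      (jacobi e e' z).conjTranspose * ((g t).coeff e' (transition e e' z) *
        (Matrix.of fun b q => dHol s (fun w => jacobi e e' w b q) z) +
        (∑ c, jacobi e e' z c s • Matrix.of fun r q => dHol c (fun w => (g t).coeff e' w r q)
          (transition e e' z)) * jacobi e e' z) := by
    ext r q
    rw [Matrix.of_apply, dHol_coeff_transition hg he he' ht hz, Matrix.mul_apply]
    refine Finset.sum_congr rfl fun a _ => ?_
    rw [Matrix.add_apply, Matrix.mul_apply, Matrix.mul_apply, ← Finset.sum_add_distrib,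
      Finset.mul_sum]
    refine Finset.sum_congr rfl fun b _ => ?_
    rw [Matrix.sum_apply]
    simp only [Matrix.smul_apply, Matrix.of_apply, smul_eq_mul, mul_comm (jacobi e e' z _ s)]
    rfl
  rw [h1, ← mul_assoc, inv_coeff_mul_conjTranspose (g t) he he' hz, mul_add, ← mul_assoc,
    mul_assoc (jacobi e e' z)⁻¹ _ ((g t).coeff e' _), Matrix.nonsing_inv_mul _ hG', mul_one,
    ← mul_assoc, add_comm]

/-- The squared norm of `lee` does not depend on the chart. -/
theorem eval_leeNormSq_transition (he : e ∈ atlas C3 X) (he' : e' ∈ atlas C3 X) (ht : t ∈ Ico 0 T)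
    (hz : z ∈ overlap e e') :
    eval (slabPt ht (mem_overlap.1 hz).1) (chartData Ω hg he).leeNormSq =
      eval (slabPt ht (transition_mem hz)) (chartData Ω hg he').leeNormSq := by
  have hJ := isUnit_det_jacobi (g t) he he' hz
  have h1 : ((g t).coeff e' (transition e e' z))⁻¹ =
      jacobi e e' z * ((g t).coeff e z)⁻¹ * (jacobi e e' z).conjTranspose := by
    rw [mul_assoc, inv_coeff_mul_conjTranspose (g t) he he' hz, ← mul_assoc,
      Matrix.mul_nonsing_inv _ hJ, one_mul]
  have h2 : ∀ c d, ((g t).coeff e' (transition e e' z))⁻¹ c d = ∑ k, (∑ j, jacobi e e' z c j *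
      ((g t).coeff e z)⁻¹ j k) * conj (jacobi e e' z d k) := fun c d => by
    rw [h1]; rfl
  have hc : ∀ {e : OpenPartialHomeomorph X C3} (he : e ∈ atlas C3 X) {z : C3} (hz : z ∈ e.target) k,
      eval (slabPt ht hz) ((chartData Ω hg he).leeConj k) =
        conj (eval (slabPt ht hz) ((chartData Ω hg he).lee k)) := by intros; rfl
  simp only [HermitianData.leeNormSq, map_mul, hc, eval_H,
    eval_lee_transition Ω hg he he' ht hz, h2, Fin.sum_univ_three, map_add]
  ring

end LeeInvariance

/-! ### The maximum principle -/

/-- The maximum lies at the right end, so moving towards a cannot increase f; the admissible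
direction a - b is negative. -/
theorem derivative_nonneg_of_le_right_endpoint {f : ℝ → ℝ} {f' a b : ℝ} (hab : a < b)
    (hf : HasDerivWithinAt f f' (Icc a b) b) (hmax : ∀ s ∈ Icc a b, f s ≤ f b) : 0 ≤ f' := by
  have h1 : IsLocalMaxOn f (Icc a b) b := by
    filter_upwards [self_mem_nhdsWithin] with s hs using hmax s hs
  have h2 := h1.hasFDerivWithinAt_nonpos hf.hasFDerivWithinAt
    (sub_mem_posTangentConeAt_of_segment_subset (y := a)
      ((convex_Icc a b).segment_subset (right_mem_Icc.2 hab.le) (left_mem_Icc.2 hab.le)))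
  simp only [ContinuousLinearMap.toSpanSingleton_apply, smul_eq_mul] at h2
  by_contra! h3
  nlinarith

section MaximumPrinciple

open SmoothAlg

variable {X : Type*} [TopologicalSpace X] [ChartedSpace C3 X] {T : ℝ}

/-- Smooth functions on the charts of space-time that define a function on space-time. -/
def IsGlobal (u : ∀ e ∈ atlas C3 X, SmoothAlg (slab T e.target)) : Prop :=
  ∀ (e e' : OpenPartialHomeomorph X C3) (he : e ∈ atlas C3 X) (he' : e' ∈ atlas C3 X) (t : ℝ)
    (ht : t ∈ Ico 0 T) (x : X) (hx : x ∈ e.source) (hx' : x ∈ e'.source),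
    eval (slabPt ht (e.map_source hx)) (u e he) = eval (slabPt ht (e'.map_source hx')) (u e' he')

/-- The real part of the function on space-time defined by functions on charts. -/
def density (u : ∀ e ∈ atlas C3 X, SmoothAlg (slab T e.target)) (t : ℝ) (x : X) : ℝ :=
  (fn (u (chartAt C3 x) (chart_mem_atlas C3 x)) (t, chartAt C3 x x)).re

variable {u n w : ∀ e ∈ atlas C3 X, SmoothAlg (slab T e.target)} (hu : IsGlobal u)

theorem density_eq_eval (u : ∀ e ∈ atlas C3 X, SmoothAlg (slab T e.target)) {t : ℝ}
    (ht : t ∈ Ico 0 T) (x : X) : density u t x =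
      (eval (slabPt ht ((chartAt C3 x).map_source (mem_chart_source C3 x)))
        (u _ (chart_mem_atlas C3 x))).re :=
  congrArg Complex.re (fn_of_mem (S := slab T (chartAt C3 x).target) _ _)

include hu

theorem IsGlobal.density_eq {e : OpenPartialHomeomorph X C3} (he : e ∈ atlas C3 X) {t : ℝ}
    (ht : t ∈ Ico 0 T) {x : X} (hx : x ∈ e.source) :
    density u t x = (fn (u e he) (t, e x)).re := by
  rw [density_eq_eval u ht, fn_of_mem (S := slab T e.target) (u e he) ⟨ht, e.map_source hx⟩]
  exact congrArg Complex.re (hu _ _ _ he t ht x (mem_chart_source C3 x) hx)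

theorem IsGlobal.density_symm {e : OpenPartialHomeomorph X C3} (he : e ∈ atlas C3 X) {t : ℝ}
    (ht : t ∈ Ico 0 T) {z : C3} (hz : z ∈ e.target) :
    density u t (e.symm z) = (fn (u e he) (t, z)).re := by
  rw [hu.density_eq he ht (e.map_target hz), e.right_inv hz]

theorem IsGlobal.continuousOn_density {t : ℝ} (ht : t < T) :
    ContinuousOn (fun p : ℝ × X => density u p.1 p.2) (Icc 0 t ×ˢ univ) := by
  rintro ⟨s, x⟩ ⟨hs, -⟩
  have hs' : ∀ s ∈ Icc 0 t, s ∈ Ico 0 T := fun s hs => ⟨hs.1, hs.2.trans_lt ht⟩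
  obtain ⟨e, he, hx⟩ : ∃ e ∈ atlas C3 X, x ∈ e.source :=
    ⟨_, chart_mem_atlas C3 x, mem_chart_source C3 x⟩
  have hsrc : ∀ᶠ p : ℝ × X in nhds (s, x), p.2 ∈ e.source :=
    continuousAt_snd.eventually_mem (e.open_source.mem_nhds hx)
  have h0 : ContinuousAt (fun p : ℝ × X => e p.2) (s, x) :=
    ContinuousAt.comp (f := Prod.snd) (e.continuousAt hx) continuousAt_snd
  have h1 : ContinuousWithinAt (fun p : ℝ × X => (p.1, e p.2))
      ((Icc 0 t ×ˢ univ) ∩ {p | p.2 ∈ e.source}) (s, x) :=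
    (continuousAt_fst.prodMk h0).continuousWithinAt
  have h2 : ContinuousWithinAt (fun q => (fn (u e he) q).re) (slab T e.target) (s, e x) :=
    Complex.continuous_re.continuousAt.comp_continuousWithinAt
      ((contDiffOn_fn (u e he)).continuousOn _ ⟨hs' s hs, e.map_source hx⟩)
  have hm : MapsTo (fun p : ℝ × X => (p.1, e p.2)) ((Icc 0 t ×ˢ univ) ∩ {p | p.2 ∈ e.source})
      (slab T e.target) := fun p hp => ⟨hs' _ hp.1.1, e.map_source hp.2⟩
  have h3 : ContinuousWithinAt (fun p : ℝ × X => (fn (u e he) (p.1, e p.2)).re)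
      ((Icc 0 t ×ˢ univ) ∩ {p | p.2 ∈ e.source}) (s, x) :=
    ContinuousWithinAt.comp (f := fun p : ℝ × X => (p.1, e p.2)) (x := (s, x))
      (g := fun q => (fn (u e he) q).re) h2 h1 hm
  exact (continuousWithinAt_inter hsrc).1 (h3.congr
    (fun p hp => hu.density_eq he (hs' _ hp.1.1) hp.2) (hu.density_eq he (hs' s hs) hx))

omit hu

/-- The differential inequality `2n ∂ₜu - w ≤ 2Mnu` at a point of space-time, in some chart. -/
def ParabolicBound (u n w : ∀ e ∈ atlas C3 X, SmoothAlg (slab T e.target)) (M : ℝ) (p : ℝ × X) :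
    Prop :=
  ∃ (e : OpenPartialHomeomorph X C3) (he : e ∈ atlas C3 X) (ht : p.1 ∈ Ico 0 T)
    (hx : p.2 ∈ e.source),
    (eval (slabPt ht (e.map_source hx)) (2 * n e he * (slabWirtinger T e.open_target).dt (u e he) -
        w e he)).re ≤
      M * (2 * (eval (slabPt ht (e.map_source hx)) (n e he)).re *
        (eval (slabPt ht (e.map_source hx)) (u e he)).re)

variable (hn : ∀ e he p, 0 < (eval p (n e he)).re) (hnn : ∀ e he p, 0 ≤ (eval p (u e he)).re)

include hn hnn

theorem ParabolicBound.mono {M M' : ℝ} (hM : M ≤ M') {p : ℝ × X} (h : ParabolicBound u n w M p) :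
    ParabolicBound u n w M' p := by
  obtain ⟨e, he, ht, hx, h⟩ := h
  exact ⟨e, he, ht, hx, h.trans (mul_le_mul_of_nonneg_right hM
    (mul_nonneg (mul_pos two_pos (hn e he _)).le (hnn e he _)))⟩

variable [CompactSpace X] (hb : ∀ e he, ∃ C : slab T e.target → ℝ, Continuous C ∧ ∀ p,
  (eval p (2 * n e he * (slabWirtinger T e.open_target).dt (u e he) - w e he)).re ≤
    C p * (eval p (u e he)).re)

include hb

/-- Near each point a single chart works, and there C/(2n) is continuous, so it stays below its
value at the point plus one. Compactness of [0,t] × X makes the constant uniform; nonnegativity of u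
allows it to be enlarged. -/
theorem exists_parabolicBound {t : ℝ} (ht : t < T) :
    ∃ M, ∀ p ∈ Icc 0 t ×ˢ (univ : Set X), ParabolicBound u n w M p := by
  have hK : IsCompact (Icc 0 t ×ˢ (univ : Set X)) := isCompact_Icc.prod isCompact_univ
  refine hK.induction_on (p := fun S => ∃ M, ∀ p ∈ S, ParabolicBound u n w M p) ⟨0, by simp⟩
    (fun S S' hS ⟨M, hM⟩ => ⟨M, fun p hp => hM p (hS hp)⟩) ?_ ?_
  · rintro S S' ⟨M, hM⟩ ⟨M', hM'⟩
    exact ⟨max M M', fun p hp => hp.elim (fun h => (hM p h).mono hn hnn (le_max_left _ _))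
      (fun h => (hM' p h).mono hn hnn (le_max_right _ _))⟩
  · rintro ⟨s, x⟩ ⟨hs, -⟩
    have hs' : s ∈ Ico 0 T := ⟨hs.1, hs.2.trans_lt ht⟩
    obtain ⟨e, he, hx⟩ : ∃ e ∈ atlas C3 X, x ∈ e.source :=
      ⟨_, chart_mem_atlas C3 x, mem_chart_source C3 x⟩
    obtain ⟨C, hC, hb⟩ := hb e he
    obtain ⟨F, hF⟩ : ∃ F : slab T e.target → ℝ, F = fun q => C q / (2 * (eval q (n e he)).re) :=
      ⟨_, rfl⟩
    have hFc : Continuous F := hF ▸ hC.div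
      (continuous_const.mul (Complex.continuous_re.comp (continuous_eval _)))
      fun q => (mul_pos two_pos (hn e he q)).ne'
    obtain ⟨K, hK⟩ : ∃ K, K = F (slabPt hs' (e.map_source hx)) + 1 := ⟨_, rfl⟩
    have hopen : IsOpen {q | F q < K} := isOpen_lt hFc continuous_const
    obtain ⟨O, hO, hOF⟩ := isOpen_induced_iff.1 hopen
    have hmem : (s, e x) ∈ O := by
      have : slabPt hs' (e.map_source hx) ∈ Subtype.val ⁻¹' O := by
        rw [hOF, mem_ofPred_eq, hK]; exact lt_add_one (F _)
      exact this
    have h0 : ContinuousAt (fun p : ℝ × X => e p.2) (s, x) :=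
      ContinuousAt.comp (f := Prod.snd) (e.continuousAt hx) continuousAt_snd
    have hcont : ContinuousAt (fun p : ℝ × X => (p.1, e p.2)) (s, x) := continuousAt_fst.prodMk h0
    refine ⟨_, Filter.inter_mem self_mem_nhdsWithin (mem_nhdsWithin_of_mem_nhds (Filter.inter_mem
      (hcont.eventually_mem (hO.mem_nhds hmem))
      (continuousAt_snd.eventually_mem (e.open_source.mem_nhds hx)))), K, ?_⟩
    rintro ⟨s', y⟩ ⟨⟨hs1, -⟩, h1, hy⟩
    have hs2 : s' ∈ Ico 0 T := ⟨hs1.1, hs1.2.trans_lt ht⟩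
    refine ⟨e, he, hs2, hy, (hb _).trans ?_⟩
    have hlt : F (slabPt hs2 (e.map_source hy)) < K := by
      have : slabPt hs2 (e.map_source hy) ∈ Subtype.val ⁻¹' O := h1
      rw [hOF] at this
      exact this
    have hn' := hn e he (slabPt hs2 (e.map_source hy))
    have hCF : C (slabPt hs2 (e.map_source hy)) = F (slabPt hs2 (e.map_source hy)) *
        (2 * (eval (slabPt hs2 (e.map_source hy)) (n e he)).re) := by
      rw [hF, div_mul_cancel₀ _ (mul_pos two_pos hn').ne']
    rw [hCF, mul_assoc]
    exact mul_le_mul_of_nonneg_right hlt.le (mul_nonneg (mul_pos two_pos hn').le (hnn e he _))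

include hu in
/-- The maximum principle: a subsolution on a compact manifold that vanishes initially is never
positive. -/
theorem IsGlobal.density_nonpos (hni : ∀ e he p, (eval p (n e he)).im = 0)
    (hlap : ∀ e he t (ht : t ∈ Ico 0 T) z (hz : z ∈ e.target),
      IsLocalMax (fun v => (fn (u e he) (t, v)).re) z → (eval (slabPt ht hz) (w e he)).re ≤ 0)
    (hini : ∀ x, density u 0 x = 0) {t : ℝ} (ht : t ∈ Ico 0 T) (x : X) : density u t x ≤ 0 := by
  by_contra! hpos
  obtain ⟨M, hM⟩ := exists_parabolicBound hn hnn hb ht.2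
  have hK : IsCompact (Icc 0 t ×ˢ (univ : Set X)) := isCompact_Icc.prod isCompact_univ
  -- The weight exp(-(M+1)s) exceeds the rate M of the differential inequality by one, which makes
  -- the contradiction strict.
  have hcont : ContinuousOn (fun p : ℝ × X => Real.exp (-(M + 1) * p.1) * density u p.1 p.2)
      (Icc 0 t ×ˢ univ) :=
    ContinuousOn.mul (by fun_prop) (hu.continuousOn_density ht.2)
  have htx : (t, x) ∈ Icc 0 t ×ˢ (univ : Set X) := ⟨right_mem_Icc.2 ht.1, mem_univ _⟩
  obtain ⟨⟨s, y⟩, hp, hmax'⟩ := hK.exists_isMaxOn ⟨_, htx⟩ hcont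
  have hmax : ∀ s' ∈ Icc 0 t, ∀ y', Real.exp (-(M + 1) * s') * density u s' y' ≤
      Real.exp (-(M + 1) * s) * density u s y :=
    fun s' hs' y' => hmax' (show (s', y') ∈ Icc 0 t ×ˢ (univ : Set X) from ⟨hs', mem_univ _⟩)
  have hs : s ∈ Icc 0 t := hp.1
  have hup : 0 < density u s y :=
    (mul_pos_iff_of_pos_left (Real.exp_pos _)).1
      ((mul_pos (Real.exp_pos _) hpos).trans_le (hmax t htx.1 x))
  have hs0 : 0 < s := by
    refine lt_of_le_of_ne hs.1 fun h => ?_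
    rw [← h, hini] at hup
    exact lt_irrefl _ hup
  obtain ⟨e, he, hsT, hy, hbound⟩ := hM _ hp
  change s ∈ Ico 0 T at hsT
  change y ∈ e.source at hy
  have hz := e.map_source hy
  have hval : (eval (slabPt hsT hz) (u e he)).re = density u s y := by
    rw [hu.density_eq he hsT hy, fn_of_mem (S := slab T e.target) (u e he) ⟨hsT, hz⟩]
  have hspace : IsLocalMax (fun v => (fn (u e he) (s, v)).re) (e y) := by
    filter_upwards [e.open_target.mem_nhds hz] with v hv
    rw [← hu.density_symm he hsT hv, ← hu.density_eq he hsT hy]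
    exact le_of_mul_le_mul_left (hmax s hs _) (Real.exp_pos _)
  have hlap' := hlap e he s hsT (e y) hz hspace
  obtain ⟨d, hd⟩ : ∃ d, d = (eval (slabPt hsT hz) ((slabWirtinger T e.open_target).dt (u e he))).re :=
    ⟨_, rfl⟩
  -- The maximum over [0,t] is in particular a maximum over [0,s] at the right end, so a one-sided
  -- derivative suffices; s may equal t.
  have htime : (M + 1) * density u s y ≤ d := by
    have h1 : HasDerivWithinAt (fun s' => density u s' y) d (Ico 0 T) s := by
      have h2 := hasDerivWithinAt_eval e.open_target (u e he) hsT hz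
        (u := fun s' => fn (u e he) (s', e y))
        (fun s' hs' => fn_of_mem (S := slab T e.target) (u e he) ⟨hs', hz⟩)
      have h3 : HasDerivWithinAt (fun s' => (fn (u e he) (s', e y)).re) d (Ico 0 T) s :=
        hd ▸ Complex.reCLM.hasFDerivAt.comp_hasDerivWithinAt s h2
      exact h3.congr (fun s' hs' => hu.density_eq he hs' hy) (hu.density_eq he hsT hy)
    have h2 : HasDerivWithinAt (fun s' => Real.exp (-(M + 1) * s')) (Real.exp (-(M + 1) * s) *
        -(M + 1)) (Icc 0 s) s := by
      have := ((hasDerivAt_id s).const_mul (-(M + 1))).exp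
      simpa using this.hasDerivWithinAt
    have hsub : Icc 0 s ⊆ Ico 0 T := fun s' hs' => ⟨hs'.1, hs'.2.trans_lt hsT.2⟩
    have h3 := derivative_nonneg_of_le_right_endpoint hs0 (h2.mul (h1.mono hsub)) fun s' hs' =>
      hmax s' ⟨hs'.1, hs'.2.trans hs.2⟩ y
    have h4 : 0 ≤ Real.exp (-(M + 1) * s) * (d - (M + 1) * density u s y) := by
      linarith
    linarith [(mul_nonneg_iff_of_pos_left (Real.exp_pos _)).1 h4]
  have hn' := hn e he (slabPt hsT hz)
  have hre : (eval (slabPt hsT hz) (2 * n e he *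
      (slabWirtinger T e.open_target).dt (u e he) - w e he)).re =
      2 * (eval (slabPt hsT hz) (n e he)).re * d - (eval (slabPt hsT hz) (w e he)).re := by
    rw [map_sub, map_mul, map_mul, map_ofNat, Complex.sub_re, Complex.mul_re, Complex.mul_re,
      Complex.mul_im, hni, ← hd]
    simp
  -- At the maximum the Laplacian term has a sign, so 2n(M+1)u ≤ 2n∂ₜu ≤ 2nMu, impossible for
  -- positive n and u.
  have hbound' := hre.symm.trans_le hbound
  rw [show (eval _ (u e he)).re = _ from hval] at hbound'
  have h5 := mul_le_mul_of_nonneg_left htime (mul_pos two_pos hn').le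
  have h6 := mul_pos (mul_pos two_pos hn') hup
  linarith

end MaximumPrinciple

/-! ### Preservation of the balanced condition on compact manifolds -/

section Compact

open SmoothAlg

theorem eval_lee_eq_zero_of_leeNormSq_nonpos {T : ℝ} {U : Set C3} {hU : IsOpen U}
    (X : HermitianData (slabWirtinger T hU)) {p : slab T U} {b : Matrix (Fin 3) (Fin 3) ℂ} {τ : ℝ}
    (hb : IsCoframe (X.H.map (eval p)) b τ) (h : (eval p X.leeNormSq).re ≤ 0) (q : Fin 3) :
    eval p (X.lee q) = 0 := by
  have h1 : ∑ q, ‖eval p (X.lee q)‖ ^ 2 ≤ 0 :=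
    (sum_norm_lee_sq_le X hb).trans (mul_nonpos_of_nonneg_of_nonpos hb.pos.le h)
  have h2 := Finset.single_le_sum (f := fun q => ‖eval p (X.lee q)‖ ^ 2)
    (fun q _ => by positivity) (Finset.mem_univ q)
  exact norm_eq_zero.1 (pow_eq_zero_iff two_ne_zero |>.1
    (le_antisymm (h2.trans h1) (by positivity)))

theorem eval_leeNormSq_eq_zero {T : ℝ} {U : Set C3} {hU : IsOpen U}
    (X : HermitianData (slabWirtinger T hU)) {p : slab T U} (h : ∀ q, eval p (X.lee q) = 0) :
    (eval p X.leeNormSq).re = 0 := by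
  rw [HermitianData.leeNormSq]
  simp [h]

variable {X : Type*} [TopologicalSpace X] [ChartedSpace C3 X] [IsManifold 𝓘(ℂ, C3) ω X]
  (Ω : HolVolumeForm X) {T : ℝ} {g : ℝ → HermitianMetric X} (hg : IsSmoothFamily T g)

/-- The volume norm in charts. -/
@[irreducible] def volNormAlg (e : OpenPartialHomeomorph X C3) (he : e ∈ atlas C3 X) :
    SmoothAlg (slab T e.target) :=
  (chartData Ω hg he).n

/-- The squared norm of `lee` in charts. -/
@[irreducible] def leeNormSqAlg (e : OpenPartialHomeomorph X C3) (he : e ∈ atlas C3 X) :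
    SmoothAlg (slab T e.target) :=
  (chartData Ω hg he).leeNormSq

/-- The Laplacian of the squared norm of `lee` in charts. -/
@[irreducible] def laplacianLeeNormSqAlg (e : OpenPartialHomeomorph X C3) (he : e ∈ atlas C3 X) :
    SmoothAlg (slab T e.target) :=
  (chartData Ω hg he).laplacian (chartData Ω hg he).leeNormSq

theorem isGlobal_leeNormSqAlg : IsGlobal (leeNormSqAlg Ω hg) := by
  intro e e' he he' t ht x hx hx'
  have hz : e x ∈ overlap e e' :=
    mem_overlap.2 ⟨e.map_source hx, by rwa [e.left_inv hx]⟩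
  have h1 : eval (slabPt ht (e.map_source hx)) (leeNormSqAlg Ω hg e he) =
      eval (slabPt ht (transition_mem hz)) (leeNormSqAlg Ω hg e' he') := by
    unfold leeNormSqAlg
    have h := eval_leeNormSq_transition Ω hg he he' ht hz
    with_reducible exact h
  have h2 : transition e e' (e x) = e' x := by rw [transition, e.left_inv hx]
  have h3 : slabPt ht (transition_mem hz) = slabPt ht (e'.map_source hx') :=
    Subtype.ext (Prod.ext rfl h2)
  exact h1.trans (congrArg (fun p => eval p (leeNormSqAlg Ω hg e' he')) h3)

theorem eval_volNormAlg (e : OpenPartialHomeomorph X C3) (he : e ∈ atlas C3 X)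
    (p : slab T e.target) :
    eval p (volNormAlg Ω hg e he) = (volNorm (Ω.coeff e p.1.2) ((g p.1.1).coeff e p.1.2) : ℂ) := by
  unfold volNormAlg
  exact eval_n Ω hg he p.2.1 p.2.2

theorem leeNormSqAlg_nonneg (e : OpenPartialHomeomorph X C3) (he : e ∈ atlas C3 X)
    (p : slab T e.target) : 0 ≤ (eval p (leeNormSqAlg Ω hg e he)).re := by
  obtain ⟨b, hb⟩ := exists_isCoframe_H Ω hg he p
  unfold leeNormSqAlg
  have := eval_leeNormSq_nonneg (chartData Ω hg he) hb
  with_reducible exact this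

variable [CompactSpace X] {slope : ℝ} {Φ : ℝ → RealForm X 4}

include hg in
/-- On a compact manifold the flow of the metric preserves the conformally balanced condition. -/
theorem isConformallyBalanced_of_isMetricFlow
    (hΦ : ∀ t ∈ Ico 0 T, IsClosedTwoTwoForm (Φ t)) (hbal : IsConformallyBalanced Ω (g 0))
    (h : IsMetricFlow Ω slope T Φ g) {t : ℝ} (ht : t ∈ Ico 0 T) :
    IsConformallyBalanced Ω (g t) := by
  have h0 : (0 : ℝ) ∈ Ico 0 T := ⟨le_rfl, ht.1.trans_lt ht.2⟩
  have hini : ∀ x, density (leeNormSqAlg Ω hg) 0 x = 0 := fun x => by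
    have hl := (isConformallyBalanced_iff Ω hg h0).1 hbal _ (chart_mem_atlas C3 x) _
      ((chartAt C3 x).map_source (mem_chart_source C3 x))
    rw [density_eq_eval _ h0]
    unfold leeNormSqAlg
    have := eval_leeNormSq_eq_zero (chartData Ω hg (chart_mem_atlas C3 x)) hl
    with_reducible exact this
  rw [isConformallyBalanced_iff Ω hg ht]
  intro e he z hz q
  -- Only |θ|² has to be a global function. The norm and the Laplacian enter at one point in one
  -- chart, the latter only through its sign at a spatial maximum, so their transformation laws are
  -- not needed.
  have h1 : density (leeNormSqAlg Ω hg) t (e.symm z) ≤ 0 :=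
    (isGlobal_leeNormSqAlg Ω hg).density_nonpos (n := volNormAlg Ω hg)
      (w := laplacianLeeNormSqAlg Ω hg)
      (fun e he p => by
        rw [eval_volNormAlg, Complex.ofReal_re]
        exact volNorm_coeff_pos Ω (g p.1.1) he p.2.2)
      (leeNormSqAlg_nonneg Ω hg)
      (fun e he => by
        unfold leeNormSqAlg volNormAlg laplacianLeeNormSqAlg
        have := exists_parabolic_bound (chartData Ω hg he)
          (divergenceEquation_of_isMetricFlow Ω hg hΦ h he) (continuous_metricTrace Ω hg he)
          (exists_isCoframe_H Ω hg he)
        with_reducible exact this)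
      (fun e he p => by rw [eval_volNormAlg, Complex.ofReal_im])
      (fun e he t ht z hz hmax => by
        obtain ⟨b, hb⟩ := exists_isCoframe_H Ω hg he (slabPt ht hz)
        unfold leeNormSqAlg at hmax
        unfold laplacianLeeNormSqAlg
        have := re_eval_laplacian_nonpos (chartData Ω hg he) _ ht hz hb hmax
        with_reducible exact this)
      hini ht _
  rw [(isGlobal_leeNormSqAlg Ω hg).density_symm he ht hz,
    fn_of_mem (S := slab T e.target) (leeNormSqAlg Ω hg e he) ⟨ht, hz⟩] at h1
  obtain ⟨b, hb⟩ := exists_isCoframe_H Ω hg he (slabPt ht hz)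
  unfold leeNormSqAlg at h1
  have := eval_lee_eq_zero_of_leeNormSq_nonpos (chartData Ω hg he) hb
  with_reducible exact this h1 q

end Compact

end AnomalyFlow

end

open AnomalyFlow in
theorem theorem1 {X : Type*} [TopologicalSpace X] [T2Space X] [ChartedSpace C3 X]
    [IsManifold 𝓘(ℂ, C3) ω X]
    (Ω : HolVolumeForm X) (slope T : ℝ) (hT : 0 < T)
    (Φ : ℝ → RealForm X 4) (hΦ : ∀ t ∈ Ico 0 T, IsClosedTwoTwoForm (Φ t))
    (g : ℝ → HermitianMetric X) (hg : IsSmoothFamily T g)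
    (hbal : IsConformallyBalanced Ω (g 0)) :
    (IsAnomalyFlow Ω slope T Φ g ↔
      ((∀ t ∈ Ico 0 T, IsConformallyBalanced Ω (g t)) ∧ IsMetricFlow Ω slope T Φ g)) ∧
    (CompactSpace X → (IsAnomalyFlow Ω slope T Φ g ↔ IsMetricFlow Ω slope T Φ g)) := by
  refine ⟨isAnomalyFlow_iff_balanced_and_isMetricFlow Ω hg hΦ hbal, fun hX => ?_⟩
  refine ⟨fun h => ((isAnomalyFlow_iff_balanced_and_isMetricFlow Ω hg hΦ hbal).1 h).2, fun h => ?_⟩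
  exact (isAnomalyFlow_iff_isMetricFlow Ω hg hΦ
    fun t ht => isConformallyBalanced_of_isMetricFlow Ω hg hΦ hbal h ht).2 h
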